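/- Let $n\ge 1$ and let $f:\{1,\dots,n\}\to\{1,\dots,n\}$ be a mapping chosen uniformly at random among all $n^n$ mappings. Let $N$ be the number of cyclic points of $f$, i.e. of points $x$ with $f^{k}(x)=x$ for some $k\ge 1$. For $r\ge 1$ let $\Lambda_r$ be the length of the $r$-th longest cycle of $f$ (cycle lengths listed in decreasing order with repetition), with $\Lambda_r=0$ if $f$ has fewer than $r$ cycles. For $x>0$ let $E(x)=\int_x^\infty \frac{e^{-t}}{t}\,dt$, and for integers $r,h\ge 1$ let $$G_{r,h}=\frac{1}{h!\,(r-1)!}\int_0^\infty x^{h-1}E(x)^{r-1}\exp\left[-E(x)-x\right]dx .$$ Then, for every $r\ge 1$, $$\lim_{n\to\infty}\frac{\mathbb{E}(\Lambda_rN)-\mathbb{E}(\Lambda_r)\,\mathbb{E}(N)}{\sqrt{\mathbb{V}(\Lambda_r)}\,\sqrt{\mathbb{V}(N)}}=\frac{\sqrt{2-\frac{\pi}{2}}\;G_{r,1}}{\sqrt{2G_{r,2}-\frac{\pi}{2}G_{r,1}^{2}}},$$ and the decimal expansion of this limit begins $0.83298010\ldots$ for $r=1$, $0.65486924\ldots$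 for $r=2$, $0.52094617\ldots$ for $r=3$ and $0.42505712\ldots$ for $r=4$ (digits truncated, not rounded). -/

import Mathlib

open MeasureTheory ProbabilityTheory Filter Topology
open scoped Nat

noncomputable section

namespace RandomMapping

/-- The uniform probability measure on the `n ^ n` mappings of an `n`-element set into itself. -/
def uniformMapping (n : ℕ) : Measure (Fin n → Fin n) :=
  uniformOn Set.univ

open Classical in
/-- The cyclic points of `f`: the points `x` with `f^[k] x = x` for some `k > 0`. -/
def cyclicPoints {n : ℕ} (f : Fin n → Fin n) : Finset (Fin n) :=
  Finset.univ.filter fun x => x ∈ Function.periodicPts f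

/-- The number `N` of cyclic points of `f`. -/
def numCyclicPoints {n : ℕ} (f : Fin n → Fin n) : ℕ :=
  (cyclicPoints f).card

open Classical in
/-- The set of cycles of (the functional graph of) `f`; fixed points are cycles of length `1`. -/
def cycles {n : ℕ} (f : Fin n → Fin n) : Finset (Cycle (Fin n)) :=
  (cyclicPoints f).image (Function.periodicOrbit f)

/-- The multiset of the lengths of the cycles of `f`. -/
def cycleLengths {n : ℕ} (f : Fin n → Fin n) : Multiset ℕ :=
  (cycles f).val.map Cycle.length

/-- The length `Λ_r` of the `r`-th longest cycle of `f`, `r ≥ 1` (lengths are listed in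
decreasing order with repetition); it is `0` if `f` has fewer than `r` cycles. -/
def longestCycle (r : ℕ) {n : ℕ} (f : Fin n → Fin n) : ℕ :=
  ((cycleLengths f).sort (· ≥ ·)).getD (r - 1) 0

/-- The correlation coefficient `(E(XY) - E(X) E(Y)) / (√V(X) √V(Y))` of `X` and `Y`. -/
def correlation {Ω : Type*} [MeasurableSpace Ω] (X Y : Ω → ℝ) (μ : Measure Ω) : ℝ :=
  ((∫ ω, X ω * Y ω ∂μ) - (∫ ω, X ω ∂μ) * (∫ ω, Y ω ∂μ)) /
    (√(variance X μ) * √(variance Y μ))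

/-- The exponential integral `E(x) = ∫ₓ^∞ e^{-t} / t dt`, for `x > 0`. -/
def expInt (x : ℝ) : ℝ :=
  ∫ t in Set.Ioi x, Real.exp (-t) / t

/-- `G_{r,h} = 1 / (h! (r-1)!) ∫₀^∞ x^{h-1} E(x)^{r-1} exp(-E(x) - x) dx`, for `r, h ≥ 1`. -/
def G (r h : ℕ) : ℝ :=
  1 / ((h ! : ℝ) * ((r - 1)! : ℝ)) *
    ∫ x in Set.Ioi (0 : ℝ), x ^ (h - 1) * expInt x ^ (r - 1) * Real.exp (-expInt x - x)

/-- The value `√(2 - π/2) G_{r,1} / √(2 G_{r,2} - (π/2) G_{r,1}²)`. -/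
def limitCorrelation (r : ℕ) : ℝ :=
  √(2 - Real.pi / 2) * G r 1 / √(2 * G r 2 - Real.pi / 2 * G r 1 ^ 2)

end RandomMapping

end

open MeasureTheory ProbabilityTheory Filter Topology
open scoped Nat

noncomputable section

/-! ### The exponential integral and the integrands of `G`. -/

namespace RandomMapping

/-! Given the set of cyclic points, a random mapping restricts to a uniformly random permutation of
it (`card_extensions_eq`, `card_filter_cyclicPerm`), and the number of mappings with a given cyclic
set depends only on its size (`mul_card_extensions`). So for a function g, the mean of Λ_r^h g(N) is
the sum over m of P(N = m) M_h(m) g(m), where M_h(m), called `permMoment`, is the h-th moment of the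
r-th longest cycle of a uniform permutation of m points (`mean_longestCycle_pow_mul`).

The permutation moments satisfy M_h(m) ~ G_{r,h} m^h. If the number of points is geometric with
parameter z, the number of cycles longer than k is Poisson with mean ∑_{j>k} z^j / j; analytically,
the generating function solves a linear differential equation (`powerSum_permDiff_eq`). With z =
e^{-t} and k ≈ x/t that mean is a Riemann sum tending to E(x). Dominated convergence and an
integration by parts then give the Abelian asymptotics of M_h (`tendsto_permMoment_abel`). As M_h is
monotone in m, Karamata's Tauberian theorem (`tendsto_div_pow_of_abel`) transfers them to M_h
itself.

For N, the tails P(N ≥ m) are the birthday probabilities n(n-1)…(n-m+1)/n^m. Hence E(N²) = 2n - E(N)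
exactly, and Laplace's method gives E(N) ~ √(πn/2). Since N tends to infinity on the scale √n,
`tendsto_cyclicMean` yields E(Λ_r) ~ G_{r,1} √(πn/2), E(Λ_r N) ~ 2 G_{r,1} n and E(Λ_r²) ~ 2 G_{r,2}
n. The quotient converges because the limiting variance of Λ_r/√n is positive: Cauchy–Schwarz for
Λ_r and N gives G_{r,1}² ≤ G_{r,2} in the limit (`sq_G_one_le`), and π/2 < 2.

The digits come from interval enclosures of the eight integrals in G_{r,1}, G_{r,2} with r ≤ 4.
Taylor models with integer coefficients treat the dyadic panels between 1/2 and 64. On (0, 1/2) the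
logarithm in E is split off and integrated exactly against polynomials. Everything is evaluated in
one kernel computation (`nearAll_table`), and `limitCorrelation_mem` converts the enclosures into
enclosures of the limit. -/

lemma integrableOn_exp_neg_div {x : ℝ} (hx : 0 < x) :
    IntegrableOn (fun t => Real.exp (-t) / t) (Set.Ioi x) := by
  have h := (integrableOn_exp_neg_Ioi x).mul_const (1 / x)
  refine h.mono' ?_ ?_
  · refine (ContinuousOn.div (by fun_prop) continuousOn_id fun t ht => ?_).aestronglyMeasurable
      measurableSet_Ioi
    exact (hx.trans ht).ne'
  · refine (ae_restrict_iff' measurableSet_Ioi).2 (Eventually.of_forall fun t ht => ?_)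
    have ht' : x < t := ht
    have : 0 < t := hx.trans ht
    rw [Real.norm_of_nonneg (by positivity), div_eq_mul_one_div]
    gcongr

lemma expInt_eq_add {x y : ℝ} (hx : 0 < x) (hxy : x ≤ y) :
    expInt x = (∫ t in x..y, Real.exp (-t) / t) + expInt y := by
  have h := integrableOn_exp_neg_div hx
  rw [expInt, expInt, intervalIntegral.integral_of_le hxy, ← setIntegral_union
    (Set.Ioc_disjoint_Ioi le_rfl) measurableSet_Ioi (h.mono_set Set.Ioc_subset_Ioi_self)
    (h.mono_set (Set.Ioi_subset_Ioi hxy)), Set.Ioc_union_Ioi_eq_Ioi hxy]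

lemma expInt_nonneg {x : ℝ} (hx : 0 < x) : 0 ≤ expInt x :=
  setIntegral_nonneg measurableSet_Ioi fun t ht => by
    have : 0 < t := hx.trans ht
    positivity

lemma expInt_le {x : ℝ} (hx : 0 < x) : expInt x ≤ Real.exp (-x) / x := by
  have h : ∫ t in Set.Ioi x, Real.exp (-t) * (1 / x) = Real.exp (-x) / x := by
    rw [integral_mul_const, integral_exp_neg_Ioi, mul_one_div]
  rw [← h]
  refine setIntegral_mono_on (integrableOn_exp_neg_div hx)
    ((integrableOn_exp_neg_Ioi x).mul_const _) measurableSet_Ioi fun t ht => ?_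
  have ht' : x < t := ht
  rw [div_eq_mul_one_div]
  gcongr

lemma continuousOn_exp_neg_div : ContinuousOn (fun t => Real.exp (-t) / t) (Set.Ioi (0 : ℝ)) :=
  ContinuousOn.div (by fun_prop) continuousOn_id fun _ ht => (Set.mem_Ioi.1 ht).ne'

lemma hasDerivAt_expInt {x : ℝ} (hx : 0 < x) :
    HasDerivAt expInt (-(Real.exp (-x) / x)) x := by
  have hy : x / 2 < x := by linarith
  have h1 : HasDerivAt (fun y => expInt (x / 2) - ∫ t in (x / 2)..y, Real.exp (-t) / t)
      (-(Real.exp (-x) / x)) x := by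
    have hc : ContinuousOn (fun t => Real.exp (-t) / t) (Set.uIcc (x / 2) x) :=
      continuousOn_exp_neg_div.mono fun t ht => by
        rw [Set.uIcc_of_le hy.le] at ht
        exact lt_of_lt_of_le (by positivity) ht.1
    have hc2 : ContinuousAt (fun t => Real.exp (-t) / t) x :=
      continuousOn_exp_neg_div.continuousAt (Ioi_mem_nhds hx)
    refine (intervalIntegral.integral_hasDerivAt_right hc.intervalIntegrable ?_ hc2).const_sub _
    exact continuousOn_exp_neg_div.stronglyMeasurableAtFilter isOpen_Ioi x hx
  refine h1.congr_of_eventuallyEq ?_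
  filter_upwards [Ioi_mem_nhds hy] with y hy'
  rw [expInt_eq_add (half_pos hx) (le_of_lt hy')]
  ring

lemma continuousOn_expInt : ContinuousOn expInt (Set.Ioi 0) :=
  fun _ hx => (hasDerivAt_expInt hx).continuousAt.continuousWithinAt

lemma pow_mul_exp_neg_le_factorial (k : ℕ) {y : ℝ} (hy : 0 ≤ y) :
    y ^ k * Real.exp (-y) ≤ k ! := by
  have h := Real.pow_div_factorial_le_exp y hy k
  rw [div_le_iff₀ (by positivity)] at h
  rw [Real.exp_neg, ← div_eq_mul_inv, div_le_iff₀ (Real.exp_pos _)]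
  linarith

/-- The integrand of `G (i + 1) (h + 1)`. -/
def integrandG (i h : ℕ) (x : ℝ) : ℝ := x ^ h * expInt x ^ i * Real.exp (-expInt x - x)

lemma G_succ_succ (i h : ℕ) : G (i + 1) (h + 1) =
    1 / (((h + 1) ! : ℝ) * (i ! : ℝ)) * ∫ x in Set.Ioi (0 : ℝ), integrandG i h x := rfl

lemma integrandG_nonneg (i h : ℕ) {x : ℝ} (hx : 0 < x) : 0 ≤ integrandG i h x := by
  have := expInt_nonneg hx
  unfold integrandG
  positivity

/-- Although `expInt` is unbounded near 0, y^i e^{-y} ≤ i! for y ≥ 0 absorbs its power into the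
factor exp(-E). The remaining Gamma integrand serves both integrability and the tail beyond 64. -/
lemma integrandG_le (i h : ℕ) {x : ℝ} (hx : 0 < x) :
    integrandG i h x ≤ i ! * (x ^ h * Real.exp (-x)) := by
  have h1 := pow_mul_exp_neg_le_factorial i (expInt_nonneg hx)
  have h2 : integrandG i h x = expInt x ^ i * Real.exp (-expInt x) * (x ^ h * Real.exp (-x)) := by
    rw [integrandG, sub_eq_add_neg, Real.exp_add]; ring
  rw [h2]
  gcongr

lemma integrableOn_pow_mul_exp_neg (h : ℕ) :
    IntegrableOn (fun x : ℝ => x ^ h * Real.exp (-x)) (Set.Ioi 0) := by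
  have := Real.GammaIntegral_convergent (s := h + 1) (by positivity)
  refine this.congr_fun (fun x hx => ?_) measurableSet_Ioi
  simp only [add_sub_cancel_right, Real.rpow_natCast]
  ring

lemma continuousOn_integrandG (i h : ℕ) : ContinuousOn (integrandG i h) (Set.Ioi 0) := by
  have := continuousOn_expInt
  unfold integrandG
  fun_prop

lemma integrableOn_integrandG (i h : ℕ) : IntegrableOn (integrandG i h) (Set.Ioi 0) := by
  refine ((integrableOn_pow_mul_exp_neg h).const_mul (i ! : ℝ)).mono'
    ((continuousOn_integrandG i h).aestronglyMeasurable measurableSet_Ioi) ?_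
  refine (ae_restrict_iff' measurableSet_Ioi).2 (Eventually.of_forall fun x hx => ?_)
  rw [Real.norm_of_nonneg (integrandG_nonneg i h hx)]
  exact integrandG_le i h hx

lemma G_pos (i h : ℕ) : 0 < G (i + 1) (h + 1) := by
  rw [G_succ_succ]
  refine mul_pos (by positivity) ?_
  rw [setIntegral_pos_iff_support_of_nonneg_ae _ (integrableOn_integrandG i h)]
  · refine lt_of_lt_of_le (b := volume (Set.Ioi (0 : ℝ))) (by simp) (measure_mono fun x hx => ⟨?_, hx⟩)
    have hx' : 0 < x := hx
    have h1 : 0 < expInt x := by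
      rw [expInt_eq_add hx' (by linarith : x ≤ x + 1)]
      refine add_pos_of_pos_of_nonneg ?_ (expInt_nonneg (by positivity))
      refine intervalIntegral.intervalIntegral_pos_of_pos_on ?_ (fun t ht => ?_) (by linarith)
      · refine (continuousOn_exp_neg_div.mono fun t ht => ?_).intervalIntegrable
        rw [Set.uIcc_of_le (by linarith)] at ht
        exact lt_of_lt_of_le hx' ht.1
      · have : 0 < t := hx'.trans ht.1
        positivity
    have : 0 < integrandG i h x := by unfold integrandG; positivity
    exact this.ne'
  · exact (ae_restrict_iff' measurableSet_Ioi).2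
      (Eventually.of_forall fun x hx => integrandG_nonneg i h hx)

lemma integral_pow_mul_exp_neg_mul (m k : ℕ) :
    ∫ y in Set.Ioi (0 : ℝ), y ^ m * Real.exp (-((k + 1) * y)) = m ! / (k + 1 : ℝ) ^ (m + 1) := by
  have h := Real.integral_rpow_mul_exp_neg_mul_Ioi (a := m + 1) (r := k + 1) (by positivity)
    (by positivity)
  rw [Real.Gamma_nat_eq_factorial] at h
  rw [add_sub_cancel_right] at h
  simp only [Real.rpow_natCast] at h
  rw [h, show ((m : ℝ) + 1) = ((m + 1 : ℕ) : ℝ) by push_cast; rfl, Real.rpow_natCast]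
  simp only [one_div, inv_pow]
  field_simp

end RandomMapping

/-! ### Fixed-point Taylor models with coefficients packed into one integer. -/

namespace RandomMapping

namespace TaylorModel

/-- Polynomials with integer coefficients, constant coefficient first. -/
abbrev Poly := List ℤ

/-- The polynomial `a * q + r`. -/
def axpy (a : ℤ) : Poly → Poly → Poly
  | [], r => r
  | b :: q, [] => a * b :: axpy a q []
  | b :: q, c :: r => (a * b + c) :: axpy a q r

/-- The product of two polynomials. -/
def mulP : Poly → Poly → Poly
  | [], q => List.replicate q.length 0
  | a :: p, q => axpy a q (0 :: mulP p q)

/-- Division of the coefficients by `k, k + i, k + 2 * i, …`, rounded down. -/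
def divP (i : ℕ) : ℕ → Poly → Poly
  | _, [] => []
  | k, a :: p => a / k :: divP i (k + i) p

/-- The sum of the absolute values of the coefficients. -/
def normP : Poly → ℤ
  | [] => 0
  | a :: p => (Int.natAbs a : ℤ) + normP p

/-- Evaluation at an integer. -/
def evalZ : Poly → ℤ → ℤ
  | [], _ => 0
  | a :: p, s => a + s * evalZ p s

/-- Evaluation at a real number. -/
def evalR : Poly → ℝ → ℝ
  | [], _ => 0
  | a :: p, s => a + s * evalR p s

/-- `forceNat n k = k n`, but the kernel normalises `n` before it unfolds `k`. -/
def forceNat {β : Type} (n : ℕ) (k : ℕ → β) : β :=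
  Nat.rec (k 0) (fun m _ => k (Nat.succ m)) n

/-- `forceInt n k = k n`, with `n` normalised first. -/
def forceInt {β : Type} (n : ℤ) (k : ℤ → β) : β :=
  Int.rec (fun m => forceNat m fun m' => k (Int.ofNat m'))
    (fun m => forceNat m fun m' => k (Int.negSucc m')) n

@[simp] lemma forceNat_eq {β : Type} (n : ℕ) (k : ℕ → β) : forceNat n k = k n := by
  cases n <;> rfl

@[simp] lemma forceInt_eq {β : Type} (n : ℤ) (k : ℤ → β) : forceInt n k = k n := by
  cases n <;> simp [forceInt]

/-- The base in which the coefficients of a polynomial are packed into one integer. -/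
def base : ℕ := Nat.pow 2 180

/-- Half of `base`. The natural number with the digits `a + half` stands for the polynomial with
the coefficients `a`. -/
def half : ℕ := Nat.pow 2 179

/-- The fixed-point unit: an integer `m` stands for the real number `m / unit`. -/
def unit : ℕ := Nat.pow 2 80

/-- The number with `n` digits `half`. -/
def offset (n : ℕ) : ℕ := Nat.rec 0 (fun _ ih => Nat.add half (Nat.mul base ih)) n

/-- Digitwise counterpart of `divP`, for `n` digits. -/
def divLoop (i n : ℕ) : ℕ → ℕ → ℕ :=
  Nat.rec (fun _ _ => 0) (fun _ ih k N => Nat.add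
    (Nat.div (Nat.add (Nat.mod N base) (Nat.mul (Nat.pred k) half)) k)
    (Nat.mul base (ih (Nat.add k i) (Nat.div N base)))) n

/-- Digitwise counterpart of `normP`, for `n` digits. -/
def normLoop (n : ℕ) : ℕ → ℕ :=
  Nat.rec (fun _ => 0) (fun _ ih N => Nat.add
    (Nat.add (Nat.sub (Nat.mod N base) half) (Nat.sub half (Nat.mod N base)))
    (ih (Nat.div N base))) n

/-- Digitwise counterpart of `evalZ`, for `n` digits. -/
def evalLoop (s : ℤ) (n : ℕ) : ℕ → ℤ :=
  Nat.rec (fun _ => 0) (fun _ ih N => Int.ofNat (Nat.mod N base) - Int.ofNat half +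
    s * ih (Nat.div N base)) n

/-- The number whose digits are the coefficients plus `half`. -/
def encode : Poly → ℕ
  | [] => 0
  | a :: p => (a + half).toNat + base * encode p

/-- A packed polynomial with an error bound and a bound on the norm. -/
structure Model where
  poly : ℤ
  err : ℤ
  norm : ℤ

/-- `force f k = k f`, with the fields of `f` normalised first. -/
def force {β : Type} (f : Model) (k : Model → β) : β :=
  forceInt f.poly fun p => forceInt f.err fun e => forceInt f.norm fun m => k ⟨p, e, m⟩

@[simp] lemma force_eq {β : Type} (f : Model) (k : Model → β) : force f k = k f := by
  simp [force]

/-- `f` is a Taylor model of the function `u` on `[c, 1]`, with at most `n` coefficients. -/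
def IsModel (n : ℕ) (c : ℝ) (u : ℝ → ℝ) (f : Model) : Prop :=
  ∃ p : Poly, p.length ≤ n ∧ f.poly = evalZ p base ∧ normP p ≤ f.norm ∧
    ∀ s ∈ Set.Icc c 1, |u s * unit - evalR p s| ≤ f.err

def ofPoly (p : Poly) (e : ℤ) : Model := ⟨evalZ p base, e, normP p⟩

def add (f g : Model) : Model := ⟨f.poly + g.poly, f.err + g.err, f.norm + g.norm⟩

def neg (f : Model) : Model := ⟨-f.poly, f.err, f.norm⟩

/-- The product, with the terms of degree at least `32` moved to the error bound. -/
def mul (f g : Model) : Model :=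
  if f.norm * g.norm < half then
    forceNat (divLoop 0 66 unit (f.poly * g.poly + offset 66).toNat) fun R =>
      ⟨Int.ofNat (Nat.mod R (Nat.pow base 32)) - offset 32,
        (f.err * g.norm + g.err * f.norm + f.err * g.err) / unit + 67 +
          normLoop 34 (Nat.div R (Nat.pow base 32)),
        normLoop 32 (Nat.mod R (Nat.pow base 32))⟩
  else ⟨0, (f.err + f.norm) * (g.err + g.norm) / unit + 1, 0⟩

def divNat (f : Model) (k : ℕ) : Model :=
  if f.norm < half then
    ⟨Int.ofNat (divLoop 0 33 k (f.poly + offset 33).toNat) - offset 33, f.err + 33, f.norm / k + 34⟩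
  else ⟨0, f.err + f.norm, 0⟩

/-- A model of `s ↦ ∫₀ˢ f`. -/
def primitive (f : Model) : Model :=
  if f.norm < half then
    ⟨base * (Int.ofNat (divLoop 1 32 1 (f.poly + offset 32).toNat) - offset 32), f.err + 32, f.norm⟩
  else ⟨0, f.err + f.norm, 0⟩

/-- A model of the value of `f` at `s`, for `s = ± 1`. -/
def evalAt (f : Model) (s : ℤ) : Model :=
  if f.norm < half then forceInt (evalLoop s 33 (f.poly + offset 33).toNat) fun a => ⟨a, f.err, a.natAbs⟩
  else ⟨0, f.err + f.norm, 0⟩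

def one : Model := ⟨unit, 0, unit⟩

/-- A model of the Taylor polynomial of `exp` of degree `n`; see `hornerFun`. -/
def horner (f : Model) : ℕ → ℕ → Model
  | 0, _ => one
  | n + 1, k => force (mul f (horner f n (k + 1))) fun r => add one (divNat r k)

/-- A model of `exp (f / 8) ^ 8`, for `|f| ≤ 2`. -/
def expModel (f : Model) : Model :=
  force (divNat f 8) fun g => force (horner g 12 1) fun r =>
  force ⟨r.poly, r.err + (unit / 380000000000000000 + 1), r.norm⟩ fun r =>
  force (mul r r) fun r => force (mul r r) fun r => mul r r

@[simp] lemma evalR_nil (s : ℝ) : evalR [] s = 0 := rfl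

@[simp] lemma evalR_cons (a : ℤ) (p : Poly) (s : ℝ) : evalR (a :: p) s = a + s * evalR p s := rfl

lemma evalR_axpy (a : ℤ) (q r : Poly) (s : ℝ) :
    evalR (axpy a q r) s = a * evalR q s + evalR r s := by
  induction q generalizing r with
  | nil => simp [axpy]
  | cons b q ih =>
    cases r with
    | nil => simp [axpy, ih]; ring
    | cons c r => simp [axpy, ih]; ring

lemma evalR_replicate_zero (n : ℕ) (s : ℝ) : evalR (List.replicate n 0) s = 0 := by
  induction n with
  | zero => rfl
  | succ n ih => simp [List.replicate_succ, ih]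

lemma normP_replicate_zero (n : ℕ) : normP (List.replicate n 0) = 0 := by
  induction n with
  | zero => rfl
  | succ n ih => simp [List.replicate_succ, normP, ih]

lemma evalR_mulP (p q : Poly) (s : ℝ) : evalR (mulP p q) s = evalR p s * evalR q s := by
  induction p with
  | nil => simp [mulP, evalR_replicate_zero]
  | cons a p ih => simp [mulP, evalR_axpy, ih]; ring

lemma evalR_intCast (p : Poly) (s : ℤ) : evalR p s = (evalZ p s : ℤ) := by
  induction p with
  | nil => simp [evalZ]
  | cons a p ih => simp [evalZ, ih]

lemma abs_evalR_le (p : Poly) {s : ℝ} (hs : |s| ≤ 1) : |evalR p s| ≤ normP p := by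
  induction p with
  | nil => simp [normP]
  | cons a p ih =>
    simp only [evalR_cons, normP, Int.cast_add]
    refine (abs_add_le _ _).trans (add_le_add ?_ ?_)
    · rw [Int.natCast_natAbs, Int.cast_abs]
    · rw [abs_mul]
      exact (mul_le_of_le_one_left (abs_nonneg _) hs).trans ih

lemma normP_nonneg (p : Poly) : 0 ≤ normP p := by
  induction p with
  | nil => simp [normP]
  | cons a p ih => simp only [normP]; positivity

lemma normP_axpy_le (a : ℤ) (q r : Poly) : normP (axpy a q r) ≤ |a| * normP q + normP r := by
  induction q generalizing r with
  | nil => simp [axpy, normP]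
  | cons b q ih =>
    cases r with
    | nil =>
      have := ih []
      simp only [axpy, normP, Int.natCast_natAbs, abs_mul] at *
      linarith
    | cons c r =>
      have := ih r
      have h := abs_add_le (a * b) c
      simp only [axpy, normP, Int.natCast_natAbs, abs_mul] at *
      linarith

lemma normP_mulP_le (p q : Poly) : normP (mulP p q) ≤ normP p * normP q := by
  induction p with
  | nil => simp [mulP, normP_replicate_zero, normP]
  | cons a p ih =>
    have := normP_axpy_le a q (0 :: mulP p q)
    simp only [mulP, normP, Int.natCast_natAbs, abs_zero, zero_add] at *
    linarith

lemma length_axpy (a : ℤ) {q r : Poly} (h : q.length ≤ r.length) :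
    (axpy a q r).length = r.length := by
  induction q generalizing r with
  | nil => rfl
  | cons b q ih =>
    cases r with
    | nil => simp at h
    | cons c r => simpa [axpy] using ih (by simpa using h)

lemma length_axpy_le {a : ℤ} {q r : Poly} {n : ℕ} (hq : q.length ≤ n) (hr : r.length ≤ n) :
    (axpy a q r).length ≤ n := by
  induction q generalizing r n with
  | nil => simpa [axpy] using hr
  | cons b q ih =>
    obtain ⟨n, rfl⟩ : ∃ m, n = m + 1 := ⟨n - 1, by simp at hq; omega⟩
    cases r with
    | nil => simpa [axpy] using ih (n := n) (by simpa using hq) (Nat.zero_le _)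
    | cons c r => simpa [axpy] using ih (n := n) (by simpa using hq) (by simpa using hr)

lemma length_mulP (p q : Poly) : (mulP p q).length = p.length + q.length := by
  induction p with
  | nil => simp [mulP]
  | cons a p ih =>
    rw [mulP, length_axpy] <;> simp [ih] <;> omega

lemma length_divP (i k : ℕ) (p : Poly) : (divP i k p).length = p.length := by
  induction p generalizing k with
  | nil => rfl
  | cons a p ih => simp [divP, ih]

lemma abs_div_le (a : ℤ) {k : ℕ} (hk : 0 < k) : |a / (k : ℤ)| ≤ |a| := by
  have hk' : (1 : ℤ) ≤ k := by exact_mod_cast hk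
  rw [abs_le]
  refine ⟨?_, Int.ediv_le_of_le_mul (by omega) ?_⟩
  · rw [Int.le_ediv_iff_mul_le (by omega)]
    nlinarith [neg_abs_le a, abs_nonneg a]
  · nlinarith [le_abs_self a, abs_nonneg a]

lemma normP_divP_le (i : ℕ) {k : ℕ} (hk : 0 < k) (p : Poly) : normP (divP i k p) ≤ normP p := by
  induction p generalizing k with
  | nil => simp [divP]
  | cons a p ih =>
    have := abs_div_le a hk
    have := ih (k := k + i) (by omega)
    simp only [divP, normP, Int.natCast_natAbs]
    linarith

lemma normP_append (p q : Poly) : normP (p ++ q) = normP p + normP q := by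
  induction p with
  | nil => simp [normP]
  | cons a p ih => simp [normP, ih, add_assoc]

lemma evalR_append_zero (p : Poly) (n : ℕ) (s : ℝ) :
    evalR (p ++ List.replicate n 0) s = evalR p s := by
  induction p with
  | nil => exact evalR_replicate_zero n s
  | cons a p ih => simp [ih]

lemma evalZ_append_zero (p : Poly) (n : ℕ) (s : ℤ) :
    evalZ (p ++ List.replicate n 0) s = evalZ p s := by
  have := evalR_append_zero p n s
  simpa only [evalR_intCast, Int.cast_inj] using this

lemma evalZ_mulP (p q : Poly) (s : ℤ) : evalZ (mulP p q) s = evalZ p s * evalZ q s := by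
  have := evalR_mulP p q s
  simp only [evalR_intCast] at this
  exact_mod_cast this

lemma base_eq : base = 2 * half := by decide +kernel

lemma half_pos : 0 < half := by decide +kernel

lemma offset_succ (n : ℕ) : offset (n + 1) = half + base * offset n := rfl

lemma divLoop_succ (i n k N : ℕ) : divLoop i (n + 1) k N =
    (N % base + (k - 1) * half) / k + base * divLoop i n (k + i) (N / base) := rfl

lemma normLoop_succ (n N : ℕ) : normLoop (n + 1) N =
    (N % base - half) + (half - N % base) + normLoop n (N / base) := rfl

lemma evalLoop_succ (s : ℤ) (n N : ℕ) : evalLoop s (n + 1) N =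
    ((N % base : ℕ) : ℤ) - (half : ℤ) + s * evalLoop s n (N / base) := rfl

section Encode

variable {a : ℤ} {p : Poly}

/-- A norm below `half` keeps every shifted coefficient a + half strictly between 0 and `base`. So
the digits do not interact, and a packed integer determines its polynomial; every lemma on `encode`
rests on this. -/
lemma head_mem (h : normP (a :: p) < half) : -(half : ℤ) < a ∧ a < half := by
  simp only [normP, Int.natCast_natAbs] at h
  exact abs_lt.1 (by linarith [normP_nonneg p])

lemma normP_tail_lt {b : ℤ} (h : normP (a :: p) < b) : normP p < b := by
  simp only [normP] at h
  linarith [Int.natCast_nonneg a.natAbs]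

lemma encode_mod (h : normP (a :: p) < half) : encode (a :: p) % base = (a + half).toNat := by
  have := head_mem h
  rw [encode, Nat.add_mul_mod_self_left, Nat.mod_eq_of_lt]
  have := base_eq
  omega

lemma encode_div (h : normP (a :: p) < half) : encode (a :: p) / base = encode p := by
  have := head_mem h
  have hb := base_eq
  have := half_pos
  rw [encode, Nat.add_mul_div_left _ _ (by omega), Nat.div_eq_of_lt (by omega), zero_add]

lemma encode_eq (h : normP p < half) : (encode p : ℤ) = evalZ p base + offset p.length := by
  induction p with
  | nil => rfl
  | cons a p ih =>
    have := head_mem h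
    rw [encode, evalZ, List.length_cons, offset_succ]
    push_cast
    rw [ih (normP_tail_lt h), Int.toNat_of_nonneg (by omega)]
    ring

lemma evalZ_add_offset (h : normP p < half) :
    (evalZ p base + offset p.length).toNat = encode p := by
  rw [← encode_eq h, Int.toNat_natCast]

lemma divLoop_encode (i : ℕ) {k : ℕ} (hk : 0 < k) (h : normP p < half) :
    divLoop i p.length k (encode p) = encode (divP i k p) := by
  induction p generalizing k with
  | nil => rfl
  | cons a p ih =>
    have ha := head_mem h
    rw [List.length_cons, divLoop_succ, encode_mod h, encode_div h,
      ih (k := k + i) (by omega) (normP_tail_lt h), divP, encode]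
    congr 1
    obtain ⟨k, rfl⟩ : ∃ m, k = m + 1 := ⟨k - 1, by omega⟩
    -- The divisor is now k + 1. Adding k further copies of `half` to the digit makes the total
    -- shift a multiple of the divisor, so the quotient is again a digit with shift exactly `half`,
    -- and natural division rounds as integer division does.
    have h1 : (((a + half).toNat + k * half : ℕ) : ℤ) = a + (k + 1 : ℕ) * half := by
      push_cast
      rw [Int.toNat_of_nonneg (by omega)]; ring
    have h2 : ((((a + half).toNat + k * half) / (k + 1) : ℕ) : ℤ) = a / (k + 1 : ℕ) + half := by
      rw [Int.natCast_div, h1, Int.add_mul_ediv_left _ _ (by positivity)]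
    rw [Nat.add_sub_cancel, ← h2, Int.toNat_natCast]

lemma normLoop_encode (h : normP p < half) : (normLoop p.length (encode p) : ℤ) = normP p := by
  induction p with
  | nil => rfl
  | cons a p ih =>
    have ha := head_mem h
    rw [List.length_cons, normLoop_succ, encode_mod h, encode_div h, normP, Nat.cast_add,
      ih (normP_tail_lt h)]
    congr 1
    omega

lemma evalLoop_encode (s : ℤ) (h : normP p < half) :
    evalLoop s p.length (encode p) = evalZ p s := by
  induction p with
  | nil => rfl
  | cons a p ih =>
    have ha := head_mem h
    rw [List.length_cons, evalLoop_succ, encode_mod h, encode_div h, evalZ, ih (normP_tail_lt h),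
      Int.toNat_of_nonneg (by omega)]
    ring

lemma encode_mod_pow (m : ℕ) (h : normP p < half) (hm : m ≤ p.length) :
    encode p % base ^ m = encode (p.take m) := by
  induction m generalizing p with
  | zero => simp [Nat.mod_one, encode]
  | succ m ih =>
    cases p with
    | nil => simp at hm
    | cons a p =>
      rw [pow_succ', Nat.mod_mul, encode_mod h, encode_div h,
        ih (normP_tail_lt h) (by simpa using hm)]
      rfl

lemma encode_div_pow (m : ℕ) (h : normP p < half) (hm : m ≤ p.length) :
    encode p / base ^ m = encode (p.drop m) := by
  induction m generalizing p with
  | zero => simp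
  | succ m ih =>
    cases p with
    | nil => simp at hm
    | cons a p =>
      rw [pow_succ', ← Nat.div_div_eq_div_mul, encode_div h,
        ih (normP_tail_lt h) (by simpa using hm)]
      rfl

end Encode

lemma abs_div_sub_le (a : ℤ) {k : ℤ} (hk : 0 < k) : |(a : ℝ) / k - (a / k : ℤ)| ≤ 1 := by
  have hk' : (0 : ℝ) < k := by exact_mod_cast hk
  have h : (a : ℝ) = k * (a / k : ℤ) + (a % k : ℤ) := by exact_mod_cast (Int.mul_ediv_add_emod a k).symm
  have h1 : (0 : ℝ) ≤ (a % k : ℤ) := by exact_mod_cast Int.emod_nonneg a hk.ne'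
  have h2 : ((a % k : ℤ) : ℝ) ≤ k := by exact_mod_cast (Int.emod_lt_of_pos a hk).le
  have h3 : (a : ℝ) / k - (a / k : ℤ) = (a % k : ℤ) / k := by
    rw [h]; field_simp; simp
  rw [h3, abs_of_nonneg (by positivity)]
  exact div_le_one_of_le₀ h2 hk'.le

lemma abs_evalR_divP (p : Poly) {m : ℕ} (hm : 0 < m) {s : ℝ} (hs : |s| ≤ 1) :
    |evalR p s / m - evalR (divP 0 m p) s| ≤ p.length := by
  induction p with
  | nil => simp [divP]
  | cons a p ih =>
    have h1 := abs_div_sub_le a (k := m) (by exact_mod_cast hm)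
    have h2 : |s * (evalR p s / m - evalR (divP 0 m p) s)| ≤ p.length := by
      rw [abs_mul]; exact (mul_le_of_le_one_left (abs_nonneg _) hs).trans ih
    simp only [evalR_cons, divP, List.length_cons, Nat.cast_add, Nat.cast_one, add_zero]
    push_cast at h1
    calc _ = |((a : ℝ) / m - (a / m : ℤ)) + s * (evalR p s / m - evalR (divP 0 m p) s)| := by
            congr 1; ring
      _ ≤ _ := (abs_add_le _ _).trans (by linarith)

lemma normP_divP_zero_le (p : Poly) {m : ℕ} (hm : 0 < m) :
    normP (divP 0 m p) ≤ normP p / m + 1 + p.length := by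
  have hm' : (0 : ℤ) < m := by exact_mod_cast hm
  have key : m * normP (divP 0 m p) ≤ normP p + m * p.length := by
    induction p with
    | nil => simp [divP, normP]
    | cons a p ih =>
      have h1 : m * |a / (m : ℤ)| ≤ |a| + m := by
        have h2 := Int.mul_ediv_add_emod a m
        have h3 := Int.emod_nonneg a hm'.ne'
        have h4 := Int.emod_lt_of_pos a hm'
        rw [← abs_of_pos hm', ← abs_mul, abs_of_pos hm', abs_le]
        constructor <;> linarith [neg_abs_le a, le_abs_self a]
      simp only [divP, normP, Int.natCast_natAbs, List.length_cons, add_zero]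
      push_cast
      linarith
  have h5 : normP (divP 0 m p) - p.length ≤ normP p / m :=
    (Int.le_ediv_iff_mul_le hm').2 (by linarith)
  linarith

lemma evalR_take_add_drop (n : ℕ) (p : Poly) (s : ℝ) :
    evalR p s = evalR (p.take n) s + s ^ n * evalR (p.drop n) s := by
  induction n generalizing p with
  | zero => simp
  | succ n ih =>
    cases p with
    | nil => simp
    | cons a p => simp [ih p]; ring

lemma normP_take_add_drop (n : ℕ) (p : Poly) :
    normP (p.take n) + normP (p.drop n) = normP p := by
  rw [← normP_append, List.take_append_drop]

lemma unit_pos : (0 : ℝ) < (unit : ℝ) := by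
  have : 0 < unit := by decide +kernel
  exact_mod_cast this

attribute [irreducible] base half unit offset divLoop normLoop evalLoop

variable {n m : ℕ} {c : ℝ} {u v : ℝ → ℝ} {f g : Model}

lemma isModel_ofPoly {p : Poly} {e : ℤ} (hp : p.length ≤ n)
    (h : ∀ s ∈ Set.Icc c 1, |u s * unit - evalR p s| ≤ e) : IsModel n c u (ofPoly p e) :=
  ⟨p, hp, rfl, le_rfl, h⟩

lemma IsModel.err_nonneg (hf : IsModel n c u f) (hc : c ≤ 0) : (0 : ℝ) ≤ f.err := by
  obtain ⟨p, -, -, -, h⟩ := hf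
  exact (abs_nonneg _).trans (h 0 ⟨hc, zero_le_one⟩)

lemma IsModel.norm_nonneg (hf : IsModel n c u f) : 0 ≤ f.norm := by
  obtain ⟨p, -, -, h, -⟩ := hf
  exact (normP_nonneg p).trans h

lemma IsModel.congr (hf : IsModel n c u f) (h : ∀ s ∈ Set.Icc c 1, v s = u s) :
    IsModel n c v f := by
  obtain ⟨p, h1, h2, h3, h4⟩ := hf
  exact ⟨p, h1, h2, h3, fun s hs => by rw [h s hs]; exact h4 s hs⟩

lemma IsModel.mono (hf : IsModel n c u f) (h : n ≤ m) : IsModel m c u f := by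
  obtain ⟨p, h1, h2⟩ := hf
  exact ⟨p, h1.trans h, h2⟩

lemma IsModel.exists_length_eq (hf : IsModel n c u f) :
    ∃ p : Poly, p.length = n ∧ f.poly = evalZ p base ∧ normP p ≤ f.norm ∧
      ∀ s ∈ Set.Icc c 1, |u s * unit - evalR p s| ≤ f.err := by
  obtain ⟨p, h1, h2, h3, h4⟩ := hf
  refine ⟨p ++ List.replicate (n - p.length) 0, by simp; omega, ?_, ?_, ?_⟩
  · rw [evalZ_append_zero, h2]
  · rwa [normP_append, normP_replicate_zero, add_zero]
  · simpa only [evalR_append_zero] using h4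

lemma IsModel.abs_le (hf : IsModel n c u f) (hc : -1 ≤ c) {s : ℝ} (hs : s ∈ Set.Icc c 1) :
    |u s| * unit ≤ f.err + f.norm := by
  obtain ⟨p, -, -, h3, h4⟩ := hf
  have hs1 : |s| ≤ 1 := _root_.abs_le.2 ⟨hc.trans hs.1, hs.2⟩
  have h5 : |evalR p s| ≤ f.norm := (abs_evalR_le p hs1).trans (by exact_mod_cast h3)
  rw [← abs_of_pos unit_pos, ← abs_mul]
  calc |u s * unit| = |(u s * unit - evalR p s) + evalR p s| := by congr 1; ring
    _ ≤ _ := (abs_add_le _ _).trans (add_le_add (h4 s hs) h5)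

/-- This covers the branches in which packed arithmetic might overflow: the operation then returns
the zero polynomial with the whole size of the function as error. Each operation is thus sound
without a side condition on norms; an overflow could only spoil the precision. -/
lemma isModel_zero {e : ℤ} (h : ∀ s ∈ Set.Icc c 1, |u s| * unit ≤ e) :
    IsModel n c u ⟨0, e, 0⟩ :=
  ⟨[], by simp, rfl, le_rfl, fun s hs => by
    rw [evalR_nil, sub_zero, abs_mul, abs_of_pos unit_pos]; exact h s hs⟩

lemma IsModel.add (hf : IsModel n c u f) (hg : IsModel n c v g) :
    IsModel n c (fun s => u s + v s) (add f g) := by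
  obtain ⟨p, h1, h2, h3, h4⟩ := hf
  obtain ⟨q, k1, k2, k3, k4⟩ := hg
  refine ⟨axpy 1 p q, length_axpy_le h1 k1, ?_, ?_, fun s hs => ?_⟩
  · have := evalR_axpy 1 p q (base : ℤ)
    simp only [evalR_intCast, Int.cast_one, one_mul] at this
    rw [TaylorModel.add, h2, k2]
    exact_mod_cast this.symm
  · have := normP_axpy_le 1 p q
    simp only [abs_one, one_mul] at this
    exact this.trans (add_le_add h3 k3)
  · simp only [TaylorModel.add, evalR_axpy, Int.cast_add, Int.cast_one, one_mul]
    calc _ = |(u s * unit - evalR p s) + (v s * unit - evalR q s)| := by congr 1; ring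
      _ ≤ _ := (abs_add_le _ _).trans (add_le_add (h4 s hs) (k4 s hs))

lemma IsModel.neg (hf : IsModel n c u f) : IsModel n c (fun s => -u s) (neg f) := by
  obtain ⟨p, h1, h2, h3, h4⟩ := hf
  refine ⟨axpy (-1) p [], length_axpy_le h1 (by simp), ?_, ?_, fun s hs => ?_⟩
  · have := evalR_axpy (-1) p [] (base : ℤ)
    simp only [evalR_intCast, Int.cast_neg, Int.cast_one, neg_one_mul, evalZ, Int.cast_zero,
      add_zero] at this
    rw [TaylorModel.neg, h2]
    exact_mod_cast this.symm
  · have := normP_axpy_le (-1) p []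
    simp only [abs_neg, abs_one, one_mul, normP, add_zero] at this
    exact this.trans h3
  · simp only [TaylorModel.neg, evalR_axpy, evalR_nil, Int.cast_neg, Int.cast_one]
    rw [← abs_neg]
    convert h4 s hs using 2
    ring

lemma abs_sub_div_unit_le {x y : ℝ} {e : ℤ} (h : |x * unit * unit - y| ≤ e) :
    |x * unit - y / unit| ≤ (e / unit : ℤ) + 1 := by
  have hU := unit_pos
  have h3 := (_root_.abs_le.1 (abs_div_sub_le e (k := unit) (by exact_mod_cast hU))).2
  have h4 : |x * unit - y / unit| ≤ (e : ℝ) / unit := by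
    rw [le_div_iff₀ hU, ← abs_of_pos hU, ← abs_mul, abs_of_pos hU]
    refine le_trans (le_of_eq ?_) h
    congr 1; field_simp
  push_cast at h3 ⊢
  linarith

/-- Multiplying the packed integers multiplies the polynomials, as packing is evaluation at `base`.
The product carries the factor `unit` twice, so each of its 66 coefficients is divided by `unit`.
The 67 in the error bound is one for each of these roundings and one for rounding the quotient of
the errors. -/
lemma IsModel.mul (hf : IsModel 33 c u f) (hg : IsModel 33 c v g) (hc : -1 ≤ c) (hc' : c ≤ 0) :
    IsModel 32 c (fun s => u s * v s) (mul f g) := by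
  have hf0 := hf.err_nonneg hc'
  have hg0 := hg.err_nonneg hc'
  have hfn : (0 : ℝ) ≤ f.norm := by exact_mod_cast hf.norm_nonneg
  have hgn : (0 : ℝ) ≤ g.norm := by exact_mod_cast hg.norm_nonneg
  unfold TaylorModel.mul
  split_ifs with hlt
  · obtain ⟨p, h1, h2, h3, h4⟩ := hf.exists_length_eq
    obtain ⟨q, k1, k2, k3, k4⟩ := hg.exists_length_eq
    have hnorm : normP (mulP p q) ≤ f.norm * g.norm :=
      (normP_mulP_le p q).trans (mul_le_mul h3 k3 (normP_nonneg q) hf.norm_nonneg)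
    have hU : 0 < unit := by exact_mod_cast unit_pos
    have hlen : (mulP p q).length = 66 := by rw [length_mulP, h1, k1]
    have e1 : (f.poly * g.poly + offset 66).toNat = encode (mulP p q) := by
      rw [h2, k2, ← evalZ_mulP, ← hlen, evalZ_add_offset (hnorm.trans_lt hlt)]
    set d := divP 0 unit (mulP p q) with hd
    have hdlt : normP d < half := ((normP_divP_le 0 hU _).trans hnorm).trans_lt hlt
    have hdl : d.length = 66 := by rw [hd, length_divP, hlen]
    have htd := normP_take_add_drop 32 d
    have ht0 := normP_nonneg (d.take 32)
    have hd0 := normP_nonneg (d.drop 32)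
    have e2 : divLoop 0 66 unit (encode (mulP p q)) = encode d := by
      rw [← hlen, divLoop_encode 0 hU (hnorm.trans_lt hlt)]
    rw [forceNat_eq, e1, e2]
    have e3 : Nat.mod (encode d) (Nat.pow base 32) = encode (d.take 32) :=
      encode_mod_pow 32 hdlt (by omega)
    have e4 : Nat.div (encode d) (Nat.pow base 32) = encode (d.drop 32) :=
      encode_div_pow 32 hdlt (by omega)
    have hl1 : (d.take 32).length = 32 := by simp [hdl]
    have hl2 : (d.drop 32).length = 34 := by simp [hdl]
    have e5 : Int.ofNat (encode (d.take 32)) - offset 32 = evalZ (d.take 32) base := by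
      rw [Int.ofNat_eq_natCast, encode_eq (by linarith), hl1]; ring
    have e6 : (normLoop 34 (encode (d.drop 32)) : ℤ) = normP (d.drop 32) := by
      rw [← hl2, normLoop_encode (by linarith)]
    have e7 : (normLoop 32 (encode (d.take 32)) : ℤ) = normP (d.take 32) := by
      have := normLoop_encode (p := d.take 32) (by linarith)
      rwa [hl1] at this
    rw [e3, e4, e5, e6, e7]
    refine ⟨d.take 32, hl1.le, rfl, le_rfl, fun s hs => ?_⟩
    have hs1 : |s| ≤ 1 := _root_.abs_le.2 ⟨hc.trans hs.1, hs.2⟩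
    have hP : |evalR p s| ≤ f.norm := (abs_evalR_le _ hs1).trans (by exact_mod_cast h3)
    have hQ : |evalR q s| ≤ g.norm := (abs_evalR_le _ hs1).trans (by exact_mod_cast k3)
    have g1 := h4 s hs
    have g2 := k4 s hs
    have key : |u s * v s * unit * unit - evalR p s * evalR q s| ≤
        (f.err * g.norm + g.err * f.norm + f.err * g.err : ℤ) := by
      -- Writing u = p + δ and v = q + ε, the error uv - pq is δq + εp + δε.
      have e : u s * v s * unit * unit - evalR p s * evalR q s =
        (u s * unit - evalR p s) * evalR q s + (v s * unit - evalR q s) * evalR p s +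
          (u s * unit - evalR p s) * (v s * unit - evalR q s) := by ring
      rw [e]
      refine (abs_add_three _ _ _).trans ?_
      push_cast
      simp only [abs_mul]
      gcongr
    have g3 := abs_sub_div_unit_le key
    have g5 := abs_evalR_divP (mulP p q) hU hs1
    rw [evalR_mulP, ← hd, evalR_take_add_drop 32 d, hlen] at g5
    have g6 : |s ^ 32 * evalR (d.drop 32) s| ≤ normP (d.drop 32) := by
      rw [abs_mul, abs_pow]
      exact (mul_le_of_le_one_left (abs_nonneg _) (pow_le_one₀ (abs_nonneg _) hs1)).trans
        (abs_evalR_le _ hs1)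
    push_cast at g3 g5 ⊢
    rw [_root_.abs_le] at g3 g5 g6 ⊢
    constructor <;> linarith
  · refine isModel_zero fun s hs => ?_
    have g1 := hf.abs_le hc hs
    have g2 := hg.abs_le hc hs
    have key : |(u s * v s) * unit * unit - 0| ≤
        ((f.err + f.norm) * (g.err + g.norm) : ℤ) := by
      have e : u s * v s * unit * unit - 0 = (u s * unit) * (v s * unit) := by ring
      rw [e, abs_mul, abs_mul, abs_mul, abs_of_pos unit_pos]
      push_cast
      have := unit_pos
      gcongr
    have := abs_sub_div_unit_le key
    rw [zero_div, sub_zero, abs_mul, abs_of_pos unit_pos] at this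
    push_cast at this ⊢
    exact this

lemma IsModel.divNat (hf : IsModel 33 c u f) (hc : -1 ≤ c) (hc' : c ≤ 0) {k : ℕ} (hk : 0 < k) :
    IsModel 33 c (fun s => u s / k) (divNat f k) := by
  have hk' : (1 : ℝ) ≤ k := by exact_mod_cast hk
  have hf0 := hf.err_nonneg hc'
  unfold TaylorModel.divNat
  split_ifs with hlt
  · obtain ⟨p, h1, h2, h3, h4⟩ := hf.exists_length_eq
    have hdl : (divP 0 k p).length = 33 := by rw [length_divP, h1]
    have hdn := (normP_divP_le 0 hk p).trans h3
    have e1 : (Int.ofNat (divLoop 0 33 k (f.poly + offset 33).toNat) - offset 33 : ℤ) =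
        evalZ (divP 0 k p) base := by
      rw [h2, ← h1, evalZ_add_offset (h3.trans_lt hlt), divLoop_encode 0 hk (h3.trans_lt hlt),
        Int.ofNat_eq_natCast, encode_eq (hdn.trans_lt hlt), length_divP]
      ring
    have hdn' : normP (divP 0 k p) ≤ f.norm / k + 34 := by
      have h5 := normP_divP_zero_le p hk
      rw [h1] at h5
      have h6 := Int.ediv_le_ediv (c := (k : ℤ)) (by exact_mod_cast hk) h3
      push_cast at h5
      linarith
    refine ⟨divP 0 k p, hdl.le, e1, hdn', fun s hs => ?_⟩
    have hs1 : |s| ≤ 1 := _root_.abs_le.2 ⟨hc.trans hs.1, hs.2⟩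
    have g := abs_evalR_divP p hk hs1
    have g1 : |(u s * unit - evalR p s) / k| ≤ f.err := by
      rw [abs_div, abs_of_pos (by linarith : (0 : ℝ) < k)]
      exact (div_le_self (abs_nonneg _) hk').trans (h4 s hs)
    rw [h1] at g
    push_cast at g ⊢
    calc _ = |(u s * unit - evalR p s) / k + (evalR p s / k - evalR (divP 0 k p) s)| :=
          congrArg abs (by ring)
      _ ≤ _ := (abs_add_le _ _).trans (add_le_add g1 g)
  · refine isModel_zero fun s hs => ?_
    have := hf.abs_le hc hs
    rw [abs_div, abs_of_pos (by linarith : (0 : ℝ) < k)]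
    push_cast
    exact (mul_le_mul_of_nonneg_right (div_le_self (abs_nonneg _) hk') unit_pos.le).trans this

lemma continuous_evalR (p : Poly) : Continuous (evalR p) := by
  induction p with
  | nil => exact continuous_const
  | cons a p ih => exact continuous_const.add (continuous_id.mul ih)

/-- The weight x^k is there for the induction: peeling off the constant coefficient raises k by one,
and each coefficient costs one rounding. Only k = 0 is used. -/
lemma abs_integral_evalR_le (p : Poly) (k : ℕ) {s : ℝ} (hs : |s| ≤ 1) :
    |(∫ x in (0)..s, x ^ k * evalR p x) - s ^ (k + 1) * evalR (divP 1 (k + 1) p) s| ≤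
      p.length := by
  induction p generalizing k with
  | nil => simp [divP]
  | cons a p ih =>
    have h1 : ∫ x in (0)..s, x ^ k * evalR (a :: p) x =
        a * (s ^ (k + 1) / (k + 1)) + ∫ x in (0)..s, x ^ (k + 1) * evalR p x := by
      have : (fun x : ℝ => x ^ k * evalR (a :: p) x) =
          fun x => a * x ^ k + x ^ (k + 1) * evalR p x := by
        ext x; rw [evalR_cons]; ring
      rw [this, intervalIntegral.integral_add, intervalIntegral.integral_const_mul, integral_pow]
      · simp
      · exact (Continuous.intervalIntegrable (by fun_prop) _ _)
      · exact (Continuous.intervalIntegrable ((continuous_pow _).mul (continuous_evalR p)) _ _)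
    have h2 := abs_div_sub_le a (k := ((k + 1 : ℕ) : ℤ)) (by positivity)
    have h3 : |s ^ (k + 1) * ((a : ℝ) / ((k + 1 : ℕ) : ℤ) - (a / ((k + 1 : ℕ) : ℤ) : ℤ))| ≤ 1 := by
      rw [abs_mul, abs_pow]
      exact (mul_le_of_le_one_left (abs_nonneg _) (pow_le_one₀ (abs_nonneg _) hs)).trans h2
    have h4 := ih (k + 1)
    rw [h1]
    simp only [divP, evalR_cons, List.length_cons, Nat.cast_add, Nat.cast_one]
    push_cast at h3 h4 ⊢
    calc _ = |s ^ (k + 1) * ((a : ℝ) / (k + 1) - (a / (k + 1 : ℤ) : ℤ)) +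
          ((∫ x in (0)..s, x ^ (k + 1) * evalR p x) -
            s ^ (k + 1 + 1) * evalR (divP 1 (k + 1 + 1) p) s)| := by congr 1; ring
      _ ≤ _ := (abs_add_le _ _).trans (by linarith)

lemma IsModel.primitive (hf : IsModel 32 c u f) (hc : -1 ≤ c) (hc' : c ≤ 0)
    (hu : ContinuousOn u (Set.Icc c 1)) :
    IsModel 33 c (fun s => ∫ x in (0)..s, u x) (primitive f) := by
  have hsub : ∀ s ∈ Set.Icc c 1, Set.uIcc 0 s ⊆ Set.Icc c 1 := fun s hs =>
    Set.uIcc_subset_Icc ⟨hc', zero_le_one⟩ hs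
  have hui : ∀ s ∈ Set.Icc c 1, IntervalIntegrable u volume 0 s := fun s hs =>
    (hu.mono (hsub s hs)).intervalIntegrable
  have hf0 := hf.err_nonneg hc'
  have hfn : (0 : ℝ) ≤ f.norm := by exact_mod_cast hf.norm_nonneg
  unfold TaylorModel.primitive
  split_ifs with hlt
  · obtain ⟨p, h1, h2, h3, h4⟩ := hf.exists_length_eq
    have hdl : (divP 1 1 p).length = 32 := by rw [length_divP, h1]
    have hdn := (normP_divP_le 1 one_pos p).trans h3
    have e1 : (Int.ofNat (divLoop 1 32 1 (f.poly + offset 32).toNat) - offset 32 : ℤ) =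
        evalZ (divP 1 1 p) base := by
      rw [h2, ← h1, evalZ_add_offset (h3.trans_lt hlt), divLoop_encode 1 one_pos (h3.trans_lt hlt),
        Int.ofNat_eq_natCast, encode_eq (hdn.trans_lt hlt), length_divP]
      ring
    refine ⟨0 :: divP 1 1 p, by simp [hdl], by rw [e1, evalZ, zero_add], by simpa [normP] using hdn,
      fun s hs => ?_⟩
    have hs1 : |s| ≤ 1 := _root_.abs_le.2 ⟨hc.trans hs.1, hs.2⟩
    have g1 : |(∫ x in (0)..s, u x) * unit - ∫ x in (0)..s, evalR p x| ≤ f.err := by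
      rw [← intervalIntegral.integral_mul_const, ← intervalIntegral.integral_sub
        ((hui s hs).mul_const _) ((continuous_evalR _).intervalIntegrable _ _)]
      refine (intervalIntegral.norm_integral_le_of_norm_le_const (C := (f.err : ℝ))
        (f := fun x => u x * unit - evalR p x) ?_).trans ?_
      · intro x hx
        exact h4 x (hsub s hs (Set.uIoc_subset_uIcc hx))
      · rw [sub_zero]
        exact mul_le_of_le_one_right hf0 hs1
    have g2 := abs_integral_evalR_le p 0 hs1
    simp only [pow_zero, one_mul, zero_add, pow_one, h1] at g2
    simp only [evalR_cons]
    push_cast at g2 ⊢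
    rw [_root_.abs_le] at g1 g2 ⊢
    constructor <;> linarith
  · refine isModel_zero fun s hs => ?_
    have hs1 : |s| ≤ 1 := _root_.abs_le.2 ⟨hc.trans hs.1, hs.2⟩
    have := intervalIntegral.norm_integral_le_of_norm_le_const (a := 0) (b := s)
      (f := fun x => u x * unit) (C := f.err + f.norm) fun x hx => by
        rw [norm_mul, Real.norm_eq_abs, Real.norm_of_nonneg unit_pos.le]
        exact hf.abs_le hc (hsub s hs (Set.uIoc_subset_uIcc hx))
    rw [intervalIntegral.integral_mul_const, norm_mul, Real.norm_eq_abs,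
      Real.norm_of_nonneg unit_pos.le, sub_zero] at this
    push_cast
    exact this.trans (mul_le_of_le_one_right (by positivity) hs1)

lemma IsModel.evalAt (hf : IsModel 33 c u f) (hc : -1 ≤ c) {s : ℤ} (hs : (s : ℝ) ∈ Set.Icc c 1)
    {c' : ℝ} : IsModel 1 c' (fun _ => u s) (evalAt f s) := by
  unfold TaylorModel.evalAt
  split_ifs with hlt
  · obtain ⟨p, h1, h2, h3, h4⟩ := hf.exists_length_eq
    have e1 : evalLoop s 33 (f.poly + offset 33).toNat = evalZ p s := by
      rw [h2, ← h1, evalZ_add_offset (h3.trans_lt hlt), evalLoop_encode s (h3.trans_lt hlt)]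
    rw [forceInt_eq, e1]
    refine ⟨[evalZ p s], by simp, by simp [evalZ], by simp [normP], fun _ _ => ?_⟩
    · simpa [← evalR_intCast] using h4 s hs
  · exact isModel_zero fun _ _ => by exact_mod_cast hf.abs_le hc hs

lemma isModel_one : IsModel 33 c (fun _ => 1) one :=
  ⟨[(unit : ℤ)], by simp, by simp [one, evalZ], by simp [normP, one],
    fun s _ => by simp [one]⟩

/-- `1 + y / k + y² / (k (k + 1)) + …`, with `n + 1` terms. -/
def hornerFun (y : ℝ) : ℕ → ℕ → ℝ
  | 0, _ => 1
  | n + 1, k => 1 + y * hornerFun y n (k + 1) / k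

lemma hornerFun_eq (y : ℝ) (n k : ℕ) : hornerFun y n (k + 1) =
    ∑ i ∈ Finset.range (n + 1), y ^ i * (k ! : ℝ) / ((k + i) ! : ℝ) := by
  induction n generalizing k with
  | zero => simp [hornerFun, div_self ((Nat.cast_ne_zero (R := ℝ)).2 k.factorial_ne_zero)]
  | succ n ih =>
    rw [hornerFun, ih, Finset.sum_range_succ' _ (n + 1), Finset.mul_sum, Finset.sum_div, add_comm]
    congr 1
    · refine Finset.sum_congr rfl fun i _ => ?_
      have h1 : k + 1 + i = k + (i + 1) := by ring
      rw [h1, Nat.factorial_succ k]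
      have := Nat.cast_ne_zero (R := ℝ).2 (k + (i + 1)).factorial_ne_zero
      have : ((k + 1 : ℕ) : ℝ) ≠ 0 := by positivity
      push_cast at *
      field_simp
      ring
    · simp [div_self ((Nat.cast_ne_zero (R := ℝ)).2 k.factorial_ne_zero)]

lemma IsModel.horner (hf : IsModel 33 c u f) (hc : -1 ≤ c) (hc' : c ≤ 0) (n : ℕ) {k : ℕ}
    (hk : 0 < k) : IsModel 33 c (fun s => hornerFun (u s) n k) (horner f n k) := by
  induction n generalizing k with
  | zero => exact isModel_one
  | succ n ih =>
    simp only [TaylorModel.horner, force_eq]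
    exact isModel_one.add
      (((hf.mul (ih (Nat.succ_pos k)) hc hc').mono (by norm_num)).divNat hc hc' hk)

lemma IsModel.expModel (hf : IsModel 33 c u f) (hc : -1 ≤ c) (hc' : c ≤ 0)
    (hu : ∀ s ∈ Set.Icc c 1, |u s| ≤ 2) :
    IsModel 32 c (fun s => Real.exp (u s)) (expModel f) := by
  simp only [TaylorModel.expModel, force_eq]
  have h1 := (hf.divNat hc hc' (k := 8) (by norm_num)).horner hc hc' 12 (k := 1) one_pos
  set r := TaylorModel.horner (TaylorModel.divNat f 8) 12 1
  have h2 : IsModel 33 c (fun s => Real.exp (u s / 8))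
      ⟨r.poly, r.err + (unit / 380000000000000000 + 1), r.norm⟩ := by
    obtain ⟨p, k1, k2, k3, k4⟩ := h1
    refine ⟨p, k1, k2, k3, fun s hs => ?_⟩
    have hy : |u s / 8| ≤ 1 / 4 := by
      rw [abs_div]; norm_num; linarith [hu s hs]
    have h3 := Real.exp_bound (x := u s / 8) (by linarith) (n := 13) (by norm_num)
    have h4 := k4 s hs
    have h5 : hornerFun (u s / 8) 12 1 =
        ∑ m ∈ Finset.range 13, (u s / 8) ^ m / (m ! : ℝ) := by
      rw [← zero_add 1, hornerFun_eq]; simp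
    simp only [Nat.cast_ofNat, h5] at h4
    -- The remainder after degree 12 at |y| ≤ 1/4 is at most 14 / (4^13 · 13! · 13), about 1 / (3.88
    -- · 10^17). Three squarings afterwards undo the division by 8.
    have h6 : |u s / 8| ^ 13 * ((Nat.succ 13 : ℝ) / ((13 ! : ℝ) * (13 : ℕ))) ≤
        1 / 380000000000000000 := by
      calc _ ≤ (1 / 4 : ℝ) ^ 13 * ((Nat.succ 13 : ℝ) / ((13 ! : ℝ) * (13 : ℕ))) := by gcongr
        _ ≤ _ := by norm_num [Nat.factorial]
    have h7 : |Real.exp (u s / 8) * unit -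
        (∑ m ∈ Finset.range 13, (u s / 8) ^ m / (m ! : ℝ)) * unit| ≤
        (unit / 380000000000000000 : ℤ) + 1 := by
      rw [← sub_mul, abs_mul, abs_of_pos unit_pos]
      have h8 := (_root_.abs_le.1 (abs_div_sub_le unit (k := 380000000000000000) (by norm_num))).2
      have h9 := mul_le_mul_of_nonneg_right (h3.trans h6) unit_pos.le
      push_cast at h8 ⊢
      linarith
    push_cast at h7 ⊢
    rw [_root_.abs_le] at h4 h7 ⊢
    constructor <;> linarith
  have h3 := (h2.mul h2 hc hc').mono (show 32 ≤ 33 by norm_num)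
  have h4 := (h3.mul h3 hc hc').mono (show 32 ≤ 33 by norm_num)
  refine (h4.mul h4 hc hc').congr fun s _ => ?_
  simp only [← Real.exp_add]
  ring_nf

end TaylorModel

end RandomMapping

/-! ### The recursion over dyadic panels between 1/2 and 64. -/

namespace RandomMapping

namespace TaylorModel

/-- A model of `s ↦ 1 / (3 + s)`. -/
def invThree : Model :=
  ofPoly (List.ofFn fun k : Fin 32 => (-1) ^ (k : ℕ) * unit / 3 ^ ((k : ℕ) + 1))
    (32 + unit / (2 * 3 ^ 32) + 1)

/-- A model of `s ↦ 3 + s`. -/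
def threeAdd : Model := ofPoly [3 * unit, unit] 0

/-- The difference of the values of `f` at `1` and `-1`, plus `k` times `a`. -/
def accumulate (f : Model) (k : ℤ) (a : ℤ × ℤ) : ℤ × ℤ :=
  ((evalAt f 1).poly - (evalAt f (-1)).poly + k * a.1,
    (evalAt f 1).err + (evalAt f (-1)).err + k * a.2)

/-- The panel [2ρ, 4ρ] is parametrised as x = ρ(3 + s). If `f` models `integrandG i 0`, then `f * E`
models `integrandG (i + 1) 0`, and `f * threeAdd` models `integrandG i 1` divided by ρ. Stored
integrals are divided by ρ or ρ², so passing from 2ρ to ρ multiplies the old values by 2 or 4, which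
keeps them integers. -/
def stepAcc (E : Model) : Model → List ((ℤ × ℤ) × (ℤ × ℤ)) → List ((ℤ × ℤ) × (ℤ × ℤ))
  | _, [] => []
  | f, a :: l => force f fun f =>
      (force (primitive f) fun A => accumulate A 2 a.1,
        force (primitive (mul f threeAdd)) fun A => accumulate A 4 a.2) :: stepAcc E (mul f E) l

/-- The values of `expInt` and of `exp (-expInt)` at the left end of a panel, and the integrals from
there to infinity. Carrying the exponential along means that on the next panel only the exponential
of the increment of `expInt` is needed. -/
structure State where
  E : Model
  w : Model
  acc : List ((ℤ × ℤ) × (ℤ × ℤ))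

def step (p : Model) (st : State) : State :=
  force (primitive (mul p invThree)) fun A =>
  force (add (evalAt A 1) (neg A)) fun D => force (add st.E D) fun E =>
  force (mul st.w (expModel (neg D))) fun w =>
  ⟨evalAt E (-1), evalAt w (-1), stepAcc E (mul w p) st.acc⟩

/-- The argument `p` models exp(-ρ(3 + s)). Its square is the same function for 2ρ, so the recursion
climbs to ρ = 32 by squaring and comes back down one panel at a time. At level 0, the point 64, the
true values differ from the stored ones by less than one unit 2^(-80). -/
def level : ℕ → Model → State
  | 0, _ => ⟨⟨0, 1, 0⟩, ⟨unit, 1, unit⟩, List.replicate 4 ((0, 1), (0, 1))⟩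
  | n + 1, p => force p fun p => step p (level n (mul p p))

def phiZero : Model := expModel (ofPoly [-3 * unit / 4, -unit / 4] 0)

/-- The pair `a` of a value and an error bound encloses `y`. -/
def Encloses (y : ℝ) (a : ℤ × ℤ) : Prop := |y * unit - a.1| ≤ a.2

/-- The list `l` encloses the scaled integrals of `integrandG j 0` and `integrandG j 1` over
`(x, ∞)`, for `j = i, i + 1, …`. -/
def AccSpec (x ρ : ℝ) : ℕ → List ((ℤ × ℤ) × (ℤ × ℤ)) → Prop
  | _, [] => True
  | i, a :: l => Encloses ((∫ t in Set.Ioi x, integrandG i 0 t) / ρ) a.1 ∧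
      Encloses ((∫ t in Set.Ioi x, integrandG i 1 t) / ρ ^ 2) a.2 ∧ AccSpec x ρ (i + 1) l

structure StateSpec (x ρ : ℝ) (st : State) : Prop where
  E : IsModel 1 (-1) (fun _ => expInt x) st.E
  w : IsModel 1 (-1) (fun _ => Real.exp (-expInt x)) st.w
  acc : AccSpec x ρ 0 st.acc

lemma IsModel.encloses {n : ℕ} (hn : n ≤ 1) {c y : ℝ} (hc : c ≤ 1) {f : Model}
    (hf : IsModel n c (fun _ => y) f) : Encloses y (f.poly, f.err) := by
  obtain ⟨p, h1, h2, -, h4⟩ := hf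
  have h := h4 1 ⟨hc, le_rfl⟩
  match p, h1 with
  | [], _ => simpa [Encloses, h2, evalZ] using h
  | [a], _ => simpa [Encloses, h2, evalZ] using h
  | _ :: _ :: _, h1 => simp at h1; omega

lemma encloses_accumulate {v : ℝ → ℝ} {A : Model} (hA : IsModel 33 (-1) v A) {y : ℝ}
    {a : ℤ × ℤ} (ha : Encloses y a) {k : ℤ} (hk : 0 ≤ k) :
    Encloses (v 1 - v (-1) + k * y) (accumulate A k a) := by
  have h1 := (hA.evalAt le_rfl (s := 1) (by norm_num) (c' := 0)).encloses le_rfl zero_le_one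
  have h2 := (hA.evalAt le_rfl (s := -1) (by norm_num) (c' := 0)).encloses le_rfl zero_le_one
  simp only [Encloses, accumulate, Int.cast_one, Int.cast_neg] at *
  push_cast
  have hk' : (0 : ℝ) ≤ k := by exact_mod_cast hk
  have h3 := mul_le_mul_of_nonneg_left ha hk'
  rw [← abs_of_nonneg hk', ← abs_mul, abs_of_nonneg hk'] at h3
  rw [abs_le] at *
  constructor <;> linarith

lemma evalR_ofFn {n : ℕ} (a : Fin n → ℤ) (s : ℝ) :
    evalR (List.ofFn a) s = ∑ k, (a k : ℝ) * s ^ (k : ℕ) := by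
  induction n with
  | zero => simp
  | succ n ih =>
    rw [List.ofFn_succ, evalR_cons, ih, Fin.sum_univ_succ, Finset.mul_sum]
    simp only [Fin.val_zero, pow_zero, mul_one, Fin.val_succ, pow_succ]
    congr 1
    exact Finset.sum_congr rfl fun _ _ => by ring

/-- Rounding the coefficients `x k` of a polynomial down costs at most the number of them. -/
lemma abs_sum_sub_evalR_ofFn_le {n : ℕ} (x : Fin n → ℝ) (a : Fin n → ℤ)
    (h : ∀ k, |x k - a k| ≤ 1) {s : ℝ} (hs : |s| ≤ 1) :
    |∑ k, x k * s ^ (k : ℕ) - evalR (List.ofFn a) s| ≤ n := by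
  rw [evalR_ofFn, ← Finset.sum_sub_distrib]
  refine (Finset.abs_sum_le_sum_abs _ _).trans ?_
  calc _ ≤ ∑ _k : Fin n, (1 : ℝ) := Finset.sum_le_sum fun k _ => by
        rw [← sub_mul, abs_mul, abs_pow]
        exact mul_le_one₀ (h k) (by positivity) (pow_le_one₀ (abs_nonneg _) hs)
    _ = n := by simp

/-- This is the geometric series in -s/3. After 32 terms the remainder is (-s/3)^32 / (3 + s), of
size at most 1 / (2 · 3^32) since 3 + s ≥ 2; the rest of the error counts roundings. -/
lemma isModel_invThree : IsModel 33 (-1) (fun s => 1 / (3 + s)) invThree := by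
  refine isModel_ofPoly (by simp) fun s hs => ?_
  have hs1 : |s| ≤ 1 := abs_le.2 hs
  have h3 : 2 ≤ 3 + s := by linarith [hs.1]
  have h1 := abs_sum_sub_evalR_ofFn_le (n := 32)
    (fun k => ((((-1) ^ (k : ℕ) * unit : ℤ)) : ℝ) / ((3 ^ ((k : ℕ) + 1) : ℤ) : ℝ))
    (fun k => (-1) ^ (k : ℕ) * unit / 3 ^ ((k : ℕ) + 1))
    (fun k => abs_div_sub_le _ (by positivity)) hs1
  have h2 : ∑ k : Fin 32, ((((-1) ^ (k : ℕ) * unit : ℤ)) : ℝ) / ((3 ^ ((k : ℕ) + 1) : ℤ) : ℝ) *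
      s ^ (k : ℕ) = unit * ((1 - (-s / 3) ^ 32) / (3 + s)) := by
    have hne : -s / 3 ≠ 1 := by intro h; linarith
    have := geom_sum_eq hne 32
    have h4 : (1 - (-s / 3) ^ 32) / (3 + s) = (1 / 3) * ∑ i ∈ Finset.range 32, (-s / 3) ^ i := by
      rw [this, show -s / 3 - 1 = -((3 + s) / 3) by ring]
      have : 3 + s ≠ 0 := by linarith
      generalize (-s / 3) ^ 32 = X
      field_simp
      ring
    rw [h4, ← Fin.sum_univ_eq_sum_range (fun i => (-s / 3) ^ i), Finset.mul_sum, Finset.mul_sum]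
    refine Finset.sum_congr rfl fun k _ => ?_
    push_cast
    rw [neg_div, neg_pow (s / 3), div_pow, pow_succ]
    field_simp
  rw [h2] at h1
  have h5 : |1 / (3 + s) * unit - unit * ((1 - (-s / 3) ^ 32) / (3 + s))| ≤
      ((unit / (2 * 3 ^ 32) : ℤ) : ℝ) + 1 := by
    have e : 1 / (3 + s) * unit - unit * ((1 - (-s / 3) ^ 32) / (3 + s)) =
      (unit * ((-s / 3) ^ 32)) / (3 + s) := by
      have : (3 + s) ≠ 0 := by linarith
      field_simp
      ring
    have h6 : |(-s / 3)| ^ 32 ≤ 1 / 3 ^ 32 := by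
      rw [abs_div, abs_neg, div_pow]
      simp only [Nat.abs_ofNat]
      gcongr
      exact pow_le_one₀ (abs_nonneg _) hs1
    have h7 := (abs_le.1 (abs_div_sub_le unit (k := 2 * 3 ^ 32) (by norm_num))).2
    have hU := unit_pos
    rw [e, abs_div, abs_mul, abs_pow, abs_of_pos hU, abs_of_pos (by linarith : 0 < 3 + s)]
    calc _ ≤ (unit : ℝ) * (1 / 3 ^ 32) / 2 := by gcongr
      _ = ((unit : ℤ) : ℝ) / ((2 * 3 ^ 32 : ℤ) : ℝ) := by push_cast; ring
      _ ≤ _ := by linarith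
  push_cast at h1 h5 ⊢
  rw [abs_le] at *
  constructor <;> linarith

lemma isModel_threeAdd {c : ℝ} : IsModel 33 c (fun s => 3 + s) threeAdd :=
  isModel_ofPoly (by simp) fun s _ => by
    simp only [evalR_cons, evalR_nil]
    push_cast
    rw [show (3 + s) * (unit : ℝ) - (3 * unit + s * (unit + s * 0)) = 0 by ring, abs_zero]

end TaylorModel

end RandomMapping

/-! ### Correctness of the panel recursion. -/

namespace RandomMapping

namespace TaylorModel

lemma integral_comp_three_add {ρ : ℝ} (hρ : 0 < ρ) (F : ℝ → ℝ) (s : ℝ) :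
    ∫ x in s..1, F (ρ * (3 + x)) = (∫ t in (ρ * (3 + s))..(4 * ρ), F t) / ρ := by
  have h := intervalIntegral.integral_comp_mul_add (a := s) (b := 1) F hρ.ne' (3 * ρ)
  rw [smul_eq_mul, inv_mul_eq_div] at h
  rw [show ρ * (3 + s) = ρ * s + 3 * ρ by ring, show 4 * ρ = ρ * 1 + 3 * ρ by ring, ← h]
  congr 1; ext x; congr 1; ring

lemma setIntegral_integrandG_split (i h : ℕ) {x y : ℝ} (hx : 0 ≤ x) (hxy : x ≤ y) :
    ∫ t in Set.Ioi x, integrandG i h t =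
      (∫ t in x..y, integrandG i h t) + ∫ t in Set.Ioi y, integrandG i h t := by
  have hI := (integrableOn_integrandG i h).mono_set (Set.Ioi_subset_Ioi hx)
  rw [intervalIntegral.integral_of_le hxy, ← setIntegral_union
    (Set.Ioc_disjoint_Ioi le_rfl) measurableSet_Ioi (hI.mono_set Set.Ioc_subset_Ioi_self)
    (hI.mono_set (Set.Ioi_subset_Ioi hxy)), Set.Ioc_union_Ioi_eq_Ioi hxy]

lemma continuousOn_comp_three_add {ρ : ℝ} (hρ : 0 < ρ) {F : ℝ → ℝ}
    (hF : ContinuousOn F (Set.Ioi 0)) :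
    ContinuousOn (fun s => F (ρ * (3 + s))) (Set.Icc (-1) 1) := by
  refine hF.comp (by fun_prop) fun s hs => ?_
  have : 0 < 3 + s := by linarith [hs.1]
  exact Set.mem_Ioi.2 (by positivity)

lemma accSpec_stepAcc {ρ : ℝ} (hρ : 0 < ρ) {E : Model}
    (hE : IsModel 33 (-1) (fun s => expInt (ρ * (3 + s))) E) {i : ℕ} {f : Model}
    {l : List ((ℤ × ℤ) × (ℤ × ℤ))}
    (hf : IsModel 32 (-1) (fun s => integrandG i 0 (ρ * (3 + s))) f)
    (hl : AccSpec (4 * ρ) (2 * ρ) i l) : AccSpec (2 * ρ) ρ i (stepAcc E f l) := by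
  induction l generalizing i f with
  | nil => trivial
  | cons a l ih =>
    obtain ⟨h1, h2, h3⟩ := hl
    simp only [stepAcc, force_eq]
    have hc0 := continuousOn_comp_three_add hρ (continuousOn_integrandG i 0)
    have hint : ∀ {v : ℝ → ℝ}, ContinuousOn v (Set.Icc (-1) 1) →
        (∫ x in (0)..1, v x) - ∫ x in (0)..(-1), v x = ∫ x in (-1)..1, v x := fun {v} hv =>
      intervalIntegral.integral_interval_sub_left
        (hv.mono (Set.uIcc_subset_Icc (by simp) (by simp))).intervalIntegrable
        (hv.mono (Set.uIcc_subset_Icc (by simp) (by simp))).intervalIntegrable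
    refine ⟨?_, ?_, ih ?_ h3⟩
    · have h := encloses_accumulate (hf.primitive le_rfl (by norm_num) hc0) h1
        (k := 2) (by norm_num)
      simp only [hint hc0] at h
      convert h using 1
      rw [integral_comp_three_add hρ, setIntegral_integrandG_split i 0 (by positivity)
        (show 2 * ρ ≤ 4 * ρ by linarith), show ρ * (3 + -1) = 2 * ρ by ring]
      push_cast
      field_simp
    · have hc1 : ContinuousOn (fun s => integrandG i 0 (ρ * (3 + s)) * (3 + s)) (Set.Icc (-1) 1) :=
        hc0.mul (by fun_prop)
      have h := encloses_accumulate (((hf.mono (by norm_num)).mul isModel_threeAdd le_rfl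
        (by norm_num)).primitive le_rfl (by norm_num) hc1) h2 (k := 4) (by norm_num)
      simp only [hint hc1] at h
      convert h using 1
      have e : ∀ s, integrandG i 0 (ρ * (3 + s)) * (3 + s) =
          integrandG i 1 (ρ * (3 + s)) / ρ := fun s => by
        simp only [integrandG]; field_simp
      simp only [e, intervalIntegral.integral_div]
      rw [integral_comp_three_add hρ, setIntegral_integrandG_split i 1 (by positivity)
        (show 2 * ρ ≤ 4 * ρ by linarith), show ρ * (3 + -1) = 2 * ρ by ring]
      push_cast
      field_simp
      ring
    · refine ((hf.mono (by norm_num)).mul hE le_rfl (by norm_num)).congr fun s _ => ?_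
      simp only [integrandG]
      ring

/-- Under x = ρ(3 + s) the factor ρ of dx cancels that of 1/x, so E(ρ(3 + s)) = E(4ρ) + ∫_s^1
e^{-ρ(3+y)} / (3 + y) dy. One primitive therefore models E on the whole panel. -/
lemma stateSpec_step {ρ : ℝ} (hρ : 0 < ρ) {p : Model} {st : State}
    (hp : IsModel 33 (-1) (fun s => Real.exp (-(ρ * (3 + s)))) p)
    (hst : StateSpec (4 * ρ) (2 * ρ) st) : StateSpec (2 * ρ) ρ (step p st) := by
  have hpos : ∀ s ∈ Set.Icc (-1 : ℝ) 1, 0 < 3 + s := fun s hs => by linarith [hs.1]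
  set g : ℝ → ℝ := fun s => Real.exp (-(ρ * (3 + s))) * (1 / (3 + s)) with hg
  have hgc : ContinuousOn g (Set.Icc (-1) 1) :=
    ContinuousOn.mul (by fun_prop) (ContinuousOn.div (by fun_prop) (by fun_prop)
      fun s hs => (hpos s hs).ne')
  set A := primitive (mul p invThree)
  have hA : IsModel 33 (-1) (fun s => ∫ x in (0)..s, g x) A :=
    (hp.mul isModel_invThree le_rfl (by norm_num)).primitive le_rfl (by norm_num) hgc
  set D := TaylorModel.add (evalAt A 1) (TaylorModel.neg A)
  have hgi : ∀ s ∈ Set.Icc (-1 : ℝ) 1, (∫ x in (0)..1, g x) + -∫ x in (0)..s, g x =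
      ∫ x in s..1, g x := fun s hs => by
    rw [← sub_eq_add_neg]
    exact intervalIntegral.integral_interval_sub_left
      (hgc.mono (Set.uIcc_subset_Icc (by simp) (by simp))).intervalIntegrable
      (hgc.mono (Set.uIcc_subset_Icc (by simp) hs)).intervalIntegrable
  have hD : IsModel 33 (-1) (fun s => ∫ x in s..1, g x) D := by
    have h1 := (hA.evalAt le_rfl (s := 1) (by norm_num) (c' := -1)).mono (show 1 ≤ 33 by norm_num)
    refine (h1.add hA.neg).congr fun s hs => ?_
    simp only [Int.cast_one]
    exact (hgi s hs).symm
  have hEq : ∀ s ∈ Set.Icc (-1 : ℝ) 1, expInt (ρ * (3 + s)) =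
      expInt (4 * ρ) + ∫ x in s..1, g x := fun s hs => by
    have h1 : ∫ x in s..1, g x = ρ * ∫ x in s..1, (fun t => Real.exp (-t) / t) (ρ * (3 + x)) := by
      rw [← intervalIntegral.integral_const_mul]
      congr 1; ext x
      simp only [hg]
      field_simp
    have := hpos s hs
    rw [h1, integral_comp_three_add hρ (fun t => Real.exp (-t) / t), expInt_eq_add (by positivity)
      (show ρ * (3 + s) ≤ 4 * ρ by nlinarith [hs.2])]
    field_simp
    ring
  set E := TaylorModel.add st.E D
  have hE : IsModel 33 (-1) (fun s => expInt (ρ * (3 + s))) E :=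
    ((hst.E.mono (by norm_num)).add hD).congr hEq
  -- The integrand is at most 1, since 3 + x ≥ 1, and the interval has length at most 2. This is the
  -- size restriction of `expModel`.
  have hDb : ∀ s ∈ Set.Icc (-1 : ℝ) 1, |-∫ x in s..1, g x| ≤ 2 := fun s hs => by
    rw [abs_neg]
    refine (intervalIntegral.norm_integral_le_of_norm_le_const (C := 1) (f := g)
      fun x hx => ?_).trans ?_
    · rw [Set.uIoc_of_le hs.2] at hx
      have hx1 : 1 ≤ 3 + x := by linarith [hx.1, hs.1]
      simp only [hg]
      rw [Real.norm_of_nonneg (by positivity)]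
      refine mul_le_one₀ (Real.exp_le_one_iff.2 ?_) (by positivity) ?_
      · have : 0 < ρ * (3 + x) := by positivity
        linarith
      · rw [div_le_one (by linarith)]; exact hx1
    · rw [one_mul, abs_of_nonneg (by linarith [hs.2])]; linarith [hs.1]
  set w := TaylorModel.mul st.w (expModel (TaylorModel.neg D))
  have hw : IsModel 32 (-1) (fun s => Real.exp (-expInt (ρ * (3 + s)))) w := by
    refine ((hst.w.mono (by norm_num)).mul ((hD.neg.expModel le_rfl (by norm_num) hDb).mono
      (by norm_num)) le_rfl (by norm_num)).congr fun s hs => ?_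
    rw [hEq s hs, ← Real.exp_add]
    ring_nf
  have hstep : step p st = ⟨evalAt E (-1), evalAt w (-1), stepAcc E (mul w p) st.acc⟩ := by
    simp only [step, force_eq]; rfl
  have e : ρ * (3 + ((-1 : ℤ) : ℝ)) = 2 * ρ := by push_cast; ring
  rw [hstep]
  refine ⟨?_, ?_, accSpec_stepAcc hρ hE ?_ hst.acc⟩
  · have := hE.evalAt le_rfl (s := -1) (by norm_num) (c' := -1)
    simpa only [e] using this
  · have := (hw.mono (show 32 ≤ 33 by norm_num)).evalAt le_rfl (s := -1) (by norm_num) (c' := -1)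
    simpa only [e] using this
  · refine ((hw.mono (by norm_num)).mul hp le_rfl (by norm_num)).congr fun s _ => ?_
    rw [← Real.exp_add, integrandG]
    simp [sub_eq_add_neg]

lemma exp_neg_le_two_pow : Real.exp (-64) ≤ 1 / 2 ^ 92 := by
  have h : (2 : ℝ) ^ 92 ≤ Real.exp 64 := by
    have h1 : (2.7182818283 : ℝ) ^ 64 ≤ Real.exp 1 ^ 64 :=
      pow_le_pow_left₀ (by norm_num) Real.exp_one_gt_d9.le 64
    rw [← Real.exp_nat_mul] at h1
    norm_num at h1 ⊢
    linarith
  rw [Real.exp_neg, ← one_div]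
  exact one_div_le_one_div_of_le (by positivity) h

lemma integral_mul_exp_neg_le : ∫ t in Set.Ioi (64 : ℝ), t * Real.exp (-t) ≤ 66 / 2 ^ 92 := by
  have hb : ∀ t ∈ Set.Ioi (64 : ℝ), t * Real.exp (-t) ≤
      64 * Real.exp (-1) * Real.exp (-(63 / 64) * t) := fun t _ => by
    -- The tangent of the exponential at t = 64 bounds the linear factor: t ≤ 64 e^{(t-64)/64}. The
    -- product is then a pure exponential of rate 63/64, with integral (4096/63) e^{-64}.
    have h1 := Real.add_one_le_exp ((t - 64) / 64)
    have h2 : t ≤ 64 * Real.exp ((t - 64) / 64) := by linarith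
    calc t * Real.exp (-t) ≤ 64 * Real.exp ((t - 64) / 64) * Real.exp (-t) := by gcongr
      _ = _ := by
        rw [mul_assoc, mul_assoc, ← Real.exp_add, ← Real.exp_add]; ring_nf
  have hi : IntegrableOn (fun t : ℝ => t * Real.exp (-t)) (Set.Ioi 64) := by
    simpa using (integrableOn_pow_mul_exp_neg 1).mono_set (Set.Ioi_subset_Ioi (by norm_num))
  have hi2 : IntegrableOn (fun t : ℝ => 64 * Real.exp (-1) * Real.exp (-(63 / 64) * t))
      (Set.Ioi 64) := (integrableOn_exp_mul_Ioi (by norm_num) 64).const_mul _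
  refine (setIntegral_mono_on hi hi2 measurableSet_Ioi hb).trans ?_
  rw [integral_const_mul, integral_exp_mul_Ioi (by norm_num)]
  have h : Real.exp (-1) * Real.exp (-(63 / 64) * 64) = Real.exp (-64) := by
    rw [← Real.exp_add]; norm_num
  calc _ = 4096 / 63 * (Real.exp (-1) * Real.exp (-(63 / 64) * 64)) := by ring
    _ ≤ 4096 / 63 * (1 / 2 ^ 92) := by rw [h]; gcongr; exact exp_neg_le_two_pow
    _ ≤ _ := by norm_num

lemma unit_eq : (unit : ℝ) = 2 ^ 80 := by
  have : unit = 2 ^ 80 := by decide +kernel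
  rw [this]; norm_num

/-- For i ≤ 3 the factor i! is at most 6, and 6 · 66 ≤ 400. As 400 < 2^12, the bound is below one
unit 2^(-80), the error with which the recursion starts. -/
lemma tail_le {i h : ℕ} (hi : i ≤ 3) (hh : h ≤ 1) :
    ∫ t in Set.Ioi (64 : ℝ), integrandG i h t ≤ 400 / 2 ^ 92 := by
  have hi2 : IntegrableOn (fun t : ℝ => 6 * (t * Real.exp (-t))) (Set.Ioi 64) := by
    simpa [IntegrableOn] using ((integrableOn_pow_mul_exp_neg 1).mono_set
      (Set.Ioi_subset_Ioi (by norm_num : (0 : ℝ) ≤ 64))).const_mul 6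
  refine (setIntegral_mono_on ((integrableOn_integrandG i h).mono_set
    (Set.Ioi_subset_Ioi (by norm_num))) hi2 measurableSet_Ioi fun t ht => ?_).trans ?_
  · have ht' : (64 : ℝ) < t := ht
    refine (integrandG_le i h (by linarith)).trans ?_
    have h1 : ((i ! : ℕ) : ℝ) ≤ 6 := by exact_mod_cast Nat.factorial_le hi
    have h2 : t ^ h ≤ t := by
      calc t ^ h ≤ t ^ 1 := pow_le_pow_right₀ (by linarith) hh
        _ = t := pow_one t
    gcongr
  · rw [integral_const_mul]
    linarith [integral_mul_exp_neg_le]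

lemma accSpec_replicate (n i : ℕ) (h : i + n ≤ 4) :
    AccSpec 64 32 i (List.replicate n ((0, 1), (0, 1))) := by
  induction n generalizing i with
  | zero => trivial
  | succ n ih =>
    have key : ∀ h ≤ 1, ∀ q : ℝ, 1 ≤ q →
        Encloses ((∫ t in Set.Ioi 64, integrandG i h t) / q) (0, 1) := fun h hh q hq => by
      have h0 : 0 ≤ ∫ t in Set.Ioi (64 : ℝ), integrandG i h t :=
        setIntegral_nonneg measurableSet_Ioi fun t ht =>
          integrandG_nonneg i h ((by norm_num : (0 : ℝ) < 64).trans ht)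
      have h1 := tail_le (i := i) (by omega) hh
      have h2 : (∫ t in Set.Ioi 64, integrandG i h t) / q ≤ 400 / 2 ^ 92 := (div_le_self h0 hq).trans h1
      simp only [Encloses, Int.cast_zero, sub_zero, Int.cast_one, unit_eq]
      rw [abs_of_nonneg (by positivity)]
      calc _ ≤ 400 / 2 ^ 92 * (2 : ℝ) ^ 80 := by gcongr
        _ ≤ 1 := by norm_num
    exact ⟨key 0 (by norm_num) _ (by norm_num), key 1 le_rfl _ (by norm_num), ih (i + 1) (by omega)⟩

lemma stateSpec_zero (p : Model) : StateSpec 64 32 (level 0 p) := by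
  have h0 := expInt_nonneg (x := 64) (by norm_num)
  have h1 : expInt 64 ≤ 1 / 2 ^ 92 :=
    (expInt_le (by norm_num)).trans ((div_le_self (Real.exp_pos _).le (by norm_num)).trans
      exp_neg_le_two_pow)
  have h2 : expInt 64 * 2 ^ 80 ≤ 1 :=
    calc _ ≤ (1 / 2 ^ 92 : ℝ) * 2 ^ 80 := by gcongr
      _ ≤ 1 := by norm_num
  refine ⟨⟨[], by simp, rfl, le_rfl, fun s _ => ?_⟩, ⟨[(unit : ℤ)], by simp, ?_, ?_, fun s _ => ?_⟩,
    accSpec_replicate 4 0 (by norm_num)⟩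
  · simp only [level, evalR_nil, sub_zero, unit_eq, Int.cast_one]
    rwa [abs_of_nonneg (by positivity)]
  · simp [level, evalZ]
  · simp [level, normP]
  · have h3 := Real.one_sub_le_exp_neg (expInt 64)
    have h4 : Real.exp (-expInt 64) ≤ 1 := Real.exp_le_one_iff.2 (by linarith)
    simp only [level, evalR_cons, evalR_nil, Int.cast_natCast, unit_eq, Int.cast_one]
    rw [abs_le]
    constructor <;> nlinarith

lemma stateSpec_level (n : ℕ) {ρ : ℝ} (hρ : 0 < ρ) (h : 2 ^ n * ρ = 32) {p : Model}
    (hp : IsModel 33 (-1) (fun s => Real.exp (-(ρ * (3 + s)))) p) :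
    StateSpec (2 * ρ) ρ (level n p) := by
  induction n generalizing ρ p with
  | zero =>
    obtain rfl : ρ = 32 := by linarith
    convert stateSpec_zero p using 1
    norm_num
  | succ n ih =>
    simp only [level, force_eq]
    refine stateSpec_step hρ hp ?_
    have h2 := ih (ρ := 2 * ρ) (by positivity) (by rw [← h]; ring)
      (((hp.mul hp le_rfl (by norm_num)).mono (show 32 ≤ 33 by norm_num)).congr fun s _ => by
        rw [← Real.exp_add]; ring_nf)
    convert h2 using 1
    ring

lemma isModel_phiZero : IsModel 33 (-1) (fun s => Real.exp (-(1 / 4 * (3 + s)))) phiZero := by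
  have h1 : ((-3 * (unit : ℤ) / 4 : ℤ) : ℝ) = -3 * unit / 4 := by
    have : 4 * (-3 * (unit : ℤ) / 4) = -3 * unit := by decide +kernel
    have h : (4 : ℝ) * ((-3 * (unit : ℤ) / 4 : ℤ) : ℝ) = -3 * unit := by exact_mod_cast this
    linarith
  have h2 : ((-(unit : ℤ) / 4 : ℤ) : ℝ) = -unit / 4 := by
    have : 4 * (-(unit : ℤ) / 4) = -unit := by decide +kernel
    have h : (4 : ℝ) * ((-(unit : ℤ) / 4 : ℤ) : ℝ) = -unit := by exact_mod_cast this
    linarith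
  have h3 : IsModel 33 (-1) (fun s => -(1 / 4 * (3 + s)))
      (ofPoly [-3 * (unit : ℤ) / 4, -(unit : ℤ) / 4] 0) := by
    refine isModel_ofPoly (by simp) fun s _ => ?_
    simp only [evalR_cons, evalR_nil, h1, h2]
    rw [Int.cast_zero]
    refine le_of_eq (abs_eq_zero.2 ?_)
    ring
  refine (h3.expModel le_rfl (by norm_num) fun s hs => ?_).mono (by norm_num)
  rw [abs_neg, abs_of_nonneg (by linarith [hs.1])]
  linarith [hs.2]

lemma stateSpec_half : StateSpec (1 / 2) (1 / 4) (level 7 phiZero) := by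
  have := stateSpec_level 7 (ρ := 1 / 4) (by norm_num) (by norm_num) isModel_phiZero
  norm_num at this ⊢
  exact this

end TaylorModel

end RandomMapping

/-! ### The logarithmic singularity at 0 and the table of integrals. -/

namespace RandomMapping

namespace TaylorModel

/-- The integral of the packed polynomial times `(-log u) ^ m * u ^ (k - 1)` over `[0, 1]`, for
`n` digits. -/
def logLoop (m n : ℕ) : ℕ → ℕ → ℤ :=
  Nat.rec (fun _ _ => 0) (fun _ ih k N =>
    (Int.ofNat (Nat.mod N base) - Int.ofNat half) * m ! / (k ^ (m + 1) : ℕ) +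
      ih (k + 1) (Nat.div N base)) n

/-- An enclosure of ∫_0^1 (-log u)^m u^h f(u) du, computed termwise from ∫_0^1 (-log u)^m u^k du =
m! / (k+1)^(m+1). As this is at most m!, the model error is multiplied by m!; the 33 coefficients
are each rounded once. -/
def logInt (m h : ℕ) (f : Model) : ℤ × ℤ :=
  if f.norm < half then
    (logLoop m 33 (h + 1) (f.poly + offset 33).toNat, f.err * m ! + 33)
  else (0, (f.err + f.norm) * m !)

/-- A model of `u ↦ (1 - exp (-u / 2)) / u`. -/
def expSlope : Model :=
  ofPoly (List.ofFn fun k : Fin 32 => (-1) ^ (k : ℕ) * unit / (2 ^ ((k : ℕ) + 1) * ((k : ℕ) + 1)! : ℕ)) 33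

/-- A model of `u ↦ E (u / 2) + log u`. -/
def regular (E : Model) : Model :=
  force (primitive expSlope) fun S => add (add E (neg (evalAt S 1))) S

/-- A model of `u ↦ u * exp (-(E (u / 2) + log u) - u / 2)`. -/
def kernelZero (R : Model) : Model :=
  mul (expModel (neg (add R (ofPoly [0, unit / 2] 0)))) (ofPoly [0, unit] 0)

def kernelModel (R : Model) (K : Model) : ℕ → Model
  | 0 => K
  | n + 1 => mul (kernelModel R K n) R

/-- The sum of `choose i m` times the `m`-th logarithmic integral, over `m < n`. -/
def logSum (K : ℕ → Model) (i h : ℕ) : ℕ → ℤ × ℤ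
  | 0 => (0, 0)
  | m + 1 => ((logSum K i h m).1 + i.choose m * (logInt m h (K (i - m))).1,
      (logSum K i h m).2 + i.choose m * (logInt m h (K (i - m))).2)

/-- An enclosure of `4 ^ (h + 1)` times the integral of `integrandG i h` over `(0, ∞)`, where `a`
encloses the part over `(1 / 2, ∞)`. -/
def total (K : ℕ → Model) (i h : ℕ) (a : ℤ × ℤ) : ℤ × ℤ :=
  (a.1 + 2 ^ (h + 1) * (logSum K i h (i + 1)).1, a.2 + 2 ^ (h + 1) * (logSum K i h (i + 1)).2)

def totals (K : ℕ → Model) : ℕ → List ((ℤ × ℤ) × (ℤ × ℤ)) → List ((ℤ × ℤ) × (ℤ × ℤ))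
  | _, [] => []
  | i, a :: l => (total K i 0 a.1, total K i 1 a.2) :: totals K (i + 1) l

/-- Seven panels lead from 64 down to 1/2. The interval (0, 1/2) is handled with x = u/2 and 0 < u <
1. -/
def table : List ((ℤ × ℤ) × (ℤ × ℤ)) :=
  let st := level 7 phiZero
  force (regular st.E) fun R => force (kernelZero R) fun K => totals (kernelModel R K) 0 st.acc

/-- Whether the enclosure `a` lies within `t / 10 ^ 16 ± 10 ^ (-10)`. -/
def near (a : ℤ × ℤ) (t : ℤ) : Bool :=
  decide ((|a.1 * 10 ^ 16 - t * unit| + a.2 * 10 ^ 16) < 10 ^ 6 * unit)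

def nearAll : List ((ℤ × ℤ) × (ℤ × ℤ)) → List (ℤ × ℤ) → Bool
  | [], [] => true
  | a :: l, t :: l' => near a.1 t.1 && (near a.2 t.2 && nearAll l l')
  | _, _ => false

lemma logLoop_succ (m n k N : ℕ) : logLoop m (n + 1) k N =
    (((N % base : ℕ) : ℤ) - (half : ℤ)) * m ! / (k ^ (m + 1) : ℕ) +
      logLoop m n (k + 1) (N / base) := rfl

/-- The integral of `(-log u) ^ m * u ^ (k - 1) * evalR p u` over `(0, 1)`. -/
def logR (m : ℕ) : ℕ → Poly → ℝ
  | _, [] => 0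
  | k, a :: p => a * m ! / (k : ℝ) ^ (m + 1) + logR m (k + 1) p

lemma abs_logR_sub_logLoop_le (m : ℕ) {k : ℕ} (hk : 0 < k) {p : Poly} (h : normP p < half) :
    |logR m k p - logLoop m p.length k (encode p)| ≤ p.length := by
  induction p generalizing k with
  | nil => simp [logR, logLoop]
  | cons a p ih =>
    have ha := head_mem h
    have e1 : (((encode (a :: p) % base : ℕ) : ℤ) - (half : ℤ)) = a := by
      rw [encode_mod h, Int.toNat_of_nonneg (by omega)]; ring
    have h1 := abs_div_sub_le (a * m ! : ℤ) (k := (k ^ (m + 1) : ℕ)) (by positivity)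
    have h2 := ih (k := k + 1) (by omega) (normP_tail_lt h)
    rw [List.length_cons, logLoop_succ, e1, encode_div h, logR]
    push_cast at h1 h2 ⊢
    rw [abs_le] at h1 h2 ⊢
    constructor <;> linarith

/-- The substitution u = e^{-y} turns this into a Gamma integral. -/
lemma integral_log_pow_mul_pow (m k : ℕ) :
    ∫ u in Set.Ioo (0 : ℝ) 1, (-Real.log u) ^ m * u ^ k = m ! / (k + 1 : ℝ) ^ (m + 1) := by
  have him : (fun y : ℝ => Real.exp (-y)) '' Set.Ioi 0 = Set.Ioo 0 1 := by
    ext u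
    constructor
    · rintro ⟨y, hy, rfl⟩
      exact ⟨Real.exp_pos _, by simpa using hy⟩
    · rintro ⟨h0, h1⟩
      exact ⟨-Real.log u, by simpa using Real.log_neg h0 h1, by simp [Real.exp_log h0]⟩
  rw [← him, integral_image_eq_integral_abs_deriv_smul (f' := fun y => -Real.exp (-y))
    measurableSet_Ioi, ← integral_pow_mul_exp_neg_mul]
  · refine setIntegral_congr_fun measurableSet_Ioi fun y _ => ?_
    simp only [abs_neg, Real.abs_exp, Real.log_exp, neg_neg, smul_eq_mul]
    rw [← Real.exp_nat_mul, show -((k + 1) * y) = -y + k * -y by ring, Real.exp_add]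
    ring
  · intro y _
    simpa using ((hasDerivAt_neg y).exp).hasDerivWithinAt
  · intro y _ z _ h
    simpa using h

lemma integrableOn_log_pow_mul_pow (m k : ℕ) :
    IntegrableOn (fun u : ℝ => (-Real.log u) ^ m * u ^ k) (Set.Ioo 0 1) := by
  -- The integral of a non-integrable function is 0 by convention, so its positive value already
  -- proves integrability.
  refine Integrable.of_integral_ne_zero ?_
  rw [integral_log_pow_mul_pow]
  positivity

lemma log_integral_evalR (m h : ℕ) (p : Poly) :
    IntegrableOn (fun u : ℝ => (-Real.log u) ^ m * u ^ h * evalR p u) (Set.Ioo 0 1) ∧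
      ∫ u in Set.Ioo (0 : ℝ) 1, (-Real.log u) ^ m * u ^ h * evalR p u = logR m (h + 1) p := by
  induction p generalizing h with
  | nil => simp [logR]
  | cons a p ih =>
    obtain ⟨h1, h2⟩ := ih (h + 1)
    have e : (fun u : ℝ => (-Real.log u) ^ m * u ^ h * evalR (a :: p) u) = fun u =>
        a * ((-Real.log u) ^ m * u ^ h) + (-Real.log u) ^ m * u ^ (h + 1) * evalR p u := by
      ext u; rw [evalR_cons]; ring
    have h3 := (integrableOn_log_pow_mul_pow m h).const_mul (a : ℝ)
    rw [e]
    refine ⟨h3.add h1, ?_⟩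
    rw [integral_add h3 h1, integral_const_mul, integral_log_pow_mul_pow, h2, logR]
    push_cast
    ring

lemma integrableOn_log_mul {v : ℝ → ℝ} (hv : ContinuousOn v (Set.Icc 0 1)) (m h : ℕ) :
    IntegrableOn (fun u : ℝ => (-Real.log u) ^ m * u ^ h * v u) (Set.Ioo 0 1) := by
  obtain ⟨C, hC⟩ := isCompact_Icc.exists_bound_of_continuousOn hv
  refine (integrableOn_log_pow_mul_pow m h).mul_bdd (c := C)
    ((hv.mono Set.Ioo_subset_Icc_self).aestronglyMeasurable measurableSet_Ioo) ?_
  exact (ae_restrict_iff' measurableSet_Ioo).2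
    (Eventually.of_forall fun u hu => hC u (Set.Ioo_subset_Icc_self hu))

lemma abs_log_integral_le {w : ℝ → ℝ} {C : ℝ} (hw : ∀ u ∈ Set.Ioo (0 : ℝ) 1, |w u| ≤ C)
    (m h : ℕ) (hC : 0 ≤ C) :
    |∫ u in Set.Ioo (0 : ℝ) 1, (-Real.log u) ^ m * u ^ h * w u| ≤ C * m ! := by
  have hi := (integrableOn_log_pow_mul_pow m h).mul_const C
  rw [← Real.norm_eq_abs]
  calc _ ≤ ∫ u in Set.Ioo (0 : ℝ) 1, (-Real.log u) ^ m * u ^ h * C := by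
        refine norm_integral_le_of_norm_le hi ((ae_restrict_iff' measurableSet_Ioo).2
          (Eventually.of_forall fun u hu => ?_))
        have h1 : 0 ≤ -Real.log u := by have := Real.log_neg hu.1 hu.2; linarith
        have h2 := hu.1
        rw [norm_mul, Real.norm_of_nonneg (by positivity)]
        exact mul_le_mul_of_nonneg_left (hw u hu) (by positivity)
    _ = m ! / (h + 1 : ℝ) ^ (m + 1) * C := by
        rw [integral_mul_const, integral_log_pow_mul_pow]
    _ ≤ m ! * C := by
        refine mul_le_mul_of_nonneg_right (div_le_self (by positivity) (one_le_pow₀ ?_)) hC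
        linarith [(Nat.cast_nonneg h : (0 : ℝ) ≤ h)]
    _ = _ := mul_comm _ _

lemma encloses_logInt {v : ℝ → ℝ} {f : Model} (hf : IsModel 33 0 v f)
    (hv : ContinuousOn v (Set.Icc 0 1)) (m h : ℕ) :
    Encloses (∫ u in Set.Ioo (0 : ℝ) 1, (-Real.log u) ^ m * u ^ h * v u) (logInt m h f) := by
  have he := hf.err_nonneg le_rfl
  have hU := unit_pos
  unfold logInt Encloses
  split_ifs with hlt
  · obtain ⟨p, h1, h2, h3, h4⟩ := hf.exists_length_eq
    have e1 : logLoop m 33 (h + 1) (f.poly + offset 33).toNat =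
        logLoop m p.length (h + 1) (encode p) := by
      rw [h2, ← h1, evalZ_add_offset (h3.trans_lt hlt)]
    have g1 := abs_logR_sub_logLoop_le m (Nat.succ_pos h) (h3.trans_lt hlt)
    obtain ⟨i1, i2⟩ := log_integral_evalR m h p
    have g2 := abs_log_integral_le (w := fun u => v u * unit - evalR p u)
      (fun u hu => h4 u (Set.Ioo_subset_Icc_self hu)) m h he
    have e2 : ∫ u in Set.Ioo (0 : ℝ) 1, (-Real.log u) ^ m * u ^ h * (v u * unit - evalR p u) =
        (∫ u in Set.Ioo (0 : ℝ) 1, (-Real.log u) ^ m * u ^ h * v u) * unit -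
          logR m (h + 1) p := by
      rw [← i2, ← integral_mul_const, ← integral_sub ((integrableOn_log_mul hv m h).mul_const _) i1]
      congr 1; ext u; ring
    rw [e2] at g2
    simp only [e1]
    rw [h1] at g1
    push_cast at g1 ⊢
    rw [h1]
    rw [abs_le] at g1 g2 ⊢
    constructor <;> linarith
  · have hn : (0 : ℝ) ≤ f.norm := by exact_mod_cast hf.norm_nonneg
    have g2 := abs_log_integral_le (w := v) (C := (f.err + f.norm) / unit)
      (fun u hu => by
        rw [le_div_iff₀ hU]
        exact hf.abs_le (by norm_num) (Set.Ioo_subset_Icc_self hu)) m h (by positivity)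
    simp only [Int.cast_zero, sub_zero]
    rw [abs_mul, abs_of_pos hU]
    push_cast
    calc _ ≤ (f.err + f.norm) / unit * m ! * (unit : ℝ) := by gcongr
      _ = _ := by field_simp

/-- The entire function `u ↦ (1 - exp (-u / 2)) / u`. -/
def expSlopeFun (u : ℝ) : ℝ := dslope (fun u => -Real.exp (-u / 2)) 0 u

lemma expSlopeFun_zero : expSlopeFun 0 = 1 / 2 := by
  have h : HasDerivAt (fun u : ℝ => -Real.exp (-u / 2)) (1 / 2) 0 := by
    have := (((hasDerivAt_neg (0 : ℝ)).div_const 2).exp).neg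
    norm_num at this
    exact this
  rw [expSlopeFun, dslope_same, h.deriv]

lemma expSlopeFun_of_ne {u : ℝ} (hu : u ≠ 0) : expSlopeFun u = (1 - Real.exp (-u / 2)) / u := by
  rw [expSlopeFun, dslope_of_ne _ hu, slope_def_field]
  simp
  ring

lemma continuous_expSlopeFun : Continuous expSlopeFun := by
  rw [← continuousOn_univ]
  refine (continuousOn_dslope univ_mem).2 ⟨by fun_prop, ?_⟩
  fun_prop

lemma expSlopeFun_mem {u : ℝ} (hu : 0 ≤ u) : expSlopeFun u ∈ Set.Icc (0 : ℝ) (1 / 2) := by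
  rcases hu.eq_or_lt with rfl | h
  · rw [expSlopeFun_zero]; norm_num
  · have h1 := Real.add_one_le_exp (-u / 2)
    have h2 : Real.exp (-u / 2) ≤ 1 := Real.exp_le_one_iff.2 (by linarith)
    rw [expSlopeFun_of_ne h.ne']
    exact ⟨div_nonneg (by linarith) hu, by rw [div_le_iff₀ h]; linarith⟩

lemma abs_expSlopeFun_sub_le {u : ℝ} (hu : u ∈ Set.Icc (0 : ℝ) 1) :
    |expSlopeFun u - ∑ k ∈ Finset.range 32, (-1) ^ k / (2 ^ (k + 1) * (k + 1)! : ℝ) * u ^ k| ≤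
      1 / 2 ^ 80 := by
  rcases hu.1.eq_or_lt with rfl | h
  · rw [expSlopeFun_zero, Finset.sum_eq_single 0]
    · norm_num
    · intro k _ hk
      simp [hk]
    · simp
  · have hb := Real.exp_bound (x := -u / 2) (n := 33) (by
      rw [abs_div, abs_neg, abs_of_pos h, abs_two]; linarith [hu.2]) (by norm_num)
    have e : expSlopeFun u - ∑ k ∈ Finset.range 32, (-1) ^ k / (2 ^ (k + 1) * (k + 1)! : ℝ) * u ^ k
        = -(Real.exp (-u / 2) - ∑ m ∈ Finset.range 33, (-u / 2) ^ m / m !) / u := by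
      rw [expSlopeFun_of_ne h.ne', Finset.sum_range_succ' _ 32]
      have e2 : ∑ k ∈ Finset.range 32, (-u / 2) ^ (k + 1) / ((k + 1)! : ℝ) =
          -u * ∑ k ∈ Finset.range 32, (-1) ^ k / (2 ^ (k + 1) * (k + 1)! : ℝ) * u ^ k := by
        rw [Finset.mul_sum]
        refine Finset.sum_congr rfl fun k _ => ?_
        rw [div_pow, neg_pow, pow_succ (-1 : ℝ), pow_succ u]
        field_simp
      rw [e2]
      simp only [pow_zero, Nat.factorial_zero, Nat.cast_one, div_one]
      generalize ∑ k ∈ Finset.range 32, (-1) ^ k / (2 ^ (k + 1) * (k + 1)! : ℝ) * u ^ k = X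
      field_simp
      ring
    rw [e, abs_div, abs_neg, abs_of_pos h, div_le_iff₀ h]
    refine hb.trans ?_
    rw [abs_div, abs_neg, abs_of_pos h, abs_two, div_pow]
    have h3 : u ^ 33 ≤ u := by
      simpa using pow_le_pow_of_le_one h.le hu.2 (show 1 ≤ 33 by norm_num)
    have h4 : ((33 : ℕ).succ / ((33 : ℕ)! * (33 : ℕ) : ℝ) : ℝ) ≤ 1 / 2 ^ 47 := by
      norm_num [Nat.factorial]
    -- The crude bound 2^(-47) is chosen so that, with the 2^(-33) from (u/2)^33, the truncation
    -- costs exactly one unit 2^(-80). With the 32 roundings this makes the error 33 of `expSlope`.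
    calc _ ≤ u / 2 ^ 33 * (1 / 2 ^ 47) := by gcongr
      _ = _ := by ring

lemma isModel_expSlope : IsModel 32 0 expSlopeFun expSlope := by
  unfold expSlope
  refine isModel_ofPoly (List.length_ofFn).le fun s hs => ?_
  have hs1 : |s| ≤ 1 := abs_le.2 ⟨by linarith [hs.1], hs.2⟩
  have h1 := abs_sum_sub_evalR_ofFn_le (n := 32)
    (fun k => ((((-1) ^ (k : ℕ) * unit : ℤ)) : ℝ) /
      (((2 ^ ((k : ℕ) + 1) * ((k : ℕ) + 1)! : ℕ) : ℤ) : ℝ))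
    (fun k => (-1) ^ (k : ℕ) * unit / (2 ^ ((k : ℕ) + 1) * ((k : ℕ) + 1)! : ℕ))
    (fun k => abs_div_sub_le _ (by positivity)) hs1
  have h2 : ∑ k : Fin 32, ((((-1) ^ (k : ℕ) * unit : ℤ)) : ℝ) /
      (((2 ^ ((k : ℕ) + 1) * ((k : ℕ) + 1)! : ℕ) : ℤ) : ℝ) * s ^ (k : ℕ) =
      unit * ∑ k ∈ Finset.range 32, (-1) ^ k / (2 ^ (k + 1) * (k + 1)! : ℝ) * s ^ k := by
    rw [← Fin.sum_univ_eq_sum_range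
      (fun k => (-1) ^ k / (2 ^ (k + 1) * (k + 1)! : ℝ) * s ^ k), Finset.mul_sum]
    refine Finset.sum_congr rfl fun k _ => ?_
    push_cast
    ring
  rw [h2] at h1
  have h3 := mul_le_mul_of_nonneg_right (abs_expSlopeFun_sub_le hs) unit_pos.le
  rw [← abs_of_pos unit_pos, ← abs_mul, abs_of_pos unit_pos, unit_eq] at h3
  rw [unit_eq] at h1 ⊢
  rw [abs_le] at h1 h3 ⊢
  push_cast at h1 ⊢
  generalize ∑ k ∈ Finset.range 32, (-1) ^ k / (2 ^ (k + 1) * (k + 1)! : ℝ) * s ^ k = X at *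
  constructor <;> linarith

/-- The entire function with `E (u / 2) = -log u + regularFun u`. -/
def regularFun (u : ℝ) : ℝ :=
  expInt (1 / 2) - (∫ x in (0 : ℝ)..1, expSlopeFun x) + ∫ x in (0 : ℝ)..u, expSlopeFun x

lemma regularFun_eq (u : ℝ) :
    regularFun u = expInt (1 / 2) - ∫ x in u..1, expSlopeFun x := by
  have := intervalIntegral.integral_add_adjacent_intervals
    (continuous_expSlopeFun.intervalIntegrable (μ := volume) 0 u)
    (continuous_expSlopeFun.intervalIntegrable u 1)
  rw [regularFun]
  linarith

lemma continuous_regularFun : Continuous regularFun := by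
  unfold regularFun
  exact continuous_const.add (intervalIntegral.continuous_primitive
    (fun a b => continuous_expSlopeFun.intervalIntegrable a b) 0)

/-- The derivative of E(u/2) + log u is (1 - e^{-u/2}) / u, which extends continuously to 0.
Integrating it from u to 1 isolates the logarithm. -/
lemma expInt_half_mul {u : ℝ} (h0 : 0 < u) (h1 : u ≤ 1) :
    expInt (u / 2) = -Real.log u + regularFun u := by
  have h := intervalIntegral.integral_comp_div (a := u) (b := 1)
    (fun t => Real.exp (-t) / t) (c := 2) two_ne_zero
  have hpos : ∀ x ∈ Set.uIcc u 1, 0 < x := fun x hx => by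
    rw [Set.uIcc_of_le h1] at hx; exact h0.trans_le hx.1
  have e : ∫ x in u..1, Real.exp (-(x / 2)) / (x / 2) =
      2 * ((-Real.log u) - ∫ x in u..1, expSlopeFun x) := by
    have i1 : IntervalIntegrable (fun x : ℝ => x⁻¹) volume u 1 :=
      (continuousOn_inv₀.mono fun x hx => (hpos x hx).ne').intervalIntegrable
    have := integral_inv (a := u) (b := 1) fun h => (hpos 0 h).ne' rfl
    rw [one_div, Real.log_inv] at this
    rw [← this, ← intervalIntegral.integral_sub i1 (continuous_expSlopeFun.intervalIntegrable _ _),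
      ← intervalIntegral.integral_const_mul]
    refine intervalIntegral.integral_congr fun x hx => ?_
    have hx' := (hpos x hx).ne'
    simp only [expSlopeFun_of_ne hx', neg_div]
    field_simp
    ring
  rw [e, smul_eq_mul, mul_right_inj' two_ne_zero] at h
  rw [regularFun_eq, expInt_eq_add (by positivity : 0 < u / 2) (by linarith : u / 2 ≤ 1 / 2), ← h]
  ring

lemma abs_regularFun_add_le {u : ℝ} (hu : u ∈ Set.Icc (0 : ℝ) 1) :
    |-(regularFun u + u / 2)| ≤ 2 := by
  have h1 : (∫ x in u..1, expSlopeFun x) ∈ Set.Icc (0 : ℝ) (1 / 2) := by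
    refine ⟨intervalIntegral.integral_nonneg hu.2 fun x hx =>
      (expSlopeFun_mem (hu.1.trans hx.1)).1, ?_⟩
    calc _ ≤ ∫ x in u..1, (1 / 2 : ℝ) := intervalIntegral.integral_mono_on hu.2
            (continuous_expSlopeFun.intervalIntegrable _ _) (by simp) fun x hx =>
              (expSlopeFun_mem (hu.1.trans hx.1)).2
      _ ≤ _ := by
        rw [intervalIntegral.integral_const, smul_eq_mul]; linarith [hu.1]
  have h2 := expInt_nonneg (x := 1 / 2) (by norm_num)
  have h3 := expInt_le (x := 1 / 2) (by norm_num)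
  -- Hence E(1/2) ≤ 2 e^{-1/2} ≤ 3/2, and adding u/2 ≤ 1/2 stays within the bound 2 that `expModel`
  -- requires.
  have h4 : Real.exp (-(1 / 2)) ≤ 3 / 4 := by
    rw [Real.exp_neg]
    have := Real.add_one_le_exp (1 / 2 : ℝ)
    rw [inv_le_comm₀ (Real.exp_pos _) (by norm_num)]
    linarith
  rw [abs_neg, abs_le, regularFun_eq]
  obtain ⟨h5, h6⟩ := h1
  obtain ⟨h7, h8⟩ := hu
  have h9 : Real.exp (-(1 / 2)) / (1 / 2) = 2 * Real.exp (-(1 / 2)) := by ring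
  constructor <;> linarith

lemma isModel_regular {E : Model} (hE : IsModel 1 (-1) (fun _ => expInt (1 / 2)) E) :
    IsModel 33 0 regularFun (regular E) := by
  rw [regular, force_eq]
  have h1 := isModel_expSlope.primitive (by norm_num) le_rfl continuous_expSlopeFun.continuousOn
  have h2 := h1.evalAt (by norm_num) (s := 1) (by norm_num) (c' := 0)
  have hE' : IsModel 33 0 (fun _ => expInt (1 / 2)) E := by
    obtain ⟨p, g1, g2, g3, g4⟩ := hE
    exact ⟨p, by omega, g2, g3, fun s hs => g4 s ⟨by linarith [hs.1], hs.2⟩⟩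
  refine ((hE'.add ((h2.neg).mono (by norm_num))).add h1).congr fun s _ => ?_
  simp only [regularFun, Int.cast_one]
  ring

/-- The function `u ↦ exp (-E (u / 2) - u / 2)`. -/
def kernelFun (n : ℕ) (u : ℝ) : ℝ :=
  Real.exp (-(regularFun u + u / 2)) * u * regularFun u ^ n

lemma continuous_kernelFun (n : ℕ) : Continuous (kernelFun n) := by
  have := continuous_regularFun
  unfold kernelFun
  fun_prop

lemma isModel_kernelZero {R : Model} (hR : IsModel 33 0 regularFun R) :
    IsModel 32 0 (kernelFun 0) (kernelZero R) := by
  have hU := unit_eq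
  have h2 : ((unit / 2 : ℤ) : ℝ) = unit / 2 := by
    have : (unit : ℤ) = 2 * 2 ^ 79 :=
      Int.cast_injective (α := ℝ) (by push_cast; rw [hU]; norm_num)
    rw [this, Int.mul_ediv_cancel_left _ two_ne_zero]
    rw [unit_eq]; norm_num
  have h1 : IsModel 33 0 (fun u => u / 2) (ofPoly [0, unit / 2] 0) :=
    isModel_ofPoly (by simp) fun s _ => by
      simp only [evalR_cons, evalR_nil, h2]
      rw [Int.cast_zero, show s / 2 * (unit : ℝ) - (0 + s * (unit / 2 + s * 0)) = 0 by ring,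
        abs_zero]
  have h3 : IsModel 33 0 (fun u => u) (ofPoly [0, unit] 0) :=
    isModel_ofPoly (by simp) fun s _ => by
      simp only [evalR_cons, evalR_nil]
      push_cast
      rw [show s * (unit : ℝ) - (0 + s * (unit + s * 0)) = 0 by ring, abs_zero]
  refine ((((hR.add h1).neg.expModel (by norm_num) le_rfl
    fun s hs => abs_regularFun_add_le hs).mono (by norm_num)).mul h3 (by norm_num) le_rfl).congr
    fun s _ => ?_
  simp [kernelFun]

lemma isModel_kernelModel {R K : Model} (hR : IsModel 33 0 regularFun R)
    (hK : IsModel 32 0 (kernelFun 0) K) (n : ℕ) : IsModel 32 0 (kernelFun n) (kernelModel R K n) := by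
  induction n with
  | zero => exact hK
  | succ n ih =>
    refine ((ih.mono (by norm_num)).mul hR (by norm_num) le_rfl).congr fun s _ => ?_
    simp only [kernelFun, pow_succ]
    ring

lemma Encloses.add {y z : ℝ} {a b : ℤ × ℤ} (hy : Encloses y a) (hz : Encloses z b) {k l : ℤ}
    (hk : 0 ≤ k) (hl : 0 ≤ l) :
    Encloses (k * y + l * z) (k * a.1 + l * b.1, k * a.2 + l * b.2) := by
  have hk' : (0 : ℝ) ≤ k := by exact_mod_cast hk
  have hl' : (0 : ℝ) ≤ l := by exact_mod_cast hl
  unfold Encloses at *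
  push_cast
  calc _ = |k * (y * unit - a.1) + l * (z * unit - b.1)| := by congr 1; ring
    _ ≤ _ := by
      refine (abs_add_le _ _).trans ?_
      rw [abs_mul, abs_mul, abs_of_nonneg hk', abs_of_nonneg hl']
      gcongr

lemma encloses_logSum {K : ℕ → Model} (hK : ∀ n, IsModel 32 0 (kernelFun n) (K n)) (i h n : ℕ) :
    Encloses (∑ m ∈ Finset.range n, (i.choose m : ℝ) *
      ∫ u in Set.Ioo (0 : ℝ) 1, (-Real.log u) ^ m * u ^ h * kernelFun (i - m) u)
      (logSum K i h n) := by
  induction n with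
  | zero => simp [Encloses, logSum]
  | succ n ih =>
    rw [Finset.sum_range_succ]
    have := ih.add (encloses_logInt ((hK (i - n)).mono (by norm_num : 32 ≤ 33))
      (continuous_kernelFun _).continuousOn n h) (k := 1) (l := i.choose n) zero_le_one
      (by positivity)
    simpa [logSum] using this

/-- With x = u/2 and E = -log u + R, the factor exp(-E) equals u exp(-R), and the binomial theorem
expands E^i. What remains are powers of -log u against continuous functions that have Taylor models
on [0, 1]. -/
lemma integral_integrandG_zero_half (i h : ℕ) :
    2 ^ (h + 1) * ∫ x in (0 : ℝ)..(1 / 2), integrandG i h x =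
      ∑ m ∈ Finset.range (i + 1), (i.choose m : ℝ) *
        ∫ u in Set.Ioo (0 : ℝ) 1, (-Real.log u) ^ m * u ^ h * kernelFun (i - m) u := by
  have h1 := intervalIntegral.integral_comp_div (a := 0) (b := 1) (integrandG i h) (c := 2)
    two_ne_zero
  rw [zero_div, smul_eq_mul] at h1
  rw [pow_succ, mul_assoc, ← h1, intervalIntegral.integral_of_le zero_le_one,
    integral_Ioc_eq_integral_Ioo, ← integral_const_mul]
  have h2 : ∀ u ∈ Set.Ioo (0 : ℝ) 1, 2 ^ h * integrandG i h (u / 2) =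
      ∑ m ∈ Finset.range (i + 1), (i.choose m : ℝ) *
        ((-Real.log u) ^ m * u ^ h * kernelFun (i - m) u) := by
    intro u hu
    have e1 : Real.exp (-(-Real.log u + regularFun u) - u / 2) =
        u * Real.exp (-(regularFun u + u / 2)) := by
      rw [show -(-Real.log u + regularFun u) - u / 2 = Real.log u + -(regularFun u + u / 2) by ring,
        Real.exp_add, Real.exp_log hu.1]
    rw [integrandG, expInt_half_mul hu.1 hu.2.le, e1, add_pow, div_pow, Finset.mul_sum,
      Finset.sum_mul, Finset.mul_sum]
    refine Finset.sum_congr rfl fun m _ => ?_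
    rw [kernelFun]
    field_simp
  rw [setIntegral_congr_fun measurableSet_Ioo h2, integral_finsetSum]
  · simp only [integral_const_mul]
  · exact fun m _ => (integrableOn_log_mul (continuous_kernelFun _).continuousOn m h).const_mul _

lemma encloses_total {K : ℕ → Model} (hK : ∀ n, IsModel 32 0 (kernelFun n) (K n)) (i h : ℕ)
    {a : ℤ × ℤ}
    (ha : Encloses ((∫ t in Set.Ioi (1 / 2 : ℝ), integrandG i h t) / (1 / 4) ^ (h + 1)) a) :
    Encloses (4 ^ (h + 1) * ∫ t in Set.Ioi (0 : ℝ), integrandG i h t) (total K i h a) := by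
  have h1 := ha.add (encloses_logSum hK i h (i + 1)) (k := 1) (l := 2 ^ (h + 1)) zero_le_one
    (by positivity)
  rw [← integral_integrandG_zero_half] at h1
  rw [setIntegral_integrandG_split i h le_rfl (by norm_num : (0 : ℝ) ≤ 1 / 2)]
  have e : ((1 : ℤ) : ℝ) * ((∫ t in Set.Ioi (1 / 2 : ℝ), integrandG i h t) / (1 / 4) ^ (h + 1)) +
      ((2 ^ (h + 1) : ℤ) : ℝ) * (2 ^ (h + 1) * ∫ x in (0 : ℝ)..(1 / 2), integrandG i h x) =
      4 ^ (h + 1) * ((∫ t in (0 : ℝ)..(1 / 2), integrandG i h t) +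
        ∫ t in Set.Ioi (1 / 2 : ℝ), integrandG i h t) := by
    rw [one_div (4 : ℝ), inv_pow, div_inv_eq_mul, show (4 : ℝ) = 2 * 2 by norm_num, mul_pow]
    push_cast
    ring
  rw [e] at h1
  simpa [total] using h1

/-- The list `l` encloses the scaled integrals of `integrandG j 0` and `integrandG j 1`, for
`j = i, i + 1, …`. -/
def TotalSpec : ℕ → List ((ℤ × ℤ) × (ℤ × ℤ)) → Prop
  | _, [] => True
  | i, a :: l => Encloses (4 ^ (0 + 1) * ∫ t in Set.Ioi (0 : ℝ), integrandG i 0 t) a.1 ∧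
      Encloses (4 ^ (1 + 1) * ∫ t in Set.Ioi (0 : ℝ), integrandG i 1 t) a.2 ∧ TotalSpec (i + 1) l

lemma totalSpec_totals {K : ℕ → Model} (hK : ∀ n, IsModel 32 0 (kernelFun n) (K n)) (i : ℕ)
    {l : List ((ℤ × ℤ) × (ℤ × ℤ))} (hl : AccSpec (1 / 2) (1 / 4) i l) :
    TotalSpec i (totals K i l) := by
  induction l generalizing i with
  | nil => trivial
  | cons a l ih =>
    obtain ⟨h1, h2, h3⟩ := hl
    exact ⟨encloses_total hK i 0 (by simpa using h1), encloses_total hK i 1 h2, ih _ h3⟩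

lemma totalSpec_table : TotalSpec 0 table := by
  have h := stateSpec_half
  have hR := isModel_regular h.E
  simp only [table, force_eq]
  exact totalSpec_totals (isModel_kernelModel hR (isModel_kernelZero hR)) 0 h.acc

/-- Approximations of the scaled integrals, with the common denominator `10 ^ 16`. -/
def approximations : List (ℤ × ℤ) :=
  [(24973199541742036, 136542644691085632), (8383234971367431, 18072938720521460),
    (7065287910652289, 7867940162387054), (9682077296848910, 6165720631269034)]

-- The one place where the whole table is evaluated, by integer arithmetic in the kernel.
set_option maxRecDepth 10000 in
lemma nearAll_table : nearAll table approximations = true := by decide +kernel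

lemma Encloses.near {y : ℝ} {a : ℤ × ℤ} (hy : Encloses y a) {t : ℤ} (h : near a t = true) :
    |y - (t : ℝ) / 10 ^ 16| ≤ 1 / 10 ^ 10 := by
  have h1 := of_decide_eq_true h
  have h2 := (Int.cast_lt (R := ℝ)).2 h1
  push_cast at h2
  have hU := unit_pos
  unfold Encloses at hy
  have h3 : |(y - (t : ℝ) / 10 ^ 16) * (10 ^ 16 * (unit : ℝ))| ≤ 10 ^ 6 * (unit : ℝ) := by
    have e : (y - (t : ℝ) / 10 ^ 16) * (10 ^ 16 * (unit : ℝ)) =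
        (y * unit - a.1) * 10 ^ 16 + (a.1 * 10 ^ 16 - t * unit) := by field_simp; ring
    have h4 := abs_add_le ((y * (unit : ℝ) - a.1) * 10 ^ 16) ((a.1 : ℝ) * 10 ^ 16 - t * unit)
    rw [abs_mul, abs_of_pos (by positivity : (0 : ℝ) < 10 ^ 16)] at h4
    rw [e]
    norm_num at h4 ⊢
    linarith
  rw [abs_mul, abs_of_pos (by positivity : (0 : ℝ) < 10 ^ 16 * unit)] at h3
  refine le_of_mul_le_mul_right (h3.trans_eq ?_) (by positivity : (0 : ℝ) < 10 ^ 16 * unit)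
  ring

/-- The list `l` contains approximations of the scaled integrals of `integrandG j 0` and
`integrandG j 1`, for `j = i, i + 1, …`. -/
def NearSpec : ℕ → List (ℤ × ℤ) → Prop
  | _, [] => True
  | i, t :: l =>
      |4 ^ (0 + 1) * (∫ x in Set.Ioi (0 : ℝ), integrandG i 0 x) - t.1 / 10 ^ 16| ≤ 1 / 10 ^ 10 ∧
      |4 ^ (1 + 1) * (∫ x in Set.Ioi (0 : ℝ), integrandG i 1 x) - t.2 / 10 ^ 16| ≤ 1 / 10 ^ 10 ∧
      NearSpec (i + 1) l

lemma TotalSpec.nearSpec {i : ℕ} {l : List ((ℤ × ℤ) × (ℤ × ℤ))} (hl : TotalSpec i l)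
    {l' : List (ℤ × ℤ)} (h : nearAll l l' = true) : NearSpec i l' := by
  induction l generalizing i l' with
  | nil =>
    cases l' with
    | nil => trivial
    | cons _ _ => simp [nearAll] at h
  | cons a l ih =>
    cases l' with
    | nil => simp [nearAll] at h
    | cons t l' =>
      simp only [nearAll, Bool.and_eq_true] at h
      exact ⟨hl.1.near h.1, hl.2.1.near h.2.1, ih hl.2.2 h.2.2⟩

lemma nearSpec_approximations : NearSpec 0 approximations :=
  totalSpec_table.nearSpec nearAll_table

end TaylorModel

/-! ### Numerical values of the limit. -/

/-- From an enclosure of the two integrals to one of the limit correlation. -/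
lemma limitCorrelation_mem {r : ℕ} {a b c d l u p q : ℝ} (hp : 0 < p)
    (hp1 : p ≤ Real.pi / 2) (hq : Real.pi / 2 ≤ q) (hq2 : q ≤ 2) (ha : 0 ≤ a)
    (h1 : G r 1 ∈ Set.Icc a b) (h2 : G r 2 ∈ Set.Icc c d)
    (hv : 0 < 2 * c - q * b ^ 2)
    (hlow : l ^ 2 * (2 * d - p * a ^ 2) ≤ (2 - q) * a ^ 2)
    (hup : (2 - p) * b ^ 2 < u ^ 2 * (2 * c - q * b ^ 2)) (hu : 0 ≤ u) :
    limitCorrelation r ∈ Set.Ico l u := by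
  obtain ⟨h1a, h1b⟩ := h1
  obtain ⟨h2a, h2b⟩ := h2
  have hG := ha.trans h1a
  set x := G r 1
  set y := G r 2
  set w := Real.pi / 2
  have s1 : a ^ 2 ≤ x ^ 2 := by gcongr
  have s2 : x ^ 2 ≤ b ^ 2 := by gcongr
  have s3 : 0 ≤ a ^ 2 := by positivity
  have v1 : 2 * c - q * b ^ 2 ≤ 2 * y - w * x ^ 2 := by
    have : w * x ^ 2 ≤ q * b ^ 2 := by gcongr; linarith
    linarith
  have v2 : 2 * y - w * x ^ 2 ≤ 2 * d - p * a ^ 2 := by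
    have : p * a ^ 2 ≤ w * x ^ 2 := by gcongr
    linarith
  have v0 := hv.trans_le v1
  -- Under a single root, both bounds become polynomial inequalities in the endpoints. The radicand
  -- increases with x² and decreases with y and w, since w ≤ 2.
  have e : limitCorrelation r = √((2 - w) * x ^ 2 / (2 * y - w * x ^ 2)) := by
    rw [Real.sqrt_div (mul_nonneg (by linarith) (by positivity)), Real.sqrt_mul (by linarith),
      Real.sqrt_sq hG]
    rfl
  rw [e]
  constructor
  · refine Real.le_sqrt_of_sq_le ?_
    rw [le_div_iff₀ v0]
    calc _ ≤ l ^ 2 * (2 * d - p * a ^ 2) := by gcongr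
      _ ≤ (2 - q) * a ^ 2 := hlow
      _ ≤ _ := by gcongr; linarith
  · rw [Real.sqrt_lt' (by
      rcases hu.eq_or_lt with rfl | h
      · have : 0 ≤ (2 - p) * b ^ 2 := mul_nonneg (by linarith) (by positivity)
        linarith
      · exact h), div_lt_iff₀ v0]
    calc _ ≤ (2 - p) * b ^ 2 := by gcongr; linarith
      _ < _ := hup
      _ ≤ _ := by gcongr

lemma limitCorrelation_numeric :
    limitCorrelation 1 ∈ Set.Ico (0.83298010 : ℝ) 0.83298011 ∧
    limitCorrelation 2 ∈ Set.Ico (0.65486924 : ℝ) 0.65486925 ∧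
    limitCorrelation 3 ∈ Set.Ico (0.52094617 : ℝ) 0.52094618 ∧
    limitCorrelation 4 ∈ Set.Ico (0.42505712 : ℝ) 0.42505713 := by
  have h := TaylorModel.nearSpec_approximations
  simp only [TaylorModel.approximations, TaylorModel.NearSpec] at h
  obtain ⟨a1, a2, b1, b2, c1, c2, d1, d2, -⟩ := h
  have g (i h : ℕ) := G_succ_succ i h
  have p1 : (1.57079632679489 : ℝ) ≤ Real.pi / 2 := by have := Real.pi_gt_d20; linarith
  have p2 : Real.pi / 2 ≤ (1.57079632679490 : ℝ) := by have := Real.pi_lt_d20; linarith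
  rw [abs_le] at a1 a2 b1 b2 c1 c2 d1 d2
  have a3 := g 0 0
  have a4 := g 0 1
  have b3 := g 1 0
  have b4 := g 1 1
  have c3 := g 2 0
  have c4 := g 2 1
  have d3 := g 3 0
  have d4 := g 3 1
  norm_num [Nat.factorial] at a1 a2 b1 b2 c1 c2 d1 d2 a3 a4 b3 b4 c3 c4 d3 d4
  -- In each case the table value for `i = r - 1` is divided by 4 i! for `G r 1` and by 32 i! for `G
  -- r 2`. The endpoints `a`, `b`, `c`, `d` are these quotients widened by the correspondingly
  -- scaled tolerance 10^(-10) and rounded outwards.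
  refine ⟨?_, ?_, ?_, ?_⟩
  · refine limitCorrelation_mem (a := 12486599770371 / 20000000000000) (b := 7804124857107 / 12500000000000)
      (c := 42669576465651 / 100000000000000) (d := 42669576466277 / 100000000000000) (by norm_num) p1 p2 (by norm_num)
      (by norm_num) ⟨?_, ?_⟩ ⟨?_, ?_⟩ (by norm_num) (by norm_num) (by norm_num) (by norm_num) <;>
      linarith
  · refine limitCorrelation_mem (a := 10479043712959 / 50000000000000) (b := 20958087430919 / 100000000000000)
      (c := 112955866997 / 2000000000000) (d := 1411948337619 / 25000000000000) (by norm_num) p1 p2 (by norm_num)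
      (by norm_num) ⟨?_, ?_⟩ ⟨?_, ?_⟩ (by norm_num) (by norm_num) (by norm_num) (by norm_num) <;>
      linarith
  · refine limitCorrelation_mem (a := 1766321977413 / 20000000000000) (b := 4415804944783 / 50000000000000)
      (c := 153670706277 / 12500000000000) (d := 122936565053 / 10000000000000) (by norm_num) p1 p2 (by norm_num)
      (by norm_num) ⟨?_, ?_⟩ ⟨?_, ?_⟩ (by norm_num) (by norm_num) (by norm_num) (by norm_num) <;>
      linarith
  · refine limitCorrelation_mem (a := 403419887327 / 10000000000000) (b := 504274859263 / 12500000000000)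
      (c := 160565641413 / 50000000000000) (d := 321131282931 / 100000000000000) (by norm_num) p1 p2 (by norm_num)
      (by norm_num) ⟨?_, ?_⟩ ⟨?_, ?_⟩ (by norm_num) (by norm_num) (by norm_num) (by norm_num) <;>
      linarith

end RandomMapping

/-! ### Counting mappings with a prescribed set of cyclic points. -/

namespace RandomMapping

open Function Finset

section Restriction

variable {n : ℕ} {f g : Fin n → Fin n} {C : Finset (Fin n)}

lemma mem_cyclicPoints {x : Fin n} : x ∈ cyclicPoints f ↔ x ∈ periodicPts f := by
  simp [cyclicPoints]

lemma bijOn_cyclicPoints (f : Fin n → Fin n) : Set.BijOn f (cyclicPoints f) (cyclicPoints f) := by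
  have : ((cyclicPoints f : Finset (Fin n)) : Set (Fin n)) = periodicPts f := by
    ext x; simp [mem_cyclicPoints]
  rw [this]
  exact bijOn_periodicPts f

/-- A periodic orbit that entered the invariant set `C` would stay there and yet return to x. With
period p, the iterate k·p is a return after time k. -/
lemma iterate_notMem (hf : Set.MapsTo f C C) {x : Fin n} (hx : x ∉ C) (hp : x ∈ periodicPts f)
    (k : ℕ) : f^[k] x ∉ C := fun hk => by
  obtain ⟨p, hp0, hp⟩ := hp
  have h1 : f^[k * p - k] (f^[k] x) ∈ C := hf.iterate _ hk
  rw [← iterate_add_apply, Nat.sub_add_cancel (Nat.le_mul_of_pos_right k hp0),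
    (hp.const_mul k).eq] at h1
  exact hx h1

lemma mem_periodicPts_of_agree (hf : Set.MapsTo f C C) (hfg : ∀ x ∉ C, f x = g x) {x : Fin n}
    (hx : x ∉ C) (hp : x ∈ periodicPts f) : x ∈ periodicPts g := by
  have h (k : ℕ) : g^[k] x = f^[k] x := by
    induction k with
    | zero => rfl
    | succ k ih =>
      rw [iterate_succ_apply', iterate_succ_apply', ih, hfg _ (iterate_notMem hf hx hp k)]
  obtain ⟨p, hp0, hp⟩ := hp
  exact ⟨p, hp0, (h p).trans hp⟩

/-- Two iterates of x coincide by finiteness, and injectivity on `C` cancels the earlier one. -/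
lemma subset_cyclicPoints (hf : Set.MapsTo f C C) (hi : Set.InjOn f C) : C ⊆ cyclicPoints f := by
  intro x hx
  obtain ⟨a, b, hab, h⟩ := Finite.exists_ne_map_eq_of_infinite (fun k : ℕ => f^[k] x)
  wlog hlt : a < b generalizing a b
  · exact this b a hab.symm h.symm (by omega)
  refine mem_cyclicPoints.2 ⟨b - a, by omega, ?_⟩
  refine (hi.iterate hf a) (hf.iterate _ hx) hx ?_
  rw [← iterate_add_apply, Nat.add_sub_cancel' hlt.le]
  exact h.symm

/-- The mappings with the set `C` of cyclic points that restrict to `σ` there. -/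
def extensions (C : Finset (Fin n)) (σ : Equiv.Perm C) : Finset (Fin n → Fin n) :=
  univ.filter fun f => cyclicPoints f = C ∧ ∀ x : C, f x = σ x

lemma mem_extensions {σ : Equiv.Perm C} :
    f ∈ extensions C σ ↔ cyclicPoints f = C ∧ ∀ x : C, f x = σ x := by
  simp [extensions]

/-- Overwriting f by τ on `C` creates no cyclic point outside `C`: its orbit would avoid `C`, hence
would be an orbit of f as well. The map is injective because f was known to be σ on `C`. -/
lemma card_extensions_le (σ τ : Equiv.Perm C) : #(extensions C σ) ≤ #(extensions C τ) := by
  let glue (f : Fin n → Fin n) : Fin n → Fin n := fun x => if h : x ∈ C then τ ⟨x, h⟩ else f x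
  have g1 (f : Fin n → Fin n) (x : C) : glue f x = τ x := by simp [glue]
  have g2 (f : Fin n → Fin n) (x : Fin n) (hx : x ∉ C) : glue f x = f x := by simp [glue, hx]
  refine card_le_card_of_injOn glue (fun f hf => ?_) fun f hf f' hf' h => ?_
  · obtain ⟨h1, h2⟩ := mem_extensions.1 hf
    have hm : Set.MapsTo (glue f) C C := fun x hx => by
      rw [g1 f ⟨x, hx⟩]; exact (τ ⟨x, hx⟩).2
    have hi : Set.InjOn (glue f) C := fun x hx y hy hxy => by
      rw [g1 f ⟨x, hx⟩, g1 f ⟨y, hy⟩] at hxy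
      simpa using hxy
    refine mem_extensions.2 ⟨(subset_cyclicPoints hm hi).antisymm' fun x hx => ?_, g1 f⟩
    by_contra hxC
    refine hxC ?_
    rw [← h1, mem_cyclicPoints]
    exact mem_periodicPts_of_agree hm (g2 f) hxC (mem_cyclicPoints.1 hx)
  · obtain ⟨-, h2⟩ := mem_extensions.1 hf
    obtain ⟨-, h2'⟩ := mem_extensions.1 hf'
    ext1 x
    by_cases hx : x ∈ C
    · rw [h2 ⟨x, hx⟩, h2' ⟨x, hx⟩]
    · rw [← g2 f x hx, ← g2 f' x hx, h]

lemma card_extensions_eq (σ τ : Equiv.Perm C) : #(extensions C σ) = #(extensions C τ) :=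
  (card_extensions_le σ τ).antisymm (card_extensions_le τ σ)

/-- The permutation of `C` that `f` restricts to, if `C` is the set of cyclic points. -/
def cyclicPerm (C : Finset (Fin n)) (f : Fin n → Fin n) : Equiv.Perm C :=
  if h : cyclicPoints f = C then
    (Set.BijOn.equiv f (h ▸ bijOn_cyclicPoints f : Set.BijOn f (C : Set (Fin n)) C)) else 1

lemma coe_cyclicPerm (h : cyclicPoints f = C) (x : C) : (cyclicPerm C f x : Fin n) = f x := by
  simp only [cyclicPerm, h, dite_true]
  rfl

lemma cyclicPerm_eq_iff (h : cyclicPoints f = C) {σ : Equiv.Perm C} :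
    cyclicPerm C f = σ ↔ ∀ x : C, f x = σ x := by
  simp only [Equiv.ext_iff, Subtype.ext_iff, coe_cyclicPerm h]

/-- All permutations of `C` have equally many extensions. This is the uniformity of the permutation
induced on a given cyclic set. -/
lemma card_filter_cyclicPerm (C : Finset (Fin n)) (Q : Equiv.Perm C → Prop) [DecidablePred Q] :
    #(univ.filter fun f : Fin n → Fin n => cyclicPoints f = C ∧ Q (cyclicPerm C f)) =
      #(univ.filter Q) * #(extensions C 1) := by
  rw [card_eq_sum_card_fiberwise (f := cyclicPerm C) (t := univ.filter Q)
    (fun f hf => by simpa using (mem_filter.1 hf).2.2), ← smul_eq_mul, ← sum_const]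
  refine sum_congr rfl fun σ hσ => ?_
  rw [← card_extensions_eq σ 1, extensions, filter_filter]
  congr 1
  ext f
  simp only [mem_filter, mem_univ, true_and]
  constructor
  · rintro ⟨⟨h1, -⟩, h2⟩
    exact ⟨h1, (cyclicPerm_eq_iff h1).1 h2⟩
  · rintro ⟨h1, h2⟩
    have h3 := (cyclicPerm_eq_iff h1).2 h2
    exact ⟨⟨h1, h3 ▸ (mem_filter.1 hσ).2⟩, h3⟩

end Restriction

/-! ### Counting rooted forests. -/

section Forests

variable {n : ℕ}

lemma card_filter_fixing (C : Finset (Fin n)) :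
    #(univ.filter fun f : Fin n → Fin n => ∀ x ∈ C, f x = x) = n ^ #Cᶜ := by
  have : (univ.filter fun f : Fin n → Fin n => ∀ x ∈ C, f x = x) =
      Fintype.piFinset fun x => if x ∈ C then {x} else univ := by
    ext f
    simp only [mem_filter, mem_univ, true_and, Fintype.mem_piFinset]
    refine forall_congr' fun x => ?_
    by_cases hx : x ∈ C <;> simp [hx]
  rw [this, Fintype.card_piFinset]
  simp only [apply_ite card, card_singleton, card_univ, Fintype.card_fin]
  rw [prod_ite, prod_const_one, one_mul, prod_const]
  congr 2
  ext x; simp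

lemma card_perm_fixing (C D : Finset (Fin n)) :
    #(univ.filter fun σ : Equiv.Perm D => ∀ x : D, (x : Fin n) ∈ C → σ x = x) = (#(D \ C))! := by
  have e := Fintype.card_congr (Equiv.Perm.subtypeEquivSubtypePerm fun x : D => (x : Fin n) ∉ C)
  rw [Fintype.card_perm, Fintype.card_subtype, Fintype.card_subtype] at e
  simp only [not_not] at e
  rw [← e]
  congr 1
  rw [← card_map (Embedding.subtype (· ∈ D))]
  congr 1
  ext x
  simp only [Finset.mem_map, mem_filter, mem_univ, true_and, Embedding.subtype_apply, Subtype.exists,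
    exists_and_right, exists_eq_right, Finset.mem_sdiff]
  tauto

/-- Both sides count the mappings fixing every point of `C`. On the right they are sorted by the set
E of their other cyclic points: a permutation of C ∪ E fixing `C`, in (#E)! ways, and then a forest
rooted at C ∪ E. -/
lemma pow_eq_sum_extensions (C : Finset (Fin n)) :
    n ^ #Cᶜ = ∑ E ∈ Cᶜ.powerset, (#E)! * #(extensions (C ∪ E) 1) := by
  rw [← card_filter_fixing, card_eq_sum_card_fiberwise (f := fun f => cyclicPoints f \ C)
    (t := Cᶜ.powerset) (fun f _ => by
      simp only [coe_powerset, Set.mem_preimage, Set.mem_powerset_iff, coe_subset]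
      intro x hx
      simpa using (Finset.mem_sdiff.1 hx).2)]
  refine sum_congr rfl fun E hE => ?_
  have hd : Disjoint E C := by
    rw [← le_compl_iff_disjoint_right]; exact mem_powerset.1 hE
  have e1 : (C ∪ E) \ C = E := by rw [union_sdiff_left, hd.sdiff_eq_left]
  have h0 := card_perm_fixing C (C ∪ E)
  rw [e1] at h0
  rw [← h0, ← card_filter_cyclicPerm,
    filter_filter]
  congr 1
  ext f
  simp only [mem_filter, mem_univ, true_and]
  constructor
  · rintro ⟨h1, h2⟩
    have hC : C ⊆ cyclicPoints f := fun x hx =>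
      mem_cyclicPoints.2 ⟨1, one_pos, h1 x hx⟩
    have h3 : cyclicPoints f = C ∪ E := by rw [← h2, union_sdiff_of_subset hC]
    refine ⟨h3, fun x hx => Subtype.ext ?_⟩
    rw [coe_cyclicPerm h3, h1 x hx]
  · rintro ⟨h1, h2⟩
    refine ⟨fun x hx => ?_, by rw [h1, e1]⟩
    have h3 := h2 ⟨x, mem_union_left E hx⟩ hx
    rw [Subtype.ext_iff, coe_cyclicPerm h1] at h3
    exact h3

/-- Since m + j = (m + N) - (N - j), the j-th term is a difference of consecutive values of
N(N-1)…(N-j+1) (m + N)^(N+1-j), and the sum telescopes. -/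
lemma sum_choose_mul_factorial (m N : ℕ) :
    ∑ j ∈ range (N + 1), N.choose j * (j ! * ((m + j) * (m + N) ^ (N - j))) =
      (m + N) ^ (N + 1) := by
  have h : ∀ j ∈ range (N + 1), ((N.choose j * (j ! * ((m + j) * (m + N) ^ (N - j))) : ℕ) : ℤ) =
      N.descFactorial j * (m + N) ^ (N + 1 - j) -
        N.descFactorial (j + 1) * (m + N) ^ (N + 1 - (j + 1)) := fun j hj => by
    have hj' : j ≤ N := by simpa [Nat.lt_succ_iff] using hj
    obtain ⟨d, rfl⟩ := Nat.exists_eq_add_of_le hj'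
    rw [Nat.descFactorial_succ, Nat.descFactorial_eq_factorial_mul_choose,
      show j + d + 1 - j = d + 1 by omega, show j + d - j = d by omega,
      show j + d + 1 - (j + 1) = d by omega]
    push_cast
    ring
  have h2 := sum_congr rfl h
  rw [sum_range_sub' (fun j => (N.descFactorial j * (m + N) ^ (N + 1 - j) : ℤ))] at h2
  simp only [Nat.descFactorial_zero, Nat.cast_one, one_mul, Nat.sub_zero,
    Nat.descFactorial_of_lt (Nat.lt_succ_self N), Nat.cast_zero, zero_mul, sub_zero] at h2
  exact_mod_cast h2

/-- The number of rooted forests with the set `C` of roots, times `n`. -/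
lemma mul_card_extensions (C : Finset (Fin n)) :
    n * #(extensions C 1) = #C * n ^ #Cᶜ := by
  -- The expected counts satisfy the recursion `pow_eq_sum_extensions` by
  -- `sum_choose_mul_factorial`. By induction the terms with E ≠ ∅ agree, so the term E = ∅ agrees
  -- too. The factor n avoids the exponent #Cᶜ - 1, which would be negative for full C.
  induction hN : #Cᶜ using Nat.strong_induction_on generalizing C with
  | _ N ih =>
    have hn : #C + N = n := by rw [← hN, card_add_card_compl, Fintype.card_fin]
    have h1 := congrArg (n * ·) (pow_eq_sum_extensions C)
    have h2 := sum_choose_mul_factorial #C N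
    simp only [← smul_eq_mul] at h2
    rw [← hN, ← sum_powerset_apply_card (fun j => j ! • ((#C + j) • (#C + #Cᶜ) ^ (#Cᶜ - j))), hN,
      hn] at h2
    simp only [smul_eq_mul] at h2
    simp only [hN, mul_sum] at h1
    rw [← pow_succ', ← h2] at h1
    have he : ∅ ∈ Cᶜ.powerset := empty_mem_powerset _
    rw [← add_sum_erase _ _ he, ← add_sum_erase _ _ he] at h1
    have h3 : ∀ E ∈ Cᶜ.powerset.erase ∅, (#E)! * ((#C + #E) * n ^ (N - #E)) =
        n * ((#E)! * #(extensions (C ∪ E) 1)) := fun E hE => by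
      obtain ⟨hE0, hE⟩ := mem_erase.1 hE
      rw [mem_powerset] at hE
      have hd : Disjoint C E := by
        rw [disjoint_comm, ← le_compl_iff_disjoint_right]; exact hE
      have hc : #(C ∪ E) = #C + #E := card_union_of_disjoint hd
      have hc' : #(C ∪ E)ᶜ = N - #E := by
        rw [card_compl, hc, Fintype.card_fin]; omega
      have hpos : 0 < #E := card_pos.2 (nonempty_iff_ne_empty.2 hE0)
      have hle : #E ≤ N := hN ▸ card_le_card hE
      have := ih (N - #E) (by omega) (C ∪ E) hc'
      rw [hc] at this
      rw [← this]; ring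
    rw [sum_congr rfl h3, Nat.add_right_cancel_iff] at h1
    have h4 : #(extensions (C ∪ ∅) 1) = #(extensions C 1) := by rw [union_empty]
    simpa [h4] using h1.symm

end Forests

end RandomMapping

/-! ### Cycle lengths of a mapping and of its induced permutation. -/

namespace RandomMapping

open Function Finset

section CycleLengths

variable {n : ℕ}

lemma mem_cycles {f : Fin n → Fin n} {c : Cycle (Fin n)} :
    c ∈ cycles f ↔ ∃ x ∈ periodicPts f, periodicOrbit f x = c := by
  simp [cycles, mem_cyclicPoints]

lemma periodicOrbit_eq_iff {f : Fin n → Fin n} {x y : Fin n} (hx : x ∈ periodicPts f)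
    (hy : y ∈ periodicPts f) : periodicOrbit f y = periodicOrbit f x ↔ y ∈ periodicOrbit f x := by
  constructor
  · intro h
    rw [← h]
    exact self_mem_periodicOrbit hy
  · intro h
    obtain ⟨k, rfl⟩ := (mem_periodicOrbit_iff hx).1 h
    exact periodicOrbit_apply_iterate_eq hx k

lemma card_filter_periodicOrbit {f : Fin n → Fin n} {c : Cycle (Fin n)} (hc : c ∈ cycles f) :
    #((cyclicPoints f).filter fun y => periodicOrbit f y = c) = c.length := by
  obtain ⟨x, hx, rfl⟩ := mem_cycles.1 hc
  obtain ⟨l, hl⟩ : ∃ l : List (Fin n), periodicOrbit f x = l := ⟨_, rfl⟩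
  have hn : #(periodicOrbit f x).toFinset = (periodicOrbit f x).length := by
    have : (periodicOrbit f x).Nodup := nodup_periodicOrbit
    rw [hl] at this ⊢
    rw [Cycle.coe_toFinset, List.toFinset_card_of_nodup (by simpa using this), Cycle.length_coe]
  have hm (y) : y ∈ (periodicOrbit f x).toFinset ↔ y ∈ periodicOrbit f x := by
    rw [hl, Cycle.coe_toFinset, List.mem_toFinset, Cycle.mem_coe_iff]
  have : (cyclicPoints f).filter (fun y => periodicOrbit f y = periodicOrbit f x) =
      (periodicOrbit f x).toFinset := by
    ext y
    rw [mem_filter, mem_cyclicPoints, hm]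
    constructor
    · rintro ⟨hy, h⟩
      exact (periodicOrbit_eq_iff hx hy).1 h
    · intro h
      obtain ⟨k, rfl⟩ := (mem_periodicOrbit_iff hx).1 h
      exact ⟨(bijOn_periodicPts f).mapsTo.iterate k hx, periodicOrbit_apply_iterate_eq hx k⟩
  rw [this, hn]

/-- Each cycle of length i holds exactly i cyclic points, all of minimal period i. Multiplicities
are recovered from minimal periods in this way, so cycles of f need not be matched with cycle
factors of a permutation. -/
lemma count_cycleLengths_mul (f : Fin n → Fin n) (i : ℕ) :
    (cycleLengths f).count i * i =
      #((cyclicPoints f).filter fun x => minimalPeriod f x = i) := by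
  rw [card_eq_sum_card_fiberwise (f := periodicOrbit f) (t := (cycles f).filter (·.length = i))
    (fun x hx => by
      obtain ⟨h1, h2⟩ := mem_filter.1 hx
      exact mem_filter.2 ⟨mem_cycles.2 ⟨x, mem_cyclicPoints.1 h1, rfl⟩,
        periodicOrbit_length.trans h2⟩), cycleLengths, Multiset.count_map]
  have h : ∀ c ∈ (cycles f).filter (·.length = i),
      #(((cyclicPoints f).filter fun x => minimalPeriod f x = i).filter
        fun x => periodicOrbit f x = c) = i := fun c hc => by
    obtain ⟨h1, h2⟩ := mem_filter.1 hc
    rw [filter_filter]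
    conv_rhs => rw [← h2, ← card_filter_periodicOrbit h1]
    congr 1
    refine filter_congr fun x _ => ?_
    constructor
    · exact fun h => h.2
    · exact fun h => ⟨by rw [← periodicOrbit_length (f := f), h, h2], h⟩
  rw [sum_congr rfl h, sum_const, smul_eq_mul]
  congr 1
  rw [card_def, filter_val]
  congr 1
  exact Multiset.filter_congr fun c _ => eq_comm

lemma zero_notMem_cycleLengths (f : Fin n → Fin n) : 0 ∉ cycleLengths f := by
  simp only [cycleLengths, Multiset.mem_map, mem_val, not_exists, not_and]
  intro c hc
  obtain ⟨x, hx, rfl⟩ := mem_cycles.1 hc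
  rw [periodicOrbit_length]
  exact (minimalPeriod_pos_of_mem_periodicPts hx).ne'

variable {β : Type*} [Fintype β] [DecidableEq β]

lemma minimalPeriod_perm (σ : Equiv.Perm β) {x : β} (hx : σ x ≠ x) :
    minimalPeriod σ x = #(σ.cycleOf x).support := by
  have hc := Equiv.Perm.isCycle_cycleOf σ hx
  rw [← hc.orderOf]
  refine Nat.dvd_right_iff_eq.1 fun k => ?_
  rw [← isPeriodicPt_iff_minimalPeriod_dvd, orderOf_dvd_iff_pow_eq_one, hc.pow_eq_one_iff'
    (x := x) (by rwa [Equiv.Perm.cycleOf_apply_self]), Equiv.Perm.cycleOf_pow_apply_self,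
    IsPeriodicPt, IsFixedPt, Equiv.Perm.iterate_eq_pow]

lemma count_parts_partition_mul (σ : Equiv.Perm β) (i : ℕ) :
    σ.partition.parts.count i * i = #(univ.filter fun x => minimalPeriod σ x = i) := by
  rw [Equiv.Perm.parts_partition, Multiset.count_add, Multiset.count_replicate]
  rcases eq_or_ne i 1 with rfl | h1
  · have h0 : σ.cycleType.count 1 = 0 := Multiset.count_eq_zero.2 fun h => by
      have := Equiv.Perm.two_le_of_mem_cycleType h; omega
    have e : (univ.filter fun x => minimalPeriod σ x = 1) = σ.supportᶜ := by
      ext x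
      simp [minimalPeriod_eq_one_iff_isFixedPt, IsFixedPt]
    rw [h0, e, card_compl]
    simp
  · rw [if_neg h1.symm, add_zero, Equiv.Perm.cycleType_def, Multiset.count_map]
    rcases eq_or_ne i 0 with rfl | hi0
    · rw [mul_zero, eq_comm, card_eq_zero, filter_eq_empty_iff]
      intro x _
      exact (minimalPeriod_pos_of_mem_periodicPts (σ.injective.mem_periodicPts x)).ne'
    have hne : ∀ x, minimalPeriod σ x = i → σ x ≠ x := fun x hx h =>
      h1 (hx ▸ minimalPeriod_eq_one_iff_isFixedPt.2 h)
    rw [card_eq_sum_card_fiberwise (f := σ.cycleOf)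
      (t := σ.cycleFactorsFinset.filter fun c => i = #c.support) (fun x hx => by
        have hx' := (mem_filter.1 hx).2
        have h := hne x hx'
        exact mem_filter.2 ⟨Equiv.Perm.cycleOf_mem_cycleFactorsFinset_iff.2
          (Equiv.Perm.mem_support.2 h), by rw [← minimalPeriod_perm σ h, hx']⟩)]
    have h : ∀ c ∈ σ.cycleFactorsFinset.filter (fun c => i = #c.support),
        #((univ.filter fun x => minimalPeriod σ x = i).filter fun x => σ.cycleOf x = c) = i := by
      intro c hc
      obtain ⟨hc1, hc2⟩ := mem_filter.1 hc
      conv_rhs => rw [hc2]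
      congr 1
      ext x
      simp only [mem_filter, mem_univ, true_and]
      constructor
      · rintro ⟨hx1, rfl⟩
        exact (Equiv.Perm.mem_support_cycleOf_iff).2 ⟨Equiv.Perm.SameCycle.rfl,
          Equiv.Perm.mem_support.2 (hne x hx1)⟩
      · intro hx
        have h2 := Equiv.Perm.cycle_is_cycleOf hx hc1
        have h3 : σ x ≠ x := Equiv.Perm.mem_support.1
          (Equiv.Perm.mem_cycleFactorsFinset_support_le hc1 hx)
        exact ⟨by rw [minimalPeriod_perm σ h3, ← h2, hc2], h2.symm⟩
    rw [sum_congr rfl h, sum_const, smul_eq_mul]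
    congr 1

lemma minimalPeriod_cyclicPerm {f : Fin n → Fin n} {C : Finset (Fin n)}
    (h : cyclicPoints f = C) (x : C) : minimalPeriod (cyclicPerm C f) x = minimalPeriod f x := by
  have hk (k : ℕ) : (((cyclicPerm C f)^[k] x : C) : Fin n) = f^[k] x := by
    induction k with
    | zero => rfl
    | succ k ih => rw [iterate_succ_apply', iterate_succ_apply', coe_cyclicPerm h, ih]
  refine minimalPeriod_eq_minimalPeriod_iff.2 fun k => ?_
  rw [IsPeriodicPt, IsFixedPt, IsPeriodicPt, IsFixedPt, Subtype.ext_iff, hk]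

/-- For each i > 0, the multiplicity of i times i counts points of minimal period i on both sides,
and minimal periods are unchanged by restriction; 0 occurs on neither side. -/
lemma cycleLengths_eq {f : Fin n → Fin n} {C : Finset (Fin n)} (h : cyclicPoints f = C) :
    cycleLengths f = (cyclicPerm C f).partition.parts := by
  ext i
  rcases Nat.eq_zero_or_pos i with rfl | hi
  · rw [Multiset.count_eq_zero.2 (zero_notMem_cycleLengths f), eq_comm, Multiset.count_eq_zero]
    exact fun h => absurd ((cyclicPerm C f).partition.parts_pos h) (lt_irrefl 0)
  refine Nat.eq_of_mul_eq_mul_right hi ?_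
  rw [count_cycleLengths_mul, count_parts_partition_mul, h,
    ← card_map (Embedding.subtype (· ∈ C))]
  congr 1
  ext x
  simp only [Finset.mem_map, mem_filter, mem_univ, true_and, Embedding.subtype_apply,
    Subtype.exists, exists_and_right, exists_eq_right, minimalPeriod_cyclicPerm h]
  exact ⟨fun hx => ⟨hx.1, hx.2⟩, fun ⟨h1, h2⟩ => ⟨h1, h2⟩⟩

end CycleLengths

section Longest

/-- In a decreasing list the entries above k form an initial segment. The default 0 is never above
k, so positions past the end are covered. -/
lemma lt_getD_sort_iff (s : Multiset ℕ) (i k : ℕ) :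
    k < (s.sort (· ≥ ·)).getD i 0 ↔ i < Multiset.card (s.filter (k < ·)) := by
  have h1 : s.filter (k < ·) = ((s.sort (· ≥ ·)).filter (k < ·) : List ℕ) := by
    conv_lhs => rw [← Multiset.sort_eq s (· ≥ ·)]
    rfl
  rw [h1, Multiset.coe_card]
  have hs : (s.sort (· ≥ ·)).Pairwise (· ≥ ·) := Multiset.pairwise_sort s (· ≥ ·)
  generalize s.sort (· ≥ ·) = l at hs
  induction l generalizing i with
  | nil => simp
  | cons a l ih =>
    rw [List.pairwise_cons] at hs
    by_cases ha : k < a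
    · cases i with
      | zero => simp [ha]
      | succ i => simp [ha, ← ih i hs.2]
    · have hl : l.filter (k < ·) = [] := by
        rw [List.filter_eq_nil_iff]
        intro b hb
        have := hs.1 b hb
        simp; omega
      have hl2 : (a :: l).filter (k < ·) = [] := by
        rw [List.filter_cons_of_neg (by simpa using ha), hl]
      rw [hl2]
      cases i with
      | zero => simpa using ha
      | succ i => simpa [hl] using ih i hs.2

lemma lt_longestCycle_iff {n : ℕ} (f : Fin n → Fin n) {r : ℕ} (hr : 1 ≤ r) (k : ℕ) :
    k < longestCycle r f ↔ r ≤ Multiset.card ((cycleLengths f).filter (k < ·)) := by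
  rw [longestCycle, lt_getD_sort_iff]
  omega

end Longest

end RandomMapping

/-! ### Cycle-type weights and the joint law of N and the longest cycles. -/

namespace RandomMapping

open Function Finset

section Weight

/-- The proportion of the permutations with the cycle lengths `s`, fixed points included. -/
def cycleWeight (s : Multiset ℕ) : ℝ :=
  ((s.prod : ℝ) * ∏ i ∈ s.toFinset, ((s.count i)! : ℝ))⁻¹

lemma prod_count_factorial (s : Multiset ℕ) {T : Finset ℕ} (h : s.toFinset ⊆ T) :
    ∏ i ∈ s.toFinset, (s.count i)! = ∏ i ∈ T, (s.count i)! :=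
  prod_subset h fun i _ hi => by
    rw [Multiset.mem_toFinset] at hi
    rw [Multiset.count_eq_zero.2 hi, Nat.factorial_zero]

/-- Adding a part j multiplies the product of the parts by j and the factorials by the new
multiplicity of j. -/
lemma cycleWeight_cons {j : ℕ} (hj : 0 < j) (s : Multiset ℕ) :
    j * (j ::ₘ s).count j * cycleWeight (j ::ₘ s) = cycleWeight s := by
  have h1 : ∏ i ∈ (j ::ₘ s).toFinset, ((j ::ₘ s).count i)! =
      (j ::ₘ s).count j * ∏ i ∈ s.toFinset, (s.count i)! := by
    rw [prod_count_factorial s (T := (j ::ₘ s).toFinset)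
      (by rw [Multiset.toFinset_cons]; exact subset_insert _ _)]
    have hm : j ∈ (j ::ₘ s).toFinset := by simp
    rw [← mul_prod_erase _ _ hm, ← mul_prod_erase _ _ hm, Multiset.count_cons_self,
      Nat.factorial_succ, mul_assoc]
    congr 2
    refine prod_congr rfl fun i hi => ?_
    rw [Multiset.count_cons_of_ne (ne_of_mem_erase hi)]
  have h2 := congrArg (Nat.cast : ℕ → ℝ) h1
  push_cast at h2
  rw [cycleWeight, cycleWeight, h2, Multiset.prod_cons, Nat.cast_mul]
  have h3 : (((j ::ₘ s).count j : ℕ) : ℝ) ≠ 0 := by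
    rw [Multiset.count_cons_self]; positivity
  have h4 : (j : ℝ) ≠ 0 := by positivity
  rw [mul_mul_mul_comm, mul_inv, ← mul_assoc, mul_inv_cancel₀ (mul_ne_zero h4 h3), one_mul]

/-- Cauchy's formula, obtained from the count by `cycleType`. The latter omits fixed points, so the
parts 1 are split off; they leave the product alone and contribute one factorial. -/
lemma card_filter_partition {β : Type*} [Fintype β] [DecidableEq β]
    (p : (Fintype.card β).Partition) :
    (#(univ.filter fun σ : Equiv.Perm β => σ.partition = p) : ℝ) =
      (Fintype.card β)! * cycleWeight p.parts := by
  set s := p.parts with hs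
  set t := s.filter (2 ≤ ·) with ht
  have h0 : s = t + Multiset.replicate (s.count 1) 1 := by
    conv_lhs => rw [← Multiset.filter_add_not (2 ≤ ·) s]
    congr 1
    rw [← Multiset.filter_eq' s 1]
    refine Multiset.filter_congr fun i hi => ?_
    have := p.parts_pos hi
    omega
  have hsum : t.sum + s.count 1 = Fintype.card β := by
    rw [← p.parts_sum, ← hs]
    conv_rhs => rw [h0]
    simp
  have e1 : (univ.filter fun σ : Equiv.Perm β => σ.partition = p) =
      univ.filter fun σ => σ.cycleType = t := by
    refine filter_congr fun σ _ => ⟨fun h => ?_, fun h => ?_⟩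
    · rw [← Equiv.Perm.filter_parts_partition_eq_cycleType, h]
    · refine Nat.Partition.ext ?_
      have h' : Fintype.card β - t.sum = s.count 1 := by omega
      rw [Equiv.Perm.parts_partition, h, ← Equiv.Perm.sum_cycleType, h, h', ← h0]
  have h2 : ∀ a ∈ t, 2 ≤ a := fun a ha => (Multiset.mem_filter.1 ha).2
  have h3 := Equiv.Perm.card_of_cycleType_mul_eq β t
  rw [if_pos ⟨by omega, h2⟩, ← hsum, Nat.add_sub_cancel_left, hsum] at h3
  have h4 : t.prod = s.prod := by
    conv_rhs => rw [h0]
    simp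
  have hc : ∀ i, t.count i = if 2 ≤ i then s.count i else 0 := fun i => by
    rw [ht, Multiset.count_filter]
  have h5 : ∏ i ∈ s.toFinset, (s.count i)! = (s.count 1)! * ∏ i ∈ t.toFinset, (t.count i)! := by
    rw [prod_count_factorial s (subset_insert 1 _), prod_count_factorial t (T := insert 1 s.toFinset)
      ((Multiset.toFinset_subset.2 (Multiset.filter_subset _ _)).trans (subset_insert 1 _)),
      ← mul_prod_erase _ _ (mem_insert_self 1 _), ← mul_prod_erase _ _ (mem_insert_self 1 _),
      hc 1, if_neg (by norm_num), Nat.factorial_zero, one_mul]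
    congr 1
    refine prod_congr rfl fun i hi => ?_
    rw [hc]
    obtain ⟨hi1, hi2⟩ := mem_erase.1 hi
    have := p.parts_pos (Multiset.mem_toFinset.1 ((mem_insert.1 hi2).resolve_left hi1))
    rw [if_pos (by omega)]
  have h6 : (s.prod : ℝ) * ∏ i ∈ s.toFinset, ((s.count i)! : ℝ) ≠ 0 := by
    refine mul_ne_zero (Nat.cast_ne_zero.2 (Multiset.prod_ne_zero fun h => ?_))
      (prod_ne_zero_iff.2 fun i _ => by positivity)
    exact absurd (p.parts_pos h) (lt_irrefl 0)
  rw [e1, cycleWeight, eq_mul_inv_iff_mul_eq₀ h6]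
  rw [h4] at h3
  have h7 := congrArg (Nat.cast : ℕ → ℝ) h3
  have h8 := congrArg (Nat.cast : ℕ → ℝ) h5
  rw [Nat.cast_mul, Nat.cast_mul, Nat.cast_mul] at h7
  push_cast at h8
  rw [Nat.cast_prod] at h7
  rw [h8, ← h7]
  ring

/-- The probability that a uniformly random permutation of `m` points has fewer than `r` cycles
longer than `k`. -/
def permProb (k r m : ℕ) : ℝ :=
  ∑ p : m.Partition with Multiset.card (p.parts.filter (k < ·)) < r, cycleWeight p.parts

lemma card_filter_perm {β : Type*} [Fintype β] [DecidableEq β] (k r : ℕ) :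
    (#(univ.filter fun σ : Equiv.Perm β =>
      Multiset.card (σ.partition.parts.filter (k < ·)) < r) : ℝ) =
      (Fintype.card β)! * permProb k r (Fintype.card β) := by
  rw [card_eq_sum_card_fiberwise (f := Equiv.Perm.partition)
    (t := univ.filter fun p : (Fintype.card β).Partition =>
      Multiset.card (p.parts.filter (k < ·)) < r) (fun σ hσ => by simpa using hσ),
    Nat.cast_sum, permProb, mul_sum]
  refine sum_congr rfl fun p hp => ?_
  rw [← card_filter_partition, filter_filter]
  congr 2
  refine filter_congr fun σ _ => ⟨fun h => h.2, fun h => ⟨by rw [h]; exact (mem_filter.1 hp).2, h⟩⟩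

lemma permProb_zero (k r : ℕ) : permProb k r 0 = if 0 < r then 1 else 0 := by
  have h : (default : Nat.Partition 0).parts = 0 := by
    have := (default : Nat.Partition 0).parts_sum
    by_contra h
    obtain ⟨a, ha⟩ := Multiset.exists_mem_of_ne_zero h
    have h1 := (default : Nat.Partition 0).parts_pos ha
    have h2 := Multiset.le_sum_of_mem ha
    omega
  rw [permProb, sum_filter, Fintype.sum_unique, h]
  simp [cycleWeight]

/-- The length of the cycle through a given point is uniform on 1, …, m, and the other points carry
a uniform permutation. The proof writes m = ∑ j · count j and removes one part j. A cycle longer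
than k lowers the allowance r by one; truncation at r = 0 is harmless because the probability is 0
there. -/
lemma mul_permProb (k r m : ℕ) :
    m * permProb k r m =
      ∑ j ∈ Icc 1 m, permProb k (r - if k < j then 1 else 0) (m - j) := by
  have h1 (p : m.Partition) : (m : ℝ) = ∑ j ∈ Icc 1 m, (j * p.parts.count j : ℝ) := by
    have hs : p.parts.toFinset ⊆ Icc 1 m := fun j hj => by
      rw [Multiset.mem_toFinset] at hj
      rw [mem_Icc]
      exact ⟨p.parts_pos hj, (Multiset.le_sum_of_mem hj).trans p.parts_sum.le⟩
    have h2 := sum_multiset_count p.parts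
    rw [p.parts_sum] at h2
    conv_lhs => rw [h2]
    push_cast
    rw [sum_subset hs fun j _ hj => by
      rw [Multiset.mem_toFinset] at hj
      rw [Multiset.count_eq_zero.2 hj]; simp]
    exact sum_congr rfl fun j _ => by rw [nsmul_eq_mul, mul_comm]; simp
  have h3 : (m : ℝ) * permProb k r m = ∑ p : m.Partition with
      Multiset.card (p.parts.filter (k < ·)) < r,
      ∑ j ∈ Icc 1 m, (j * p.parts.count j : ℝ) * cycleWeight p.parts := by
    rw [permProb, mul_sum]
    refine sum_congr rfl fun p _ => ?_
    rw [← sum_mul, ← h1]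
  rw [h3, sum_comm]
  refine sum_congr rfl fun j hj => ?_
  obtain ⟨hj1, hj2⟩ := mem_Icc.1 hj
  symm
  let e (q : (m - j).Partition) : m.Partition :=
    ⟨j ::ₘ q.parts, fun hi => by
      rcases Multiset.mem_cons.1 hi with rfl | hi
      · exact hj1
      · exact q.parts_pos hi, by rw [Multiset.sum_cons, q.parts_sum]; omega⟩
  have he (q) : (e q).parts = j ::ₘ q.parts := rfl
  have hcard (q : (m - j).Partition) : Multiset.card ((e q).parts.filter (k < ·)) < r ↔
      Multiset.card (q.parts.filter (k < ·)) < r - if k < j then 1 else 0 := by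
    rw [he]
    by_cases h : k < j
    · rw [Multiset.filter_cons_of_pos _ h, Multiset.card_cons, if_pos h]; exact Nat.lt_sub_iff_add_lt.symm
    · rw [Multiset.filter_cons_of_neg _ h, if_neg h, Nat.sub_zero]
  rw [permProb]
  refine sum_of_injOn e ?_ ?_ ?_ ?_
  · intro q _ q' _ h
    have := congrArg Nat.Partition.parts h
    rw [he, he, Multiset.cons_inj_right] at this
    exact Nat.Partition.ext this
  · intro q hq
    simpa [hcard] using hq
  · intro p hp hpe
    have hnot : j ∉ p.parts := fun hmem => by
      refine hpe ⟨⟨p.parts.erase j, fun hi => p.parts_pos (Multiset.mem_of_mem_erase hi), ?_⟩,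
        ?_, ?_⟩
      · have := Multiset.sum_erase hmem
        rw [p.parts_sum] at this
        omega
      · have e2 : p = e ⟨p.parts.erase j, fun hi => p.parts_pos (Multiset.mem_of_mem_erase hi), by
            have := Multiset.sum_erase hmem
            rw [p.parts_sum] at this
            omega⟩ := Nat.Partition.ext (by rw [he, Multiset.cons_erase hmem])
        rw [e2, mem_filter, hcard] at hp
        simpa using hp.2
      · exact Nat.Partition.ext (by rw [he, Multiset.cons_erase hmem])
    rw [Multiset.count_eq_zero.2 hnot]
    simp
  · intro q _
    rw [he, cycleWeight_cons hj1]

end Weight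

/-- There are `n.choose m` cyclic sets, m! · `permProb k r m` suitable permutations of each, and m ·
n^(n-m) / n extensions of each permutation. -/
lemma card_joint (n m k : ℕ) {r : ℕ} (hr : 1 ≤ r) :
    (n : ℝ) * #(univ.filter fun f : Fin n → Fin n =>
      numCyclicPoints f = m ∧ ¬ k < longestCycle r f) =
      n.descFactorial m * m * n ^ (n - m) * permProb k r m := by
  have h1 : (univ.filter fun f : Fin n → Fin n =>
      numCyclicPoints f = m ∧ ¬ k < longestCycle r f) =
      (univ.filter fun f : Fin n → Fin n => cyclicPoints f ∈ powersetCard m univ ∧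
        ¬ k < longestCycle r f) := by
    refine filter_congr fun f _ => ?_
    rw [mem_powersetCard_univ, numCyclicPoints]
  rw [h1, card_eq_sum_card_fiberwise (f := cyclicPoints) (t := powersetCard m univ)
    (fun f hf => (mem_filter.1 hf).2.1), Nat.cast_sum, mul_sum]
  have h2 : ∀ C ∈ powersetCard m (univ : Finset (Fin n)), (n : ℝ) *
      #((univ.filter fun f : Fin n → Fin n => cyclicPoints f ∈ powersetCard m univ ∧
        ¬ k < longestCycle r f).filter fun f => cyclicPoints f = C) =
      m ! * permProb k r m * (m * n ^ (n - m)) := fun C hC => by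
    rw [mem_powersetCard_univ] at hC
    have h3 := congrArg (Nat.cast : ℕ → ℝ) (mul_card_extensions C)
    have h4 := card_filter_perm (β := C) k r
    rw [card_compl, Fintype.card_fin, hC] at h3
    have h4 := h4.trans (b := _) (c := m ! * permProb k r m) (by rw [Fintype.card_coe, hC])
    push_cast at h3
    rw [← h3, ← h4, mul_left_comm, ← Nat.cast_mul (#_), ← card_filter_cyclicPerm, filter_filter]
    congr 3
    refine filter_congr fun f _ => ?_
    rw [mem_powersetCard_univ]
    constructor
    · rintro ⟨⟨-, h5⟩, h6⟩
      refine ⟨h6, ?_⟩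
      rw [← cycleLengths_eq h6]
      rwa [lt_longestCycle_iff f hr, not_le] at h5
    · rintro ⟨h5, h6⟩
      rw [← cycleLengths_eq h5] at h6
      rw [lt_longestCycle_iff f hr, not_le]
      exact ⟨⟨by rw [h5, hC], h6⟩, h5⟩
  rw [sum_congr rfl h2, sum_const, card_powersetCard, card_univ, Fintype.card_fin, nsmul_eq_mul,
    Nat.descFactorial_eq_factorial_mul_choose]
  push_cast
  ring

end RandomMapping

/-! ### The generating function of `permProb`. -/

namespace RandomMapping

section PermProb

open Finset

lemma cycleWeight_nonneg (s : Multiset ℕ) : 0 ≤ cycleWeight s := by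
  unfold cycleWeight; positivity

lemma permProb_nonneg (k r m : ℕ) : 0 ≤ permProb k r m :=
  sum_nonneg fun _ _ => cycleWeight_nonneg _

lemma permProb_mono (k m : ℕ) {r r' : ℕ} (h : r ≤ r') : permProb k r m ≤ permProb k r' m :=
  sum_le_sum_of_subset_of_nonneg
    (fun _ hp => mem_filter.2 ⟨mem_univ _, (mem_filter.1 hp).2.trans_le h⟩)
    fun _ _ _ => cycleWeight_nonneg _

@[simp] lemma permProb_zero_right (k m : ℕ) : permProb k 0 m = 0 := by simp [permProb]

lemma mul_permProb_eq (k r m : ℕ) :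
    m * permProb k r m = ∑ i ∈ range m, permProb k (r - if i + k < m then 1 else 0) i := by
  rw [mul_permProb]
  refine sum_nbij' (fun j => m - j) (fun i => m - i) ?_ ?_ ?_ ?_ ?_
  · intro j hj; simp only [mem_Icc, mem_range] at *; omega
  · intro j hj; simp only [mem_Icc, mem_range] at *; omega
  · intro j hj; simp only [mem_Icc] at *; omega
  · intro j hj; simp only [mem_range] at *; omega
  · intro j hj
    have h : k < j ↔ m - j + k < m := by simp only [mem_Icc] at *; omega
    simp only [h]

/-- The change of `permProb` when a point is added. -/
lemma succ_mul_permProb_sub (k r m : ℕ) :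
    (m + 1) * (permProb k r (m + 1) - permProb k r m) =
      if k ≤ m then permProb k (r - 1) (m - k) - permProb k r (m - k) else 0 := by
  have h1 := mul_permProb_eq k r (m + 1)
  have h2 := mul_permProb_eq k r m
  rw [sum_range_succ] at h1
  have h3 : ∑ i ∈ range m, permProb k (r - if i + k < m + 1 then 1 else 0) i -
      ∑ i ∈ range m, permProb k (r - if i + k < m then 1 else 0) i =
      if k ≤ m ∧ 0 < k then permProb k (r - 1) (m - k) - permProb k r (m - k) else 0 := by
    rw [← sum_sub_distrib]
    split_ifs with h
    · rw [sum_eq_single (m - k)]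
      · rw [if_pos (by omega), if_neg (by omega), Nat.sub_zero]
      · intro i _ hi
        by_cases h4 : i + k < m
        · rw [if_pos h4, if_pos (by omega), sub_self]
        · rw [if_neg h4, if_neg (by omega), sub_self]
      · intro h4
        exact absurd (mem_range.2 (by omega)) h4
    · refine sum_eq_zero fun i hi => ?_
      rw [mem_range] at hi
      by_cases h4 : i + k < m
      · rw [if_pos h4, if_pos (by omega), sub_self]
      · rw [if_neg h4, if_neg (by omega), sub_self]
  push_cast at h1
  rcases Nat.eq_zero_or_pos k with rfl | hk
  · simp at h1 h2 h3 ⊢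
    linarith
  · simp only [hk, and_true] at h3
    rw [if_neg (show ¬ m + k < m + 1 by omega), Nat.sub_zero] at h1
    rw [← h3]
    linarith

/-- The increment is a nonnegative multiple of `permProb k (r - 1) - permProb k r` at an earlier
index, and lowering the allowance lowers the probability. -/
lemma permProb_antitone (k r : ℕ) : Antitone (permProb k r) := by
  refine antitone_nat_of_succ_le fun m => ?_
  have h := succ_mul_permProb_sub k r m
  have h1 : (if k ≤ m then permProb k (r - 1) (m - k) - permProb k r (m - k) else 0) ≤ 0 := by
    split_ifs
    · exact sub_nonpos.2 (permProb_mono k _ (Nat.sub_le r 1))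
    · rfl
  rw [← h] at h1
  have h2 := nonpos_of_mul_nonpos_right h1 (by positivity)
  linarith

lemma permProb_le_one (k r m : ℕ) : permProb k r m ≤ 1 := by
  refine (permProb_antitone k r (Nat.zero_le m)).trans ?_
  rw [permProb_zero]
  split_ifs <;> norm_num

lemma permProb_eq_one {k r m : ℕ} (hr : 0 < r) (h : m ≤ k) : permProb k r m = 1 := by
  induction m with
  | zero => rw [permProb_zero, if_pos hr]
  | succ m ih =>
    have h1 := succ_mul_permProb_sub k r m
    rw [if_neg (by omega), ih (by omega)] at h1
    have := (mul_eq_zero.1 h1).resolve_left (by positivity)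
    linarith

end PermProb

section PowerSeries

/-- The sum of the power series with the coefficients `a`. -/
def powerSum (a : ℕ → ℝ) (z : ℝ) : ℝ := ∑' m, a m * z ^ m

variable {a : ℕ → ℝ} {C z : ℝ}

lemma summable_mul_pow (ha : ∀ m, |a m| ≤ C) (hz : |z| < 1) : Summable fun m => a m * z ^ m := by
  refine Summable.of_norm_bounded ((summable_geometric_of_abs_lt_one (r := |z|)
    (by rwa [abs_abs])).mul_left C) fun m => ?_
  rw [norm_mul, norm_pow]
  exact mul_le_mul_of_nonneg_right (ha m) (by positivity)

lemma hasDerivAt_powerSum (ha : ∀ m, |a m| ≤ C) (hz : |z| < 1) :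
    HasDerivAt (powerSum a) (∑' m : ℕ, (m + 1) * a (m + 1) * z ^ m) z := by
  obtain ⟨ρ, h1, h2⟩ := exists_between hz
  have hρ : 0 < ρ := (abs_nonneg z).trans_lt h1
  have hu : Summable fun m : ℕ => C * (m * ρ ^ (m - 1)) := by
    refine Summable.mul_left C ?_
    have := (summable_pow_mul_geometric_of_norm_lt_one 1 (r := ρ)
      (by rwa [Real.norm_of_nonneg hρ.le])).mul_right ρ⁻¹
    refine this.congr fun m => ?_
    cases m with
    | zero => simp
    | succ m => rw [pow_one, Nat.add_sub_cancel, pow_succ]; field_simp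
  have hC : 0 ≤ C := (abs_nonneg _).trans (ha 0)
  have h := hasDerivAt_tsum_of_isPreconnected (𝕜 := ℝ) (F := ℝ) (t := Set.Ioo (-ρ) ρ) (y₀ := 0)
    (g := fun m y => a m * y ^ m) (g' := fun m y => a m * (m * y ^ (m - 1))) hu isOpen_Ioo
    isPreconnected_Ioo (fun m y _ => (hasDerivAt_pow m y).const_mul _) (fun m y hy => by
      rw [norm_mul, norm_mul, norm_pow, Real.norm_natCast]
      have : |y| ≤ ρ := (abs_lt.2 hy).le
      have := ha m
      simp only [Real.norm_eq_abs]
      gcongr) ⟨neg_lt_zero.2 hρ, hρ⟩ (summable_mul_pow ha (by simp)) (abs_lt.1 h1)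
  have hs : Summable fun m : ℕ => a m * (m * z ^ (m - 1)) := by
    refine Summable.of_norm_bounded hu fun m => ?_
    rw [norm_mul, norm_mul, norm_pow, Real.norm_natCast]
    have := ha m
    simp only [Real.norm_eq_abs]
    gcongr
  rw [hs.tsum_eq_zero_add] at h
  simp only [Nat.cast_zero, zero_mul, mul_zero, zero_add] at h
  refine h.congr_deriv (tsum_congr fun m => ?_)
  push_cast
  ring

lemma powerSum_eq_add (ha : ∀ m, |a m| ≤ C) (hz : |z| < 1) :
    powerSum a z = a 0 + z * powerSum (fun m => a (m + 1)) z := by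
  rw [powerSum, (summable_mul_pow ha hz).tsum_eq_zero_add, pow_zero, mul_one, powerSum,
    ← tsum_mul_left]
  congr 1
  exact tsum_congr fun m => by ring

end PowerSeries

section GeneratingFunction

/-- The tail `∑_{j > k} z ^ j / j` of the logarithm series. -/
def logTail (k : ℕ) (z : ℝ) : ℝ := powerSum (fun j => if k < j then (j : ℝ)⁻¹ else 0) z

lemma hasDerivAt_logTail (k : ℕ) {z : ℝ} (hz : |z| < 1) :
    HasDerivAt (logTail k) (z ^ k / (1 - z)) z := by
  have h := hasDerivAt_powerSum (a := fun j : ℕ => if k < j then (j : ℝ)⁻¹ else 0) (C := 1)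
    (fun j => by
      split_ifs with h
      · rw [abs_of_nonneg (by positivity)]
        exact inv_le_one_of_one_le₀ (by exact_mod_cast (by omega : 1 ≤ j))
      · simp) hz
  refine h.congr_deriv ?_
  have hs : HasSum (fun m : ℕ => z ^ (m + k)) (z ^ k / (1 - z)) := by
    have := (hasSum_geometric_of_abs_lt_one hz).mul_left (z ^ k)
    rw [← div_eq_mul_inv] at this
    simpa only [← pow_add, add_comm] using this
  have e : ∀ m : ℕ, ((m : ℝ) + 1) * (if k < m + 1 then ((m + 1 : ℕ) : ℝ)⁻¹ else 0) * z ^ m =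
      if k ≤ m then z ^ m else 0 := fun m => by
    by_cases h : k ≤ m
    · rw [if_pos h, if_pos (by omega)]
      push_cast
      rw [mul_inv_cancel₀ (by positivity), one_mul]
    · rw [if_neg h, if_neg (by omega)]; simp
  rw [tsum_congr e]
  refine HasSum.tsum_eq ?_
  rw [← hasSum_nat_add_iff' k, Finset.sum_eq_zero (fun i hi => by
    rw [if_neg (by simpa using hi)]), sub_zero]
  simpa using hs

lemma logTail_zero (k : ℕ) : logTail k 0 = 0 := by
  rw [logTail, powerSum, tsum_eq_single 0]
  · simp
  · intro m hm; simp [hm]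

/-- The probability that a Poisson variable with mean `y` is at least `r`. -/
def poissonTail (r : ℕ) (y : ℝ) : ℝ := 1 - Real.exp (-y) * ∑ s ∈ Finset.range r, y ^ s / s !

/-- Differentiating the Poisson weights telescopes, leaving only the last one. -/
lemma hasDerivAt_poissonTail (r : ℕ) (y : ℝ) :
    HasDerivAt (poissonTail (r + 1)) (Real.exp (-y) * (y ^ r / r !)) y := by
  induction r with
  | zero =>
    have : HasDerivAt (fun y : ℝ => 1 - Real.exp (-y)) (Real.exp (-y)) y := by
      simpa using ((hasDerivAt_neg y).exp).const_sub 1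
    exact (this.congr_of_eventuallyEq (Eventually.of_forall fun y => by simp [poissonTail])).congr_deriv
      (by simp)
  | succ r ih =>
    have e : poissonTail (r + 2) = fun y => poissonTail (r + 1) y -
        Real.exp (-y) * (y ^ (r + 1) / (r + 1)!) := by
      ext y
      rw [poissonTail, poissonTail, Finset.sum_range_succ _ (r + 1)]
      ring
    rw [e]
    have h2 := ih.sub (((hasDerivAt_neg y).exp).mul
      ((hasDerivAt_pow (r + 1) y).div_const ((r + 1)! : ℝ)))
    refine h2.congr_deriv ?_
    rw [Nat.factorial_succ]
    push_cast
    field_simp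
    ring

lemma poissonTail_sub_succ (r : ℕ) (y : ℝ) :
    poissonTail r y - poissonTail (r + 1) y = Real.exp (-y) * (y ^ r / r !) := by
  rw [poissonTail, poissonTail, Finset.sum_range_succ]
  ring

lemma abs_permProb_le (k r m : ℕ) : |permProb k r m| ≤ 1 := by
  rw [abs_of_nonneg (permProb_nonneg k r m)]; exact permProb_le_one k r m

/-- The change of `permProb k r` when the `m`-th point is added. -/
def permDiff (k r m : ℕ) : ℝ := permProb k r m - if m = 0 then 0 else permProb k r (m - 1)

lemma abs_permDiff_le (k r m : ℕ) : |permDiff k r m| ≤ 2 := by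
  unfold permDiff
  have h1 := permProb_nonneg k r m
  have h2 := permProb_le_one k r m
  have h3 := permProb_nonneg k r (m - 1)
  have h4 := permProb_le_one k r (m - 1)
  rw [abs_le]
  split_ifs <;> constructor <;> linarith

lemma powerSum_permDiff (k r : ℕ) {z : ℝ} (hz : |z| < 1) :
    powerSum (permDiff k r) z = (1 - z) * powerSum (permProb k r) z := by
  have h := summable_mul_pow (abs_permProb_le k r) hz
  have h1 : Summable fun m => permProb k r (m + 1) * z ^ m :=
    summable_mul_pow (fun m => abs_permProb_le k r (m + 1)) hz
  rw [powerSum_eq_add (abs_permDiff_le k r) hz]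
  have h2 : powerSum (fun m => permDiff k r (m + 1)) z =
      powerSum (fun m => permProb k r (m + 1)) z - powerSum (permProb k r) z := by
    rw [powerSum, powerSum, powerSum, ← h1.tsum_sub h]
    exact tsum_congr fun m => by simp [permDiff, sub_mul]
  have h3 := powerSum_eq_add (abs_permProb_le k r) hz
  rw [h2]
  simp only [permDiff, if_true]
  linear_combination -h3

/-- This is the recursion `succ_mul_permProb_sub` for coefficients: the factor m + 1 is
differentiation, the shift by k is multiplication by z^k. -/
lemma hasDerivAt_powerSum_permDiff (k r : ℕ) {z : ℝ} (hz : |z| < 1) :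
    HasDerivAt (powerSum (permDiff k (r + 1)))
      (z ^ k / (1 - z) * (powerSum (permDiff k r) z - powerSum (permDiff k (r + 1)) z)) z := by
  refine (hasDerivAt_powerSum (abs_permDiff_le k (r + 1)) hz).congr_deriv ?_
  have hz1 : 1 - z ≠ 0 := by have := (abs_lt.1 hz).2; linarith
  have h0 := summable_mul_pow (abs_permProb_le k r) hz
  have h1 := summable_mul_pow (abs_permProb_le k (r + 1)) hz
  have hs : HasSum (fun m => (permProb k r m - permProb k (r + 1) m) * z ^ (m + k))
      (z ^ k * (powerSum (permProb k r) z - powerSum (permProb k (r + 1)) z)) := by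
    refine ((h0.hasSum.sub h1.hasSum).mul_left (z ^ k)).congr_fun ?_
    intro m
    ring
  have e : ∀ m : ℕ, ((m : ℝ) + 1) * permDiff k (r + 1) (m + 1) * z ^ m =
      if k ≤ m then (permProb k r (m - k) - permProb k (r + 1) (m - k)) * z ^ m else 0 := fun m => by
    have := succ_mul_permProb_sub k (r + 1) m
    rw [permDiff, if_neg (Nat.succ_ne_zero m), show m + 1 - 1 = m from rfl, this,
      show r + 1 - 1 = r from rfl, ite_mul, zero_mul]
  rw [tsum_congr e, powerSum_permDiff k r hz, powerSum_permDiff k (r + 1) hz, ← mul_sub,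
    ← mul_assoc, div_mul_cancel₀ _ hz1]
  refine HasSum.tsum_eq ?_
  rw [← hasSum_nat_add_iff' k, Finset.sum_eq_zero (fun i hi => by
    rw [if_neg (by simpa using hi)]), sub_zero]
  simpa using hs

/-- Both sides solve the same linear equation, with inhomogeneity known by induction on r, and agree
at 0. With the integrating factor e^{logTail} their difference has derivative zero. In probabilistic
terms, at geometric size the number of cycles longer than k is Poisson with mean `logTail k z`. -/
lemma powerSum_permDiff_eq (k r : ℕ) {z : ℝ} (hz : |z| < 1) :
    powerSum (permDiff k r) z = 1 - poissonTail r (logTail k z) := by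
  induction r generalizing z with
  | zero =>
    rw [powerSum_permDiff k 0 hz]
    simp [powerSum, poissonTail]
  | succ r ih =>
    have hd : ∀ y ∈ Set.Ioo (-1 : ℝ) 1, HasDerivAt (fun y => Real.exp (logTail k y) *
        (powerSum (permDiff k (r + 1)) y - (1 - poissonTail (r + 1) (logTail k y)))) 0 y := by
      intro y hy
      have hy' : |y| < 1 := abs_lt.2 hy
      have h1 := hasDerivAt_logTail k hy'
      have h2 := hasDerivAt_powerSum_permDiff k r hy'
      have h3 := ((hasDerivAt_poissonTail r (logTail k y)).comp y h1).const_sub 1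
      refine (h1.exp.mul (h2.sub h3)).congr_deriv ?_
      rw [ih hy', ← poissonTail_sub_succ]
      simp only [Function.comp_apply, Pi.sub_apply]
      ring
    have h := isOpen_Ioo.is_const_of_deriv_eq_zero isPreconnected_Ioo
      (fun y hy => (hd y hy).differentiableAt.differentiableWithinAt)
      (fun y hy => (hd y hy).deriv) (abs_lt.1 hz) (show (0 : ℝ) ∈ Set.Ioo (-1 : ℝ) 1 by simp)
    have h0 : powerSum (permDiff k (r + 1)) 0 = 1 := by
      rw [powerSum, tsum_eq_single 0 (fun m hm => by simp [hm])]
      simp [permDiff, permProb_zero]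
    have h1 : poissonTail (r + 1) 0 = 0 := by
      rw [poissonTail, Finset.sum_eq_single 0] <;> simp +contextual
    simp only [logTail_zero, h0, h1] at h
    simp only [sub_zero, sub_self, mul_zero, mul_eq_zero, Real.exp_ne_zero, false_or] at h
    linarith

/-- The generating function of the probability of at least `r` cycles longer than `k`. -/
lemma hasSum_one_sub_permProb (k r : ℕ) {z : ℝ} (hz : |z| < 1) :
    HasSum (fun m => (1 - permProb k r m) * z ^ m) (poissonTail r (logTail k z) / (1 - z)) := by
  have hz1 : 1 - z ≠ 0 := by have := (abs_lt.1 hz).2; linarith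
  have h := (hasSum_geometric_of_abs_lt_one hz).sub
    (summable_mul_pow (abs_permProb_le k r) hz).hasSum
  have e : (1 - z)⁻¹ - ∑' m, permProb k r m * z ^ m = poissonTail r (logTail k z) / (1 - z) := by
    have h1 := powerSum_permDiff k r hz
    rw [powerSum_permDiff_eq k r hz, powerSum] at h1
    field_simp
    linarith
  rw [e] at h
  simpa only [sub_mul, one_mul] using h

end GeneratingFunction

end RandomMapping

/-! ### Permutation moments, and the logarithmic tail compared with E. -/

namespace RandomMapping

section PermMoment

open Finset

/-- The `h`-th moment of the length of the `r`-th longest cycle of a uniformly random permutation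
of `m` points. -/
def permMoment (h r m : ℕ) : ℝ :=
  ∑ k ∈ range m, ((k + 1 : ℝ) ^ h - k ^ h) * (1 - permProb k r m)

lemma pow_diff_nonneg (h k : ℕ) : (0 : ℝ) ≤ (k + 1) ^ h - k ^ h :=
  sub_nonneg.2 (by gcongr; linarith)

lemma permMoment_nonneg (h r m : ℕ) : 0 ≤ permMoment h r m :=
  sum_nonneg fun k _ => mul_nonneg (pow_diff_nonneg h k)
    (sub_nonneg.2 (permProb_le_one k r m))

/-- The chance of at least r cycles longer than k grows with the number of points. This monotonicity
is the Tauberian condition. -/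
lemma permMoment_mono (h r : ℕ) : Monotone (permMoment h r) := fun m m' hm => by
  refine (sum_le_sum fun k _ => ?_).trans (sum_le_sum_of_subset_of_nonneg
    (range_subset_range.2 hm) fun k _ _ => ?_)
  · exact mul_le_mul_of_nonneg_left (sub_le_sub_left (permProb_antitone k r hm) 1)
      (pow_diff_nonneg h k)
  · exact mul_nonneg (pow_diff_nonneg h k) (sub_nonneg.2 (permProb_le_one k r m'))

lemma permMoment_le (h r m : ℕ) : permMoment h r m ≤ (m : ℝ) ^ h := by
  calc _ ≤ ∑ k ∈ range m, ((k + 1 : ℝ) ^ h - k ^ h) := sum_le_sum fun k _ =>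
        mul_le_of_le_one_right (pow_diff_nonneg h k) (by linarith [permProb_nonneg k r m])
    _ = (m : ℝ) ^ h - (0 : ℕ) ^ h := by
        have := sum_range_sub (fun k : ℕ => (k : ℝ) ^ h) m
        push_cast at this ⊢
        exact this
    _ ≤ _ := sub_le_self _ (by positivity)

lemma summable_permMoment_mul_pow (h r : ℕ) {z : ℝ} (h0 : 0 ≤ z) (h1 : z < 1) :
    Summable fun m => permMoment h r m * z ^ m := by
  refine Summable.of_nonneg_of_le (fun m => mul_nonneg (permMoment_nonneg h r m) (by positivity))
    (fun m => mul_le_mul_of_nonneg_right (permMoment_le h r m) (by positivity))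
    (summable_pow_mul_geometric_of_norm_lt_one h (r := z) ?_)
  rwa [Real.norm_of_nonneg h0]

/-- The nonnegative double series over the size m and the threshold k is summed in both orders. For
m ≤ k the terms vanish, which makes the inner sum over k finite. -/
lemma hasSum_poissonTail_logTail (h : ℕ) {r : ℕ} (hr : 0 < r) {z : ℝ} (h0 : 0 ≤ z) (h1 : z < 1) :
    HasSum (fun k : ℕ => ((k + 1 : ℝ) ^ h - k ^ h) * poissonTail r (logTail k z))
      ((1 - z) * ∑' m, permMoment h r m * z ^ m) := by
  let u : ℕ × ℕ → ℝ := fun x =>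
    ((x.2 + 1 : ℝ) ^ h - x.2 ^ h) * (1 - permProb x.2 r x.1) * z ^ x.1
  have hu : 0 ≤ u := fun x => mul_nonneg (mul_nonneg (pow_diff_nonneg h x.2)
    (sub_nonneg.2 (permProb_le_one x.2 r x.1))) (by positivity)
  have hrow (m : ℕ) : HasSum (fun k => u (m, k)) (permMoment h r m * z ^ m) := by
    rw [permMoment, sum_mul]
    refine hasSum_sum_of_ne_finset_zero fun k hk => ?_
    simp only [u, permProb_eq_one hr (by simpa using hk), sub_self, mul_zero, zero_mul]
  have hs : Summable u := (summable_prod_of_nonneg hu).2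
    ⟨fun m => (hrow m).summable, by
      simpa only [(hrow _).tsum_eq] using summable_permMoment_mul_pow h r h0 h1⟩
  have e := (hs.hasSum.prod_fiberwise hrow).tsum_eq
  have hcol (k : ℕ) : HasSum (fun m => (u ∘ Equiv.prodComm ℕ ℕ) (k, m))
      (((k + 1 : ℝ) ^ h - k ^ h) * (poissonTail r (logTail k z) / (1 - z))) := by
    have := (hasSum_one_sub_permProb k r (z := z) (by rwa [abs_of_nonneg h0])).mul_left
      ((k + 1 : ℝ) ^ h - k ^ h)
    simpa only [u, Function.comp, Equiv.prodComm_apply, Prod.swap_prod_mk, mul_assoc] using this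
  have h2 := ((((Equiv.prodComm ℕ ℕ).hasSum_iff (f := u)).2 hs.hasSum).prod_fiberwise
    hcol).mul_left (1 - z)
  rw [← e] at h2
  refine h2.congr_fun fun k => ?_
  have : 1 - z ≠ 0 := by linarith
  field_simp

end PermMoment

section Bounds

lemma continuous_poissonTail (r : ℕ) : Continuous (poissonTail r) := by
  unfold poissonTail; fun_prop

lemma poissonTail_nonneg (r : ℕ) {y : ℝ} (hy : 0 ≤ y) : 0 ≤ poissonTail r y := by
  have h := Real.sum_le_exp_of_nonneg hy r
  have h2 := mul_le_mul_of_nonneg_left h (Real.exp_pos (-y)).le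
  rw [← Real.exp_add, neg_add_cancel, Real.exp_zero] at h2
  exact sub_nonneg.2 h2

lemma poissonTail_le_one (r : ℕ) {y : ℝ} (hy : 0 ≤ y) : poissonTail r y ≤ 1 :=
  sub_le_self _ (by positivity)

lemma poissonTail_le {r : ℕ} (hr : 0 < r) {y : ℝ} (hy : 0 ≤ y) : poissonTail r y ≤ y := by
  have h1 : (1 : ℝ) ≤ ∑ s ∈ Finset.range r, y ^ s / s ! := by
    have := Finset.single_le_sum (f := fun s => y ^ s / (s ! : ℝ)) (fun s _ => by positivity)
      (Finset.mem_range.2 hr)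
    simpa using this
  have h2 := Real.add_one_le_exp (-y)
  have h3 := mul_le_mul_of_nonneg_left h1 (Real.exp_pos (-y)).le
  rw [poissonTail]
  linarith

lemma hasSum_logTail (k : ℕ) {z : ℝ} (hz : |z| < 1) :
    HasSum (fun j : ℕ => z ^ (j + (k + 1)) / (j + (k + 1) : ℕ)) (logTail k z) := by
  have h := (summable_mul_pow (a := fun j : ℕ => if k < j then (j : ℝ)⁻¹ else 0) (C := 1)
    (fun j => by
      split_ifs with h
      · rw [abs_of_nonneg (by positivity)]
        exact inv_le_one_of_one_le₀ (by exact_mod_cast (by omega : 1 ≤ j))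
      · simp) hz).hasSum
  rw [← hasSum_nat_add_iff' (k + 1), Finset.sum_eq_zero (fun i hi => by
    rw [if_neg (by rw [Finset.mem_range] at hi; omega), zero_mul]), sub_zero] at h
  refine h.congr_fun fun j => ?_
  rw [if_pos (by omega)]
  ring

lemma logTail_nonneg (k : ℕ) {z : ℝ} (h0 : 0 ≤ z) (h1 : z < 1) : 0 ≤ logTail k z :=
  (hasSum_logTail k (by rwa [abs_of_nonneg h0])).nonneg fun j => by positivity

/-- The decreasing integrand e^{-x}/x on an interval of length t, bounded by its end values.
Telescoping shows that ∑_{j>k} e^{-jt}/j lies between E((k+1)t) and E(kt). -/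
lemma expInt_sub_bounds {j : ℕ} (hj : 0 < j) {t : ℝ} (ht : 0 < t) :
    expInt (j * t) - expInt ((j + 1) * t) ∈
      Set.Icc (Real.exp (-t) ^ (j + 1) / (j + 1 : ℕ)) (Real.exp (-t) ^ j / j) := by
  have hj' : (0 : ℝ) < j := by exact_mod_cast hj
  have h0 : 0 < j * t := by positivity
  have hle : j * t ≤ (j + 1) * t := by nlinarith
  have hi : IntervalIntegrable (fun x => Real.exp (-x) / x) volume (j * t) ((j + 1) * t) := by
    refine (continuousOn_exp_neg_div.mono fun x hx => ?_).intervalIntegrable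
    rw [Set.uIcc_of_le hle] at hx
    exact h0.trans_le hx.1
  rw [expInt_eq_add h0 hle, add_sub_cancel_right]
  rw [← Real.exp_nat_mul, ← Real.exp_nat_mul]
  constructor
  · calc _ = ∫ _ in (j * t)..((j + 1) * t), Real.exp (-((j + 1) * t)) / ((j + 1) * t) := by
          rw [intervalIntegral.integral_const, smul_eq_mul]
          push_cast
          rw [mul_neg]
          field_simp
          ring
      _ ≤ _ := intervalIntegral.integral_mono_on hle (by simp) hi fun x hx => by
          have : 0 < x := h0.trans_le hx.1
          have := hx.2
          gcongr
  · calc _ ≤ ∫ _ in (j * t)..((j + 1) * t), Real.exp (-(j * t)) / (j * t) :=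
          intervalIntegral.integral_mono_on hle hi (by simp) fun x hx => by
            have := hx.1
            gcongr
      _ = _ := by
          rw [intervalIntegral.integral_const, smul_eq_mul, mul_neg]
          field_simp
          ring

lemma tendsto_expInt_atTop : Tendsto expInt atTop (𝓝 0) := by
  refine squeeze_zero' (eventually_gt_atTop 0 |>.mono fun x hx => expInt_nonneg hx)
    (g := fun x => Real.exp (-x)) ?_ ?_
  · filter_upwards [eventually_ge_atTop 1] with x hx
    exact (expInt_le (by linarith)).trans (div_le_self (Real.exp_pos _).le hx)
  · exact Real.tendsto_exp_neg_atTop_nhds_zero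

lemma abs_exp_neg_lt_one {t : ℝ} (ht : 0 < t) : |Real.exp (-t)| < 1 := by
  rw [Real.abs_exp]; exact Real.exp_lt_one_iff.2 (by linarith)

lemma expInt_le_logTail (k : ℕ) {t : ℝ} (ht : 0 < t) :
    expInt ((k + 1) * t) ≤ logTail k (Real.exp (-t)) := by
  have h := (hasSum_logTail k (abs_exp_neg_lt_one ht)).tendsto_sum_nat
  have h2 : Tendsto (fun n : ℕ => expInt ((k + 1) * t) - expInt ((n + (k + 1)) * t)) atTop
      (𝓝 (expInt ((k + 1) * t) - 0)) := by
    refine (tendsto_expInt_atTop.comp ?_).const_sub _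
    refine Tendsto.atTop_mul_const ht ?_
    exact tendsto_atTop_add_const_right _ _ tendsto_natCast_atTop_atTop
  rw [sub_zero] at h2
  refine le_of_tendsto_of_tendsto' h2 h fun n => ?_
  have e := Finset.sum_range_sub' (fun j : ℕ => expInt ((j + (k + 1)) * t)) n
  simp only [Nat.cast_zero, zero_add] at e
  rw [← e]
  refine Finset.sum_le_sum fun j _ => ?_
  have := (expInt_sub_bounds (j := j + (k + 1)) (by omega) ht).2
  push_cast at this ⊢
  rwa [show (j : ℝ) + 1 + (k + 1) = j + (k + 1) + 1 by ring]

lemma logTail_le_expInt {k : ℕ} (hk : 0 < k) {t : ℝ} (ht : 0 < t) :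
    logTail k (Real.exp (-t)) ≤ expInt (k * t) := by
  have h := (hasSum_logTail k (abs_exp_neg_lt_one ht)).tendsto_sum_nat
  refine le_of_tendsto' h fun n => ?_
  have e := Finset.sum_range_sub' (fun j : ℕ => expInt ((j + k) * t)) n
  simp only [Nat.cast_zero, zero_add] at e
  have h3 : 0 ≤ expInt ((n + k) * t) := expInt_nonneg (by positivity)
  calc _ ≤ ∑ j ∈ Finset.range n,
        (expInt ((j + k) * t) - expInt (((j + 1 : ℕ) + k) * t)) := by
        refine Finset.sum_le_sum fun j _ => ?_
        have := (expInt_sub_bounds (j := j + k) (by omega) ht).1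
        push_cast at this ⊢
        rwa [show (j : ℝ) + 1 + k = j + k + 1 by ring, show (j : ℝ) + (k + 1) = j + k + 1 by ring]
    _ ≤ _ := by rw [e]; linarith

end Bounds

end RandomMapping

/-! ### The scaling limit: Abelian asymptotics of the moments. -/

namespace RandomMapping

section ScalingLimit

/-- The integrand whose integral over `(0, ∞)` is the scaled sum over cycle lengths. -/
def stepIntegrand (i r : ℕ) (t x : ℝ) : ℝ :=
  (i + 1) * x ^ i * poissonTail r (logTail ⌊x / t⌋₊ (Real.exp (-t)))

lemma poissonTail_logTail_nonneg (r k : ℕ) {t : ℝ} (ht : 0 < t) :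
    0 ≤ poissonTail r (logTail k (Real.exp (-t))) :=
  poissonTail_nonneg r (logTail_nonneg k (Real.exp_pos _).le
    ((le_abs_self _).trans_lt (abs_exp_neg_lt_one ht)))

/-- A bound uniform in t ≤ 1, for dominated convergence. For x ≤ 2 it exceeds 1; for x > 2 the point
⌊x/t⌋t is at least x - 1 ≥ 1, where E(y) ≤ e^{-y}. -/
lemma poissonTail_logTail_le {r : ℕ} (hr : 0 < r) {t x : ℝ} (ht : 0 < t) (ht1 : t ≤ 1) :
    poissonTail r (logTail ⌊x / t⌋₊ (Real.exp (-t))) ≤ Real.exp (2 - x) := by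
  have hS := logTail_nonneg ⌊x / t⌋₊ (Real.exp_pos (-t)).le
    ((le_abs_self _).trans_lt (abs_exp_neg_lt_one ht))
  rcases le_or_gt x 2 with h | h
  · exact (poissonTail_le_one r hS).trans (Real.one_le_exp (by linarith))
  · have h1 := Nat.lt_floor_add_one (x / t)
    rw [div_lt_iff₀ ht] at h1
    have h2 : x - 1 ≤ ⌊x / t⌋₊ * t := by linarith
    have hk : 0 < ⌊x / t⌋₊ := by
      rw [Nat.floor_pos, le_div_iff₀ ht]; linarith
    calc _ ≤ logTail ⌊x / t⌋₊ (Real.exp (-t)) := poissonTail_le hr hS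
      _ ≤ expInt (⌊x / t⌋₊ * t) := logTail_le_expInt hk ht
      _ ≤ Real.exp (-(⌊x / t⌋₊ * t)) / (⌊x / t⌋₊ * t) := expInt_le (by positivity)
      _ ≤ Real.exp (-(⌊x / t⌋₊ * t)) := div_le_self (Real.exp_pos _).le (by linarith)
      _ ≤ _ := Real.exp_le_exp.2 (by linarith)

lemma measurable_stepIntegrand (i r : ℕ) (t : ℝ) : Measurable (stepIntegrand i r t) := by
  have h : Measurable fun x : ℝ => poissonTail r (logTail ⌊x / t⌋₊ (Real.exp (-t))) :=
    (measurable_from_nat (f := fun k => poissonTail r (logTail k (Real.exp (-t))))).comp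
      (Nat.measurable_floor.comp (measurable_id.div_const t))
  unfold stepIntegrand
  fun_prop

lemma stepIntegrand_le {i r : ℕ} (hr : 0 < r) {t x : ℝ} (ht : 0 < t) (ht1 : t ≤ 1) (hx : 0 < x) :
    ‖stepIntegrand i r t x‖ ≤ (i + 1) * Real.exp 2 * (x ^ i * Real.exp (-x)) := by
  have h0 := poissonTail_logTail_nonneg r ⌊x / t⌋₊ ht
  have h1 := poissonTail_logTail_le (x := x) hr ht ht1
  rw [stepIntegrand, Real.norm_of_nonneg (by positivity)]
  rw [sub_eq_add_neg, Real.exp_add] at h1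
  calc _ ≤ (i + 1) * x ^ i * (Real.exp 2 * Real.exp (-x)) := by gcongr
    _ = _ := by ring

lemma integrableOn_stepIntegrand (i : ℕ) {r : ℕ} (hr : 0 < r) {t : ℝ} (ht : 0 < t) (ht1 : t ≤ 1) :
    IntegrableOn (stepIntegrand i r t) (Set.Ioi 0) :=
  ((integrableOn_pow_mul_exp_neg i).const_mul _).mono'
    (measurable_stepIntegrand i r t).aestronglyMeasurable
    ((ae_restrict_iff' measurableSet_Ioi).2
      (Eventually.of_forall fun _ hx => stepIntegrand_le hr ht ht1 hx))

lemma integral_stepIntegrand_step (i r k : ℕ) {t : ℝ} (ht : 0 < t) :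
    IntervalIntegrable (stepIntegrand i r t) volume (k * t) ((k + 1 : ℕ) * t) ∧
    ∫ x in (k * t)..((k + 1 : ℕ) * t), stepIntegrand i r t x =
      t ^ (i + 1) * (((k + 1 : ℝ) ^ (i + 1) - k ^ (i + 1)) *
        poissonTail r (logTail k (Real.exp (-t)))) := by
  set c := poissonTail r (logTail k (Real.exp (-t))) with hc
  have hle : k * t ≤ (k + 1 : ℕ) * t := by push_cast; nlinarith
  have h1 : ∀ x ∈ Set.Ioo (k * t) ((k + 1 : ℕ) * t), stepIntegrand i r t x = (i + 1) * x ^ i * c := by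
    intro x hx
    have hx0 : 0 < x := lt_of_le_of_lt (by positivity) hx.1
    have : ⌊x / t⌋₊ = k := by
      rw [Nat.floor_eq_iff (by positivity), le_div_iff₀ ht, div_lt_iff₀ ht]
      have := hx.2
      push_cast at this
      exact ⟨hx.1.le, this⟩
    rw [stepIntegrand, this]
  constructor
  · rw [intervalIntegrable_iff_integrableOn_Ioo_of_le hle]
    refine IntegrableOn.congr_fun ?_ (fun x hx => (h1 x hx).symm) measurableSet_Ioo
    exact ((by fun_prop : Continuous fun x : ℝ => (i + 1) * x ^ i * c).integrableOn_Icc).mono_set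
      Set.Ioo_subset_Icc_self
  · rw [intervalIntegral.integral_of_le hle, integral_Ioc_eq_integral_Ioo,
      setIntegral_congr_fun measurableSet_Ioo h1, ← integral_Ioc_eq_integral_Ioo,
      ← intervalIntegral.integral_of_le hle, intervalIntegral.integral_mul_const,
      intervalIntegral.integral_const_mul, integral_pow]
    push_cast
    rw [mul_pow, mul_pow]
    field_simp

lemma integral_stepIntegrand (i : ℕ) {r : ℕ} (hr : 0 < r) {t : ℝ} (ht : 0 < t) (ht1 : t ≤ 1) :
    ∫ x in Set.Ioi (0 : ℝ), stepIntegrand i r t x =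
      t ^ (i + 1) * ((1 - Real.exp (-t)) *
        ∑' m, permMoment (i + 1) r m * Real.exp (-t) ^ m) := by
  have hz := (le_abs_self _).trans_lt (abs_exp_neg_lt_one ht)
  have h1 := ((hasSum_poissonTail_logTail (i + 1) hr (Real.exp_pos (-t)).le hz).mul_left
    (t ^ (i + 1))).tendsto_sum_nat
  have h2 := intervalIntegral_tendsto_integral_Ioi 0 (integrableOn_stepIntegrand i hr ht ht1)
    ((tendsto_natCast_atTop_atTop (R := ℝ)).atTop_mul_const ht)
  refine tendsto_nhds_unique h2 (h1.congr fun n => ?_)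
  have h3 := intervalIntegral.sum_integral_adjacent_intervals (f := stepIntegrand i r t)
    (μ := volume) (a := fun k : ℕ => (k : ℝ) * t) (n := n)
    fun k _ => (integral_stepIntegrand_step i r k ht).1
  simp only [(integral_stepIntegrand_step i r _ ht).2] at h3
  rw [h3, Nat.cast_zero, zero_mul]

lemma tendsto_logTail_floor {x : ℝ} (hx : 0 < x) :
    Tendsto (fun t => logTail ⌊x / t⌋₊ (Real.exp (-t))) (𝓝[>] 0) (𝓝 (expInt x)) := by
  have hid : Tendsto (fun t : ℝ => t) (𝓝[>] 0) (𝓝 0) := tendsto_nhdsWithin_of_tendsto_nhds tendsto_id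
  have hpos : ∀ᶠ t : ℝ in 𝓝[>] 0, 0 < t := eventually_mem_nhdsWithin
  have h1 : Tendsto (fun t : ℝ => (⌊x / t⌋₊ : ℝ) * t) (𝓝[>] 0) (𝓝 x) := by
    have h := hid.const_sub x
    rw [sub_zero] at h
    refine tendsto_of_tendsto_of_tendsto_of_le_of_le' h tendsto_const_nhds ?_ ?_
    · filter_upwards [hpos] with t ht
      have := Nat.lt_floor_add_one (x / t)
      rw [div_lt_iff₀ ht] at this
      linarith
    · filter_upwards [hpos] with t ht
      have := Nat.floor_le (div_pos hx ht).le
      rwa [le_div_iff₀ ht] at this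
  have h2 : Tendsto (fun t : ℝ => ((⌊x / t⌋₊ : ℝ) + 1) * t) (𝓝[>] 0) (𝓝 x) := by
    have := h1.add hid
    rw [add_zero] at this
    exact this.congr fun t => by ring
  have hE := (hasDerivAt_expInt hx).continuousAt.tendsto
  refine tendsto_of_tendsto_of_tendsto_of_le_of_le' (hE.comp h2) (hE.comp h1) ?_ ?_
  · filter_upwards [hpos] with t ht
    exact expInt_le_logTail _ ht
  · filter_upwards [hpos, hid.eventually (eventually_le_nhds hx)] with t ht htx
    exact logTail_le_expInt (Nat.floor_pos.2 ((le_div_iff₀ ht).2 (by linarith))) ht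

lemma tendsto_integral_stepIntegrand (i : ℕ) {r : ℕ} (hr : 0 < r) :
    Tendsto (fun t => ∫ x in Set.Ioi (0 : ℝ), stepIntegrand i r t x) (𝓝[>] 0)
      (𝓝 (∫ x in Set.Ioi (0 : ℝ), (i + 1) * x ^ i * poissonTail r (expInt x))) := by
  have h01 : ∀ᶠ t : ℝ in 𝓝[>] 0, 0 < t ∧ t ≤ 1 := by
    filter_upwards [Ioo_mem_nhdsGT (zero_lt_one' ℝ)] with t ht using ⟨ht.1, ht.2.le⟩
  refine tendsto_integral_filter_of_dominated_convergence
    (fun x => (i + 1) * Real.exp 2 * (x ^ i * Real.exp (-x)))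
    (Eventually.of_forall fun t => (measurable_stepIntegrand i r t).aestronglyMeasurable) ?_
    ((integrableOn_pow_mul_exp_neg i).const_mul _) ?_
  · filter_upwards [h01] with t ht
    exact (ae_restrict_iff' measurableSet_Ioi).2
      (Eventually.of_forall fun x hx => stepIntegrand_le hr ht.1 ht.2 hx)
  · refine (ae_restrict_iff' measurableSet_Ioi).2 (Eventually.of_forall fun x hx => ?_)
    exact (((continuous_poissonTail r).tendsto _).comp (tendsto_logTail_floor hx)).const_mul _

lemma hasDerivAt_pow_mul_poissonTail (i s : ℕ) {x : ℝ} (hx : 0 < x) :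
    HasDerivAt (fun x => x ^ (i + 1) * poissonTail (s + 1) (expInt x))
      ((i + 1) * x ^ i * poissonTail (s + 1) (expInt x) - integrandG s i x / s !) x := by
  have h := (hasDerivAt_pow (i + 1) x).mul
    ((hasDerivAt_poissonTail s (expInt x)).comp x (hasDerivAt_expInt hx))
  refine h.congr_deriv ?_
  have e : Real.exp (-expInt x - x) = Real.exp (-expInt x) * Real.exp (-x) := by
    rw [← Real.exp_add, sub_eq_add_neg]
  rw [integrandG, e]
  simp only [Function.comp_apply]
  push_cast
  rw [pow_succ x i]
  field_simp
  ring

lemma integrableOn_pow_mul_poissonTail (i s : ℕ) :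
    IntegrableOn (fun x => (i + 1) * x ^ i * poissonTail (s + 1) (expInt x)) (Set.Ioi 0) := by
  refine ((integrableOn_pow_mul_exp_neg i).const_mul ((i + 1) * Real.exp 2)).mono' ?_ ?_
  · refine ContinuousOn.aestronglyMeasurable ?_ measurableSet_Ioi
    exact (by fun_prop : Continuous fun x : ℝ => (i + 1) * x ^ i).continuousOn.mul
      ((continuous_poissonTail _).comp_continuousOn continuousOn_expInt)
  · refine (ae_restrict_iff' measurableSet_Ioi).2 (Eventually.of_forall fun x hx => ?_)
    -- The limit function inherits the bound from `stepIntegrand_le`, being its pointwise limit.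
    refine le_of_tendsto ((((continuous_poissonTail (s + 1)).tendsto _).comp
      (tendsto_logTail_floor hx)).const_mul ((i + 1) * x ^ i)).norm ?_
    filter_upwards [Ioo_mem_nhdsGT (zero_lt_one' ℝ)] with t ht
    exact stepIntegrand_le s.succ_pos ht.1 ht.2.le hx

/-- Integration by parts against x^(i+1): the derivative of the Poisson tail along E is, up to s!,
minus the integrand of `G` with one power of x fewer. The boundary terms vanish, at 0 since the tail
is at most 1 and at infinity since it is at most E. -/
lemma integral_pow_mul_poissonTail (i s : ℕ) :
    ∫ x in Set.Ioi (0 : ℝ), (i + 1) * x ^ i * poissonTail (s + 1) (expInt x) =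
      (i + 1)! * G (s + 1) (i + 1) := by
  have hb : ∀ x > 0, |x ^ (i + 1) * poissonTail (s + 1) (expInt x)| ≤ x ^ (i + 1) := fun x hx => by
    rw [abs_of_nonneg (mul_nonneg (by positivity) (poissonTail_nonneg _ (expInt_nonneg hx)))]
    exact mul_le_of_le_one_right (by positivity) (poissonTail_le_one _ (expInt_nonneg hx))
  have hc : ContinuousWithinAt (fun x => x ^ (i + 1) * poissonTail (s + 1) (expInt x))
      (Set.Ici 0) 0 := by
    -- The conventional value `expInt 0` carries no meaning here; the factor 0^(i+1) removes it.
    have h0 : (0 : ℝ) ^ (i + 1) * poissonTail (s + 1) (expInt 0) = 0 := by simp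
    rw [ContinuousWithinAt, h0]
    refine squeeze_zero_norm' (a := fun x : ℝ => x ^ (i + 1)) ?_ ?_
    · filter_upwards [self_mem_nhdsWithin] with x hx
      rcases (Set.mem_Ici.1 hx).eq_or_lt with rfl | h
      · simp
      · exact hb x h
    · have : Tendsto (fun x : ℝ => x ^ (i + 1)) (𝓝 0) (𝓝 (0 ^ (i + 1))) :=
        (continuous_pow (i + 1)).tendsto 0
      rw [zero_pow (Nat.succ_ne_zero i)] at this
      exact this.mono_left nhdsWithin_le_nhds
  have hinf : Tendsto (fun x => x ^ (i + 1) * poissonTail (s + 1) (expInt x)) atTop (𝓝 0) := by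
    refine squeeze_zero_norm' (a := fun x : ℝ => x ^ i * Real.exp (-x)) ?_
      (Real.tendsto_pow_mul_exp_neg_atTop_nhds_zero i)
    filter_upwards [eventually_gt_atTop 0] with x hx
    have hE := expInt_nonneg hx
    rw [Real.norm_of_nonneg (mul_nonneg (by positivity) (poissonTail_nonneg _ hE))]
    calc _ ≤ x ^ (i + 1) * (Real.exp (-x) / x) := by
          gcongr
          exact (poissonTail_le s.succ_pos hE).trans (expInt_le hx)
      _ = _ := by rw [pow_succ]; field_simp
  have hI := (integrableOn_integrandG s i).div_const (s ! : ℝ)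
  have h := integral_Ioi_of_hasDerivAt_of_tendsto hc
    (fun x hx => hasDerivAt_pow_mul_poissonTail i s hx)
    ((integrableOn_pow_mul_poissonTail i s).sub hI) hinf
  rw [integral_sub (integrableOn_pow_mul_poissonTail i s) hI, integral_div] at h
  rw [G_succ_succ]
  simp only [ne_eq, Nat.add_eq_zero_iff, one_ne_zero, and_false, not_false_eq_true, zero_pow,
    zero_mul, sub_zero] at h
  rw [sub_eq_zero.1 h]
  field_simp

/-- The Abelian form of the asymptotics of `permMoment`. -/
lemma tendsto_permMoment_abel (i s : ℕ) :
    Tendsto (fun t : ℝ => t ^ (i + 2) *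
      ∑' m, permMoment (i + 1) (s + 1) m * Real.exp (-t) ^ m) (𝓝[>] 0)
      (𝓝 ((i + 1)! * G (s + 1) (i + 1))) := by
  have h1 := tendsto_integral_stepIntegrand i s.succ_pos
  rw [integral_pow_mul_poissonTail] at h1
  -- `integral_stepIntegrand` has t^(i+1) (1 - e^{-t}) in front of the series; this limit replaces
  -- it by t^(i+2).
  have h2 : Tendsto (fun t : ℝ => (1 - Real.exp (-t)) / t) (𝓝[>] 0) (𝓝 1) := by
    have h3 : HasDerivAt (fun t : ℝ => 1 - Real.exp (-t)) 1 0 := by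
      simpa using ((hasDerivAt_neg (0 : ℝ)).exp).const_sub 1
    have h4 := (hasDerivAt_iff_tendsto_slope.1 h3).mono_left
      (nhdsWithin_mono 0 fun t (ht : 0 < t) => ht.ne')
    refine h4.congr fun t => ?_
    rw [slope_def_field]
    simp
  have h5 := h1.div h2 one_ne_zero
  rw [div_one] at h5
  refine h5.congr' ?_
  filter_upwards [Ioo_mem_nhdsGT (zero_lt_one' ℝ)] with t ht
  have h6 : 1 - Real.exp (-t) ≠ 0 := by
    have := (le_abs_self _).trans_lt (abs_exp_neg_lt_one ht.1)
    linarith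
  have h7 := ht.1.ne'
  simp only [Pi.div_apply]
  rw [integral_stepIntegrand i s.succ_pos ht.1 ht.2.le, pow_succ t (i + 1)]
  field_simp

end ScalingLimit

end RandomMapping

/-! ### Karamata's Tauberian theorem. -/

namespace RandomMapping

section Tauberian

variable {a : ℕ → ℝ} {d : ℕ} {K : ℝ} {ψ : ℝ → ℝ}

lemma exp_neg_pow_mem (t : ℝ) (ht : 0 < t) (m : ℕ) : Real.exp (-t) ^ m ∈ Set.Icc (0 : ℝ) 1 :=
  ⟨by positivity, pow_le_one₀ (Real.exp_pos _).le (Real.exp_le_one_iff.2 (by linarith))⟩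

lemma exp_neg_mem {u : ℝ} (hu : 0 < u) : Real.exp (-u) ∈ Set.Icc (0 : ℝ) 1 :=
  ⟨(Real.exp_pos _).le, Real.exp_le_one_iff.2 (by linarith)⟩

lemma summable_mul_comp (h0 : ∀ m, 0 ≤ a m) {t : ℝ} (ht : 0 < t)
    (hs : Summable fun m => a m * Real.exp (-t) ^ m) {C : ℝ}
    (hψ : ∀ y ∈ Set.Icc (0 : ℝ) 1, |ψ y| ≤ C) :
    Summable fun m => a m * Real.exp (-t) ^ m * ψ (Real.exp (-t) ^ m) := by
  refine Summable.of_norm_bounded (hs.mul_right C) fun m => ?_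
  have := h0 m
  rw [norm_mul, Real.norm_of_nonneg (by positivity)]
  exact mul_le_mul_of_nonneg_left (hψ _ (exp_neg_pow_mem t ht m)) (by positivity)

lemma abs_tsum_mul_comp_le (h0 : ∀ m, 0 ≤ a m) {t : ℝ} (ht : 0 < t)
    (hs : Summable fun m => a m * Real.exp (-t) ^ m) {C : ℝ}
    (hψ : ∀ y ∈ Set.Icc (0 : ℝ) 1, |ψ y| ≤ C) :
    |∑' m, a m * Real.exp (-t) ^ m * ψ (Real.exp (-t) ^ m)| ≤
      C * ∑' m, a m * Real.exp (-t) ^ m := by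
  rw [← tsum_mul_left, ← Real.norm_eq_abs]
  refine tsum_of_norm_bounded (hs.mul_left C).hasSum fun m => ?_
  have := h0 m
  rw [norm_mul, Real.norm_of_nonneg (by positivity), mul_comm]
  exact mul_le_mul_of_nonneg_right (hψ _ (exp_neg_pow_mem t ht m)) (by positivity)

lemma integrableOn_gamma_comp (hψ : ContinuousOn ψ (Set.Icc 0 1)) (d : ℕ) :
    IntegrableOn (fun u : ℝ => u ^ d * Real.exp (-u) * ψ (Real.exp (-u))) (Set.Ioi 0) := by
  obtain ⟨C, hC⟩ := isCompact_Icc.exists_bound_of_continuousOn hψ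
  refine (integrableOn_pow_mul_exp_neg d).mul_bdd (c := C) ?_ ?_
  · exact (hψ.comp (by fun_prop) fun u hu => exp_neg_mem hu).aestronglyMeasurable
      measurableSet_Ioi
  · exact (ae_restrict_iff' measurableSet_Ioi).2
      (Eventually.of_forall fun u hu => hC _ (exp_neg_mem hu))

lemma abs_gamma_comp_le (d : ℕ) {C : ℝ}
    (hψC : ∀ y ∈ Set.Icc (0 : ℝ) 1, |ψ y| ≤ C) :
    |∫ u in Set.Ioi (0 : ℝ), u ^ d * Real.exp (-u) * ψ (Real.exp (-u))| ≤ d ! * C := by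
  have h1 : ∫ u in Set.Ioi (0 : ℝ), u ^ d * Real.exp (-u) = d ! := by
    have := integral_pow_mul_exp_neg_mul d 0
    simpa using this
  rw [← h1, ← integral_mul_const, ← Real.norm_eq_abs]
  refine norm_integral_le_of_norm_le ((integrableOn_pow_mul_exp_neg d).mul_const C)
    ((ae_restrict_iff' measurableSet_Ioi).2 (Eventually.of_forall fun u hu => ?_))
  have hu' : 0 < u := hu
  rw [norm_mul, Real.norm_of_nonneg (by positivity)]
  exact mul_le_mul_of_nonneg_left (hψC _ (exp_neg_mem hu)) (by positivity)

lemma exists_bound_Icc (hψ : ContinuousOn ψ (Set.Icc 0 1)) :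
    ∃ C, ∀ y ∈ Set.Icc (0 : ℝ) 1, |ψ y| ≤ C :=
  isCompact_Icc.exists_bound_of_continuousOn hψ

/-- For the monomial y^j the weighted series is the original one at (j + 1)t, and the factor (j +
1)^(-(d+1)) matches the Gamma integral. -/
lemma tendsto_tsum_mul_polynomial (h0 : ∀ m, 0 ≤ a m)
    (hs : ∀ t > 0, Summable fun m => a m * Real.exp (-t) ^ m)
    (h : Tendsto (fun t : ℝ => t ^ (d + 1) * ∑' m, a m * Real.exp (-t) ^ m) (𝓝[>] 0)
      (𝓝 (d ! * K))) (p : Polynomial ℝ) :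
    Tendsto (fun t : ℝ => t ^ (d + 1) *
        ∑' m, a m * Real.exp (-t) ^ m * p.eval (Real.exp (-t) ^ m)) (𝓝[>] 0)
      (𝓝 (K * ∫ u in Set.Ioi (0 : ℝ), u ^ d * Real.exp (-u) * p.eval (Real.exp (-u)))) := by
  induction p using Polynomial.induction_on' with
  | add p q hp hq =>
    have hI (p : Polynomial ℝ) := integrableOn_gamma_comp (ψ := fun y => p.eval y)
      p.continuous.continuousOn d
    have h2 := hp.add hq
    simp only [Polynomial.eval_add, mul_add]
    rw [integral_add (hI p) (hI q), mul_add]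
    refine h2.congr' ?_
    filter_upwards [self_mem_nhdsWithin] with t ht
    have hsum (p : Polynomial ℝ) : Summable fun m =>
        a m * Real.exp (-t) ^ m * p.eval (Real.exp (-t) ^ m) := by
      obtain ⟨C, hC⟩ := exists_bound_Icc (ψ := fun y => p.eval y) p.continuous.continuousOn
      exact summable_mul_comp (ψ := fun y => p.eval y) h0 ht (hs t ht) hC
    rw [(hsum p).tsum_add (hsum q), mul_add]
  | monomial j c =>
    have hj : (0 : ℝ) < j + 1 := by positivity
    have h1 : Tendsto (fun t : ℝ => (j + 1) * t) (𝓝[>] 0) (𝓝[>] 0) := by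
      refine tendsto_nhdsWithin_iff.2 ⟨?_, ?_⟩
      · have : Tendsto (fun t : ℝ => (j + 1) * t) (𝓝 0) (𝓝 ((j + 1) * 0)) :=
          (continuous_const_mul _).tendsto 0
        rw [mul_zero] at this
        exact this.mono_left nhdsWithin_le_nhds
      · filter_upwards [self_mem_nhdsWithin] with t ht
        exact mul_pos hj ht
    have h2 := (h.comp h1).const_mul (c / (j + 1 : ℝ) ^ (d + 1))
    have e : K * ∫ u in Set.Ioi (0 : ℝ), u ^ d * Real.exp (-u) *
        (Polynomial.monomial j c).eval (Real.exp (-u)) =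
        c / (j + 1 : ℝ) ^ (d + 1) * (d ! * K) := by
      have h3 : ∀ u : ℝ, u ^ d * Real.exp (-u) *
          (Polynomial.monomial j c).eval (Real.exp (-u)) =
          c * (u ^ d * Real.exp (-((j + 1) * u))) := fun u => by
        rw [Polynomial.eval_monomial, ← Real.exp_nat_mul,
          show -((j + 1) * u) = -u + j * -u by ring, Real.exp_add]
        ring
      simp only [h3]
      rw [integral_const_mul, integral_pow_mul_exp_neg_mul]
      ring
    rw [e]
    refine h2.congr fun t => ?_
    have h4 : ∀ m : ℕ, a m * Real.exp (-t) ^ m *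
        (Polynomial.monomial j c).eval (Real.exp (-t) ^ m) =
        c * (a m * Real.exp (-((j + 1) * t)) ^ m) := fun m => by
      rw [Polynomial.eval_monomial, show -((j + 1) * t) = -t + j * -t by ring, Real.exp_add,
        Real.exp_nat_mul]
      ring
    simp only [h4, Function.comp_apply]
    rw [tsum_mul_left, mul_pow]
    field_simp

/-- Weierstrass approximation. The terms are nonnegative, so a uniform error δ changes the scaled
sum by at most δ times the convergent, hence bounded, unweighted sum. -/
lemma tendsto_tsum_mul_comp (h0 : ∀ m, 0 ≤ a m)
    (hs : ∀ t > 0, Summable fun m => a m * Real.exp (-t) ^ m)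
    (h : Tendsto (fun t : ℝ => t ^ (d + 1) * ∑' m, a m * Real.exp (-t) ^ m) (𝓝[>] 0)
      (𝓝 (d ! * K))) (hK : 0 ≤ K) (hψ : ContinuousOn ψ (Set.Icc 0 1)) :
    Tendsto (fun t : ℝ => t ^ (d + 1) *
        ∑' m, a m * Real.exp (-t) ^ m * ψ (Real.exp (-t) ^ m)) (𝓝[>] 0)
      (𝓝 (K * ∫ u in Set.Ioi (0 : ℝ), u ^ d * Real.exp (-u) * ψ (Real.exp (-u)))) := by
  rw [Metric.tendsto_nhds]
  intro ε hε
  set M := d ! * K + 1 with hM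
  have hMpos : 0 < M := by positivity
  set δ := ε / (3 * M) with hδ
  have hδpos : 0 < δ := by positivity
  obtain ⟨p, hp⟩ := exists_polynomial_near_of_continuousOn 0 1 ψ hψ δ hδpos
  have hp' : ∀ y ∈ Set.Icc (0 : ℝ) 1, |ψ y - p.eval y| ≤ δ := fun y hy => by
    rw [abs_sub_comm]; exact (hp y hy).le
  have h1 := tendsto_tsum_mul_polynomial h0 hs h p
  rw [Metric.tendsto_nhds] at h1
  obtain ⟨C, hC⟩ := exists_bound_Icc hψ
  obtain ⟨C', hC'⟩ := exists_bound_Icc (ψ := fun y => p.eval y) p.continuous.continuousOn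
  have hI : |(∫ u in Set.Ioi (0 : ℝ), u ^ d * Real.exp (-u) * ψ (Real.exp (-u))) -
      ∫ u in Set.Ioi (0 : ℝ), u ^ d * Real.exp (-u) * p.eval (Real.exp (-u))| ≤ d ! * δ := by
    rw [← integral_sub (integrableOn_gamma_comp hψ d)
      (integrableOn_gamma_comp (ψ := fun y => p.eval y) p.continuous.continuousOn d)]
    simp only [← mul_sub]
    exact abs_gamma_comp_le d (ψ := fun y => ψ y - p.eval y) hp'
  filter_upwards [h1 (ε / 3) (by positivity), self_mem_nhdsWithin,
    h.eventually (eventually_lt_nhds (show d ! * K < M by linarith))] with t ht ht0 htM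
  have ht0' : 0 < t := ht0
  have h2 : |t ^ (d + 1) * (∑' m, a m * Real.exp (-t) ^ m * ψ (Real.exp (-t) ^ m)) -
      t ^ (d + 1) * ∑' m, a m * Real.exp (-t) ^ m * p.eval (Real.exp (-t) ^ m)| ≤ δ * M := by
    rw [← mul_sub, ← (summable_mul_comp h0 ht0 (hs t ht0) hC).tsum_sub
      (summable_mul_comp (ψ := fun y => p.eval y) h0 ht0 (hs t ht0) hC')]
    simp only [← mul_sub]
    have h3 := abs_tsum_mul_comp_le (ψ := fun y => ψ y - p.eval y) h0 ht0 (hs t ht0) hp'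
    rw [abs_mul, abs_of_pos (by positivity)]
    calc _ ≤ t ^ (d + 1) * (δ * ∑' m, a m * Real.exp (-t) ^ m) := by gcongr
      _ = δ * (t ^ (d + 1) * ∑' m, a m * Real.exp (-t) ^ m) := by ring
      _ ≤ _ := by gcongr
  have h4 : |K * (∫ u in Set.Ioi (0 : ℝ), u ^ d * Real.exp (-u) * ψ (Real.exp (-u))) -
      K * ∫ u in Set.Ioi (0 : ℝ), u ^ d * Real.exp (-u) * p.eval (Real.exp (-u))| ≤
      K * (d ! * δ) := by
    rw [← mul_sub, abs_mul, abs_of_nonneg hK]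
    gcongr
  have h5 : δ * M = ε / 3 := by rw [hδ]; field_simp
  have h6 : K * (d ! * δ) < ε / 3 := by rw [← h5]; nlinarith
  rw [Real.dist_eq] at ht ⊢
  rw [abs_le] at h2 h4
  rw [abs_lt] at ht ⊢
  constructor <;> linarith

/-- A continuous function of `y = exp (-u)`, positive for `α < u < β` and zero elsewhere. -/
def bump (α β y : ℝ) : ℝ := max 0 ((y - Real.exp (-β)) * (Real.exp (-α) - y))

lemma continuous_bump (α β : ℝ) : Continuous (bump α β) := by unfold bump; fun_prop

lemma bump_nonneg (α β y : ℝ) : 0 ≤ bump α β y := le_max_left _ _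

lemma bump_pos {α β u : ℝ} (h1 : α < u) (h2 : u < β) : 0 < bump α β (Real.exp (-u)) :=
  lt_max_of_lt_right (mul_pos (sub_pos.2 (Real.exp_lt_exp.2 (by linarith)))
    (sub_pos.2 (Real.exp_lt_exp.2 (by linarith))))

lemma mem_of_bump_ne_zero {α β u : ℝ} (hαβ : α < β) (h : bump α β (Real.exp (-u)) ≠ 0) :
    α < u ∧ u < β := by
  have h1 : 0 < (Real.exp (-u) - Real.exp (-β)) * (Real.exp (-α) - Real.exp (-u)) := by
    by_contra h2
    exact h (max_eq_left (not_lt.1 h2))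
  have h2 : Real.exp (-β) < Real.exp (-α) := Real.exp_lt_exp.2 (by linarith)
  rcases mul_pos_iff.1 h1 with ⟨h3, h4⟩ | ⟨h3, h4⟩
  · have h5 := Real.exp_lt_exp.1 (sub_pos.1 h3)
    have h6 := Real.exp_lt_exp.1 (sub_pos.1 h4)
    constructor <;> linarith
  · linarith

lemma integral_bump_bounds {α β : ℝ} (hα : 0 ≤ α) (hαβ : α < β) (d : ℕ) :
    0 < (∫ u in Set.Ioi (0 : ℝ), u ^ 0 * Real.exp (-u) * bump α β (Real.exp (-u))) ∧
    α ^ d * (∫ u in Set.Ioi (0 : ℝ), u ^ 0 * Real.exp (-u) * bump α β (Real.exp (-u))) ≤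
      ∫ u in Set.Ioi (0 : ℝ), u ^ d * Real.exp (-u) * bump α β (Real.exp (-u)) ∧
    (∫ u in Set.Ioi (0 : ℝ), u ^ d * Real.exp (-u) * bump α β (Real.exp (-u))) ≤
      β ^ d * ∫ u in Set.Ioi (0 : ℝ), u ^ 0 * Real.exp (-u) * bump α β (Real.exp (-u)) := by
  have hI (d : ℕ) := integrableOn_gamma_comp (continuous_bump α β).continuousOn d
  refine ⟨?_, ?_, ?_⟩
  · rw [setIntegral_pos_iff_support_of_nonneg_ae _ (hI 0)]
    · refine lt_of_lt_of_le ?_ (measure_mono (s := Set.Ioo α β) fun u hu => ⟨?_, hα.trans_lt hu.1⟩)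
      · simpa using hαβ
      · rw [Function.mem_support, pow_zero, one_mul]
        exact (mul_pos (Real.exp_pos _) (bump_pos hu.1 hu.2)).ne'
    · refine (ae_restrict_iff' measurableSet_Ioi).2 (Eventually.of_forall fun u _ => ?_)
      simp only [Pi.zero_apply, pow_zero, one_mul]
      exact mul_nonneg (Real.exp_pos _).le (bump_nonneg _ _ _)
  · rw [← integral_const_mul]
    refine setIntegral_mono_on ((hI 0).const_mul _) (hI d) measurableSet_Ioi fun u hu => ?_
    by_cases h : bump α β (Real.exp (-u)) = 0
    · simp [h]
    · have h1 := (mem_of_bump_ne_zero hαβ h).1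
      have := bump_nonneg α β (Real.exp (-u))
      rw [pow_zero, one_mul, ← mul_assoc]
      gcongr
  · rw [← integral_const_mul]
    refine setIntegral_mono_on (hI d) ((hI 0).const_mul _) measurableSet_Ioi fun u hu => ?_
    have hu' : 0 < u := hu
    by_cases h : bump α β (Real.exp (-u)) = 0
    · simp [h]
    · have h1 := (mem_of_bump_ne_zero hαβ h).2
      have := bump_nonneg α β (Real.exp (-u))
      rw [pow_zero, one_mul, ← mul_assoc]
      gcongr

lemma tendsto_inv_natCast_nhdsGT : Tendsto (fun n : ℕ => (n : ℝ)⁻¹) atTop (𝓝[>] 0) :=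
  tendsto_inv_atTop_nhdsGT_zero.comp tendsto_natCast_atTop_atTop

lemma tendsto_geometric_abel :
    Tendsto (fun t : ℝ => t ^ (0 + 1) * ∑' m, (1 : ℝ) * Real.exp (-t) ^ m) (𝓝[>] 0)
      (𝓝 ((0 ! : ℕ) * 1)) := by
  have h3 : HasDerivAt (fun t : ℝ => 1 - Real.exp (-t)) 1 0 := by
    simpa using ((hasDerivAt_neg (0 : ℝ)).exp).const_sub 1
  have h4 := ((hasDerivAt_iff_tendsto_slope.1 h3).mono_left
    (nhdsWithin_mono 0 fun t (ht : 0 < t) => ht.ne')).inv₀ one_ne_zero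
  simp only [Nat.factorial_zero, Nat.cast_one, mul_one]
  rw [inv_one] at h4
  refine h4.congr' ?_
  filter_upwards [self_mem_nhdsWithin] with t ht
  have ht' : 0 < t := ht
  simp only [one_mul]
  rw [tsum_geometric_of_lt_one (Real.exp_pos _).le
    ((le_abs_self _).trans_lt (abs_exp_neg_lt_one ht)), slope_def_field]
  simp [div_eq_mul_inv]

/-- Karamata's Tauberian theorem for monotone sequences. -/
theorem tendsto_div_pow_of_abel (hmono : Monotone a) (h0 : ∀ m, 0 ≤ a m)
    (hs : ∀ t > 0, Summable fun m => a m * Real.exp (-t) ^ m)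
    (h : Tendsto (fun t : ℝ => t ^ (d + 1) * ∑' m, a m * Real.exp (-t) ^ m) (𝓝[>] 0)
      (𝓝 (d ! * K))) :
    Tendsto (fun n : ℕ => a n / (n : ℝ) ^ d) atTop (𝓝 K) := by
  have hK : 0 ≤ K := by
    have h1 : 0 ≤ d ! * K := by
      refine ge_of_tendsto h ?_
      filter_upwards [self_mem_nhdsWithin] with t ht
      have ht' : 0 < t := ht
      exact mul_nonneg (by positivity) (tsum_nonneg fun m => mul_nonneg (h0 m) (by positivity))
    exact nonneg_of_mul_nonneg_right h1 (by positivity)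
  have hs1 : ∀ t > 0, Summable fun m : ℕ => (1 : ℝ) * Real.exp (-t) ^ m := fun t ht => by
    simpa using summable_geometric_of_lt_one (Real.exp_pos (-t)).le
      ((le_abs_self _).trans_lt (abs_exp_neg_lt_one ht))
  -- X and Y weight the sequences 1 and a by a bump supported on α < m/n < β, at t = 1/n. Their
  -- ratio tends to K times a mean of u^d over (α, β). By monotonicity every a m in the window is at
  -- most a n if β ≤ 1, and at least a n if α ≥ 1. Windows (α, 1) and (1, β) with endpoints near 1
  -- then pinch a n / n^d, without approximating an indicator function.
  have key (α β : ℝ) (hα : 0 ≤ α) (hαβ : α < β) :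
      ∃ X Y : ℕ → ℝ, ∃ L, (∀ᶠ n in atTop, 0 < X n) ∧ α ^ d * K ≤ L ∧ L ≤ β ^ d * K ∧
        Tendsto (fun n => Y n / X n) atTop (𝓝 L) ∧
        (β ≤ 1 → ∀ n : ℕ, 0 < n → Y n ≤ a n / (n : ℝ) ^ d * X n) ∧
        (1 ≤ α → ∀ n : ℕ, 0 < n → a n / (n : ℝ) ^ d * X n ≤ Y n) := by
    obtain ⟨C, hC⟩ := exists_bound_Icc (continuous_bump α β).continuousOn
    obtain ⟨i1, i2, i3⟩ := integral_bump_bounds hα hαβ d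
    have hX := (tendsto_tsum_mul_comp (a := fun _ => 1) (fun _ => zero_le_one) hs1
      tendsto_geometric_abel zero_le_one (continuous_bump α β).continuousOn).comp
      tendsto_inv_natCast_nhdsGT
    have hY := (tendsto_tsum_mul_comp h0 hs h hK (continuous_bump α β).continuousOn).comp
      tendsto_inv_natCast_nhdsGT
    rw [one_mul] at hX
    refine ⟨_, _, _, hX.eventually (eventually_gt_nhds i1), ?_, ?_, hY.div hX i1.ne', ?_, ?_⟩
    · rw [le_div_iff₀ i1]; nlinarith
    · rw [div_le_iff₀ i1]; nlinarith
    all_goals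
      intro h1 n hn
      have hn' : (0 : ℝ) < n := by exact_mod_cast hn
      have ht : (0 : ℝ) < (n : ℝ)⁻¹ := by positivity
      have sY := summable_mul_comp h0 ht (hs _ ht) hC
      have sX := (summable_mul_comp (a := fun _ => 1) (fun _ => zero_le_one) ht
        (hs1 _ ht) hC).mul_left (a n)
      have e : a n / (n : ℝ) ^ d * ((n : ℝ)⁻¹ ^ (0 + 1) * ∑' m : ℕ, 1 * Real.exp (-(n : ℝ)⁻¹) ^ m *
          bump α β (Real.exp (-(n : ℝ)⁻¹) ^ m)) = (n : ℝ)⁻¹ ^ (d + 1) * ∑' m : ℕ,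
          a n * (1 * Real.exp (-(n : ℝ)⁻¹) ^ m * bump α β (Real.exp (-(n : ℝ)⁻¹) ^ m)) := by
        rw [tsum_mul_left, zero_add, pow_one, pow_succ, inv_pow]
        field_simp
      have hloc (m : ℕ) (hb : bump α β (Real.exp (-(n : ℝ)⁻¹) ^ m) ≠ 0) :
          α < m * (n : ℝ)⁻¹ ∧ m * (n : ℝ)⁻¹ < β := by
        rw [← Real.exp_nat_mul, mul_neg] at hb
        exact mem_of_bump_ne_zero hαβ hb
      simp only [Function.comp_apply]
      rw [e]
      refine mul_le_mul_of_nonneg_left ?_ (by positivity)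
    · refine sY.tsum_le_tsum (fun m => ?_) sX
      by_cases hb : bump α β (Real.exp (-(n : ℝ)⁻¹) ^ m) = 0
      · simp [hb]
      · have h2 := ((hloc m hb).2.trans_le h1)
        rw [← div_eq_mul_inv, div_lt_one hn'] at h2
        have h3 : a m ≤ a n := hmono (by exact_mod_cast h2.le)
        have := bump_nonneg α β (Real.exp (-(n : ℝ)⁻¹) ^ m)
        rw [one_mul, mul_assoc]
        gcongr
    · refine sX.tsum_le_tsum (fun m => ?_) sY
      by_cases hb : bump α β (Real.exp (-(n : ℝ)⁻¹) ^ m) = 0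
      · simp [hb]
      · have h2 := (h1.trans_lt (hloc m hb).1)
        rw [← div_eq_mul_inv, one_lt_div hn'] at h2
        have h3 : a n ≤ a m := hmono (by exact_mod_cast h2.le)
        have := bump_nonneg α β (Real.exp (-(n : ℝ)⁻¹) ^ m)
        rw [one_mul, mul_assoc]
        gcongr
  have hcont : Tendsto (fun x : ℝ => x ^ d * K) (𝓝 1) (𝓝 K) := by
    have : Continuous fun x : ℝ => x ^ d * K := by fun_prop
    simpa using this.tendsto 1
  refine tendsto_order.2 ⟨fun b hb => ?_, fun b hb => ?_⟩
  · obtain ⟨α, hα1, hα2, hα⟩ : ∃ α : ℝ, α < 1 ∧ 0 ≤ α ∧ b < α ^ d * K := by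
      have h1 := (hcont.mono_left (nhdsWithin_le_nhds (s := Set.Iio 1))).eventually
        (eventually_gt_nhds hb)
      obtain ⟨α, ⟨h2, h3⟩, h4⟩ := ((h1.and (Ioo_mem_nhdsLT (zero_lt_one' ℝ))).and
        self_mem_nhdsWithin).exists
      exact ⟨α, h4, h3.1.le, h2⟩
    obtain ⟨X, Y, L, hX, hL, -, hYX, hle, -⟩ := key α 1 hα2 hα1
    filter_upwards [hX, hYX.eventually (eventually_gt_nhds (hα.trans_le hL)),
      eventually_gt_atTop 0] with n h1 h2 h3
    exact h2.trans_le ((div_le_iff₀ h1).2 (hle le_rfl n h3))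
  · obtain ⟨β, hβ1, hβ⟩ : ∃ β : ℝ, 1 < β ∧ β ^ d * K < b := by
      have h1 := (hcont.mono_left (nhdsWithin_le_nhds (s := Set.Ioi 1))).eventually
        (eventually_lt_nhds hb)
      obtain ⟨β, h2, h3⟩ := (h1.and self_mem_nhdsWithin).exists
      exact ⟨β, h3, h2⟩
    obtain ⟨X, Y, L, hX, -, hL, hYX, -, hle⟩ := key 1 β zero_le_one hβ1
    filter_upwards [hX, hYX.eventually (eventually_lt_nhds (hL.trans_lt hβ)),
      eventually_gt_atTop 0] with n h1 h2 h3
    exact ((le_div_iff₀ h1).2 (hle le_rfl n h3)).trans_lt h2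

lemma tendsto_permMoment_div_pow (i s : ℕ) :
    Tendsto (fun m : ℕ => permMoment (i + 1) (s + 1) m / (m : ℝ) ^ (i + 1)) atTop
      (𝓝 (G (s + 1) (i + 1))) :=
  tendsto_div_pow_of_abel (permMoment_mono _ _) (permMoment_nonneg _ _)
    (fun _ ht => summable_permMoment_mul_pow _ _ (Real.exp_pos _).le
      ((le_abs_self _).trans_lt (abs_exp_neg_lt_one ht))) (tendsto_permMoment_abel i s)

end Tauberian

end RandomMapping

/-! ### Moments under the uniform mapping as means over N. -/

namespace RandomMapping

section Moments

open Finset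

/-- The average of a function over the mappings of an `n`-element set into itself. -/
def mean (n : ℕ) (F : (Fin n → Fin n) → ℝ) : ℝ := (∑ f, F f) / (n : ℝ) ^ n

lemma integral_uniformMapping (n : ℕ) (F : (Fin n → Fin n) → ℝ) :
    ∫ f, F f ∂uniformMapping n = mean n F := by
  rw [uniformMapping, uniformOn, ProbabilityTheory.cond, integral_smul_measure,
    Measure.restrict_univ, integral_count, mean, Measure.count_univ]
  simp [div_eq_inv_mul]

lemma isProbabilityMeasure_uniformMapping {n : ℕ} (hn : n ≠ 0) :
    IsProbabilityMeasure (uniformMapping n) := by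
  have : NeZero n := ⟨hn⟩
  exact isProbabilityMeasure_uniformOn' Set.finite_univ Set.univ_nonempty MeasurableSet.univ

lemma variance_uniformMapping {n : ℕ} (hn : n ≠ 0) (F : (Fin n → Fin n) → ℝ) :
    variance F (uniformMapping n) = mean n (fun f => F f ^ 2) - mean n F ^ 2 := by
  have := isProbabilityMeasure_uniformMapping hn
  rw [variance_eq_sub (MemLp.of_discrete), ← integral_uniformMapping, ← integral_uniformMapping]
  rfl

lemma sq_mean_mul_le (n : ℕ) (F H : (Fin n → Fin n) → ℝ) :
    mean n (fun f => F f * H f) ^ 2 ≤ mean n (fun f => F f ^ 2) * mean n (fun f => H f ^ 2) := by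
  unfold mean
  rw [div_pow, div_mul_div_comm, ← sq]
  gcongr
  exact sum_mul_sq_le_sq_mul_sq _ _ _

/-- The probability that the first `m` values of a uniformly random sequence in an `n`-element set
are distinct. -/
def distinctProb (n m : ℕ) : ℝ := n.descFactorial m / (n : ℝ) ^ m

/-- The probability that a uniformly random mapping has exactly `m` cyclic points. -/
def cyclicProb (n m : ℕ) : ℝ := distinctProb n m * m / n

/-- The mean of `g N`, where `N` is the number of cyclic points of a random mapping. -/
def cyclicMean (n : ℕ) (g : ℕ → ℝ) : ℝ := ∑ m ∈ range (n + 1), cyclicProb n m * g m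

lemma distinctProb_zero (n : ℕ) : distinctProb n 0 = 1 := by simp [distinctProb]

lemma distinctProb_eq_zero {n m : ℕ} (h : n < m) : distinctProb n m = 0 := by
  simp [distinctProb, Nat.descFactorial_eq_zero_iff_lt.2 h]

lemma cyclicProb_nonneg (n m : ℕ) : 0 ≤ cyclicProb n m := by
  unfold cyclicProb distinctProb; positivity

/-- The tail P(N ≥ m) is thus `distinctProb n m`: N is distributed as the number of distinct values
before the first repetition in a uniform sequence. -/
lemma cyclicProb_eq_sub {n : ℕ} (hn : n ≠ 0) (m : ℕ) :
    cyclicProb n m = distinctProb n m - distinctProb n (m + 1) := by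
  have hn' : (n : ℝ) ≠ 0 := by exact_mod_cast hn
  rcases lt_or_ge n m with h | h
  · rw [cyclicProb, distinctProb_eq_zero h, distinctProb_eq_zero (h.trans m.lt_succ_self)]
    simp
  · unfold cyclicProb distinctProb
    rw [Nat.descFactorial_succ, Nat.cast_mul, Nat.cast_sub h]
    field_simp
    ring

lemma card_eq_cyclicProb {n : ℕ} (hn : n ≠ 0) (m k : ℕ) {r : ℕ} (hr : 1 ≤ r) :
    (#(univ.filter fun f : Fin n → Fin n => numCyclicPoints f = m ∧ ¬ k < longestCycle r f) : ℝ) =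
      n ^ n * cyclicProb n m * permProb k r m := by
  have hn' : (n : ℝ) ≠ 0 := by exact_mod_cast hn
  have h := card_joint n m k hr
  rw [← mul_right_inj' hn', h]
  rcases lt_or_ge n m with h | h
  · simp [cyclicProb, distinctProb, Nat.descFactorial_eq_zero_iff_lt.2 h]
  · rw [cyclicProb, distinctProb, ← Nat.sub_add_cancel h, pow_add, Nat.sub_add_cancel h]
    field_simp

/-- Read off from the counts: for fixed m the mappings with Λ_r ≤ m are as many as those with Λ_r ≤
K for any K ≥ m, since `permProb` is 1 for both. So the two sets coincide, and f lies in the second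
one for K = m + Λ_r(f). -/
lemma longestCycle_le_numCyclicPoints {n : ℕ} (hn : n ≠ 0) {r : ℕ} (hr : 1 ≤ r)
    (f : Fin n → Fin n) : longestCycle r f ≤ numCyclicPoints f := by
  set m := numCyclicPoints f with hm
  let S (k : ℕ) := univ.filter fun f : Fin n → Fin n =>
    numCyclicPoints f = m ∧ ¬ k < longestCycle r f
  set K := m + longestCycle r f
  have h1 : #(S m) = #(S K) := by
    have : (#(S m) : ℝ) = #(S K) := by
      rw [card_eq_cyclicProb hn m m hr, card_eq_cyclicProb hn m K hr, permProb_eq_one hr le_rfl,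
        permProb_eq_one hr (Nat.le_add_right _ _)]
    exact_mod_cast this
  have h2 : S m = S K := eq_of_subset_of_card_le (fun g hg => by
    simp only [S, mem_filter, mem_univ, true_and] at hg ⊢
    exact ⟨hg.1, by omega⟩) h1.ge
  have h3 : f ∈ S m := by
    rw [h2]
    simp [S, ← hm, K]
  simpa [S] using (mem_filter.1 h3).2.2

lemma card_numCyclicPoints {n : ℕ} (hn : n ≠ 0) (m : ℕ) :
    (#(univ.filter fun f : Fin n → Fin n => numCyclicPoints f = m) : ℝ) =
      n ^ n * cyclicProb n m := by
  have h := card_eq_cyclicProb hn m m le_rfl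
  rw [permProb_eq_one one_pos le_rfl, mul_one] at h
  rw [← h]
  congr 3
  ext f
  have := longestCycle_le_numCyclicPoints hn le_rfl f
  constructor
  · intro h; exact ⟨h, by omega⟩
  · exact fun h => h.1

lemma numCyclicPoints_le {n : ℕ} (f : Fin n → Fin n) : numCyclicPoints f ≤ n :=
  (card_le_univ _).trans_eq (Fintype.card_fin n)

lemma mean_eq_sum_fiber (n : ℕ) (F : (Fin n → Fin n) → ℝ) :
    mean n F = ∑ m ∈ range (n + 1),
      (∑ f ∈ univ.filter (fun f : Fin n → Fin n => numCyclicPoints f = m), F f) / (n : ℝ) ^ n := by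
  rw [mean, ← sum_div, sum_fiberwise_of_maps_to]
  exact fun f _ => mem_range.2 (Nat.lt_succ_of_le (numCyclicPoints_le f))

lemma mean_comp_numCyclicPoints {n : ℕ} (hn : n ≠ 0) (g : ℕ → ℝ) :
    mean n (fun f => g (numCyclicPoints f)) = cyclicMean n g := by
  have hn' : (n : ℝ) ≠ 0 := by exact_mod_cast hn
  rw [mean_eq_sum_fiber, cyclicMean]
  refine sum_congr rfl fun m _ => ?_
  rw [sum_congr rfl fun f hf => by rw [(mem_filter.1 hf).2], sum_const, nsmul_eq_mul,
    card_numCyclicPoints hn]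
  field_simp

lemma mean_longestCycle_pow_mul {n : ℕ} (hn : n ≠ 0) (h : ℕ) {r : ℕ} (hr : 1 ≤ r) (g : ℕ → ℝ) :
    mean n (fun f => (longestCycle r f : ℝ) ^ (h + 1) * g (numCyclicPoints f)) =
      cyclicMean n (fun m => permMoment (h + 1) r m * g m) := by
  have hn' : (n : ℝ) ≠ 0 := by exact_mod_cast hn
  rw [mean_eq_sum_fiber, cyclicMean]
  refine sum_congr rfl fun m _ => ?_
  set S := univ.filter fun f : Fin n → Fin n => numCyclicPoints f = m with hS
  have h1 : ∑ f ∈ S, (longestCycle r f : ℝ) ^ (h + 1) =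
      n ^ n * cyclicProb n m * permMoment (h + 1) r m := by
    -- A power is the telescoping sum of its increments below Λ_r, so the moment becomes a sum over
    -- k of P(Λ_r > k), as in `permMoment`.
    have e1 (f) (hf : f ∈ S) : (longestCycle r f : ℝ) ^ (h + 1) =
        ∑ k ∈ range m, if k < longestCycle r f then ((k + 1 : ℝ) ^ (h + 1) - k ^ (h + 1)) else 0 := by
      have hle := longestCycle_le_numCyclicPoints hn hr f
      rw [(mem_filter.1 hf).2] at hle
      rw [← sum_filter, show (range m).filter (· < longestCycle r f) = range (longestCycle r f) by
        ext; simp only [mem_filter, mem_range]; omega]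
      have := sum_range_sub (fun k : ℕ => (k : ℝ) ^ (h + 1)) (longestCycle r f)
      push_cast at this
      rw [this]
      simp
    rw [sum_congr rfl e1, sum_comm, permMoment, mul_sum]
    refine sum_congr rfl fun k _ => ?_
    rw [← sum_filter, sum_const, nsmul_eq_mul]
    have e2 := card_filter_add_card_filter_not (s := S) fun f => k < longestCycle r f
    have e3 := card_eq_cyclicProb hn m k hr
    rw [← filter_filter, ← hS] at e3
    have e4 := card_numCyclicPoints hn m
    rw [← hS, ← e2, Nat.cast_add, e3] at e4
    rw [eq_sub_of_add_eq e4]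
    ring
  rw [sum_congr rfl fun f hf => by rw [(mem_filter.1 hf).2], ← sum_mul, h1]
  field_simp

lemma sum_mul_sub_succ (u q : ℕ → ℝ) (M : ℕ) :
    ∑ m ∈ range M, (q m - q (m + 1)) * u m =
      u 0 * q 0 + ∑ m ∈ range M, (u (m + 1) - u m) * q (m + 1) - u M * q M := by
  induction M with
  | zero => simp
  | succ M ih => rw [sum_range_succ, ih, sum_range_succ]; ring

lemma cyclicMean_eq_sum {n : ℕ} (hn : n ≠ 0) (u : ℕ → ℝ) :
    cyclicMean n u = u 0 + ∑ m ∈ range (n + 1), (u (m + 1) - u m) * distinctProb n (m + 1) := by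
  unfold cyclicMean
  simp_rw [cyclicProb_eq_sub hn]
  rw [sum_mul_sub_succ, distinctProb_zero, distinctProb_eq_zero n.lt_succ_self]
  ring

lemma cyclicMean_one {n : ℕ} (hn : n ≠ 0) : cyclicMean n (fun _ => 1) = 1 := by
  simp [cyclicMean_eq_sum hn]

lemma one_add_cyclicMean_id {n : ℕ} (hn : n ≠ 0) :
    1 + cyclicMean n (fun m => m) = ∑ m ∈ range (n + 1), distinctProb n m := by
  have h := sum_range_succ' (distinctProb n) (n + 1)
  rw [sum_range_succ, distinctProb_eq_zero n.lt_succ_self, distinctProb_zero, add_zero] at h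
  rw [cyclicMean_eq_sum hn, h]
  simp [add_comm]

/-- By partial summation E(N² + N) is the sum of 2m P(N ≥ m). Since m P(N ≥ m) = n P(N = m), this is
2n. -/
lemma cyclicMean_sq {n : ℕ} (hn : n ≠ 0) :
    cyclicMean n (fun m => (m : ℝ) ^ 2) = 2 * n - cyclicMean n (fun m => m) := by
  have hn' : (n : ℝ) ≠ 0 := by exact_mod_cast hn
  have h1 : ∑ m ∈ range (n + 1), (m + 1 : ℝ) * distinctProb n (m + 1) = n := by
    have h2 := sum_range_succ' (fun m => n * cyclicProb n m) (n + 1)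
    have h3 := cyclicMean_one hn
    simp only [cyclicMean, mul_one] at h3
    rw [sum_range_succ, ← mul_sum, h3] at h2
    simp only [cyclicProb, distinctProb_eq_zero n.lt_succ_self] at h2
    simp only [Nat.cast_zero, mul_zero, zero_mul, zero_div, add_zero, mul_one] at h2
    rw [h2]
    refine sum_congr rfl fun m _ => ?_
    push_cast
    field_simp
  rw [cyclicMean_eq_sum hn, cyclicMean_eq_sum hn, ← h1, mul_sum]
  simp only [Nat.cast_zero]
  rw [← sub_eq_zero, sub_add_eq_sub_sub, sub_zero, zero_pow two_ne_zero, zero_add,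
    ← sum_sub_distrib, ← sum_sub_distrib]
  refine sum_eq_zero fun m _ => ?_
  push_cast
  ring

end Moments

end RandomMapping

/-! ### Asymptotics of the number of cyclic points. -/

namespace RandomMapping

section MeanCyclic

/-- Expanding the power binomially, each term integrates to m! times `n.choose m` / n^m. The
integral form is suited to Laplace's method. -/
lemma sum_distinctProb_eq_integral (n : ℕ) :
    ∑ m ∈ Finset.range (n + 1), distinctProb n m =
      ∫ x in Set.Ioi (0 : ℝ), (1 + x / n) ^ n * Real.exp (-x) := by
  have h1 (x : ℝ) : (1 + x / n) ^ n * Real.exp (-x) = ∑ m ∈ Finset.range (n + 1),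
      ((n.choose m : ℝ) / (n : ℝ) ^ m) * (x ^ m * Real.exp (-x)) := by
    rw [add_comm, add_pow, Finset.sum_mul]
    refine Finset.sum_congr rfl fun m _ => ?_
    rw [one_pow, div_pow]
    ring
  simp_rw [h1]
  rw [integral_finsetSum _ fun m _ => (integrableOn_pow_mul_exp_neg m).const_mul _]
  refine Finset.sum_congr rfl fun m _ => ?_
  have h2 := integral_pow_mul_exp_neg_mul m 0
  simp only [Nat.cast_zero, zero_add, one_mul, one_pow, div_one] at h2
  rw [integral_const_mul, h2, distinctProb, Nat.descFactorial_eq_factorial_mul_choose,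
    Nat.cast_mul]
  ring

/-- The right-hand side is sinh(log(1 + v)), and y ≤ sinh y for y ≥ 0. -/
lemma log_one_add_le {v : ℝ} (hv : 0 ≤ v) :
    Real.log (1 + v) ≤ v - v ^ 2 / (2 * (1 + v)) := by
  have h1 := Real.self_le_sinh_iff.2 (Real.log_nonneg (show 1 ≤ 1 + v by linarith))
  rw [Real.sinh_log (by linarith)] at h1
  refine h1.trans_eq ?_
  have : 1 + v ≠ 0 := by positivity
  field_simp
  ring

lemma pow_mul_exp_eq {n : ℕ} {u : ℝ} (hu : 0 < u) :
    (1 + u / √n) ^ n * Real.exp (-(√n * u)) =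
      Real.exp (n * Real.log (1 + u / √n) - √n * u) := by
  have : 0 < 1 + u / √n := by positivity
  rw [sub_eq_add_neg, Real.exp_add, Real.exp_nat_mul, Real.exp_log this]

lemma tendsto_pow_mul_exp {u : ℝ} (hu : 0 < u) :
    Tendsto (fun n : ℕ => (1 + u / √n) ^ n * Real.exp (-(√n * u))) atTop
      (𝓝 (Real.exp (-(1 / 2) * u ^ 2))) := by
  simp_rw [pow_mul_exp_eq hu]
  refine (Real.continuous_exp.tendsto _).comp ?_
  have hs : Tendsto (fun n : ℕ => √(n : ℝ)) atTop atTop :=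
    Real.tendsto_sqrt_atTop.comp tendsto_natCast_atTop_atTop
  have hv : Tendsto (fun n : ℕ => u / √(n : ℝ)) atTop (𝓝 0) := hs.const_div_atTop u
  have hb : Tendsto (fun n : ℕ => u ^ 2 * (u / √(n : ℝ)) / (1 - u / √n)) atTop (𝓝 0) := by
    have := Tendsto.div (hv.const_mul (u ^ 2)) (hv.const_sub 1) (by norm_num)
    rwa [mul_zero, zero_div] at this
  rw [tendsto_iff_norm_sub_tendsto_zero]
  refine squeeze_zero' (Eventually.of_forall fun _ => norm_nonneg _) ?_ hb
  filter_upwards [hv.eventually (eventually_lt_nhds one_pos), eventually_gt_atTop 0] with n h1 hn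
  have hn' : (0 : ℝ) < n := by exact_mod_cast hn
  have hs' : 0 < √(n : ℝ) := Real.sqrt_pos.2 hn'
  have hv0 : 0 < u / √(n : ℝ) := by positivity
  have h2 := Real.abs_log_sub_add_sum_range_le (x := -(u / √n))
    (by rwa [abs_neg, abs_of_pos hv0]) 2
  rw [abs_neg, abs_of_pos hv0] at h2
  set v := u / √(n : ℝ) with hvdef
  have hsq : √(n : ℝ) ^ 2 = n := Real.sq_sqrt hn'.le
  have huv : u = v * √n := by rw [hvdef]; field_simp
  -- With v = u/√n, the linear and quadratic terms of the logarithm cancel, and the cubic remainder,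
  -- multiplied by n, is at most u² v / (1 - v), which tends to 0.
  have e : n * Real.log (1 + v) - √n * u - -(1 / 2) * u ^ 2 =
      n * ((∑ i ∈ Finset.range 2, (-v) ^ (i + 1) / ((i : ℝ) + 1)) + Real.log (1 - -v)) := by
    rw [Finset.sum_range_succ, Finset.sum_range_one, huv, sub_neg_eq_add]
    push_cast
    linear_combination (v ^ 2 / 2 - v) * hsq
  rw [e, Real.norm_eq_abs, abs_mul, abs_of_pos hn']
  calc _ ≤ (n : ℝ) * (v ^ (2 + 1) / (1 - v)) := by gcongr
    _ = _ := by
        rw [huv]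
        linear_combination (-(v ^ 3 / (1 - v))) * hsq

lemma pow_mul_exp_le {n : ℕ} (hn : 0 < n) {u : ℝ} (hu : 0 < u) :
    (1 + u / √n) ^ n * Real.exp (-(√n * u)) ≤ Real.exp (1 / 2) * Real.exp (-(1 / 2) * u) := by
  rw [pow_mul_exp_eq hu, ← Real.exp_add, Real.exp_le_exp]
  have hn1 : (1 : ℝ) ≤ n := by exact_mod_cast hn
  have hs1 : 1 ≤ √(n : ℝ) := Real.one_le_sqrt.2 hn1
  have hsq : √(n : ℝ) ^ 2 = n := Real.sq_sqrt (by linarith)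
  have h1 := log_one_add_le (v := u / √n) (by positivity)
  have h2 : (n : ℝ) * (u / √n - (u / √n) ^ 2 / (2 * (1 + u / √n))) =
      √n * u - u ^ 2 / (2 * (1 + u / √n)) := by
    have h5 : (n : ℝ) = √n * √n := by rw [← sq, hsq]
    generalize √(n : ℝ) = s at *
    rw [h5]
    field_simp
  -- As √n ≥ 1, the Gaussian-like exponent is at least u² / (2(1 + u)) ≥ (u - 1)/2, a majorant
  -- independent of n.
  have h3 : (u - 1) / 2 ≤ u ^ 2 / (2 * (1 + u / √n)) := by
    calc (u - 1) / 2 ≤ u ^ 2 / (2 * (1 + u)) := by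
          rw [div_le_div_iff₀ two_pos (by positivity)]; nlinarith
      _ ≤ _ := by
          gcongr
          exact div_le_self hu.le hs1
  have h4 := mul_le_mul_of_nonneg_left h1 (show (0 : ℝ) ≤ n by positivity)
  rw [h2] at h4
  linarith

lemma tendsto_sum_distinctProb_div_sqrt :
    Tendsto (fun n : ℕ => (∑ m ∈ Finset.range (n + 1), distinctProb n m) / √n) atTop
      (𝓝 √(Real.pi / 2)) := by
  have h1 : Tendsto (fun n : ℕ => ∫ u in Set.Ioi (0 : ℝ),
      (1 + u / √n) ^ n * Real.exp (-(√n * u))) atTop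
      (𝓝 (∫ u in Set.Ioi (0 : ℝ), Real.exp (-(1 / 2) * u ^ 2))) := by
    refine tendsto_integral_filter_of_dominated_convergence
      (fun u => Real.exp (1 / 2) * Real.exp (-(1 / 2) * u)) ?_ ?_ ?_ ?_
    · refine Eventually.of_forall fun n => Continuous.aestronglyMeasurable ?_
      fun_prop
    · filter_upwards [eventually_gt_atTop 0] with n hn
      refine (ae_restrict_iff' measurableSet_Ioi).2 (Eventually.of_forall fun u hu => ?_)
      have hu' : 0 < u := hu
      rw [Real.norm_of_nonneg (by positivity)]
      exact pow_mul_exp_le hn hu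
    · exact (exp_neg_integrableOn_Ioi 0 (by norm_num : (0 : ℝ) < 1 / 2)).const_mul _
    · exact (ae_restrict_iff' measurableSet_Ioi).2
        (Eventually.of_forall fun u hu => tendsto_pow_mul_exp hu)
  rw [integral_gaussian_Ioi] at h1
  have h2 : √(Real.pi / (1 / 2)) / 2 = √(Real.pi / 2) := by
    rw [show Real.pi / (1 / 2) = 2 ^ 2 * (Real.pi / 2) by ring, Real.sqrt_mul (by norm_num),
      Real.sqrt_sq two_pos.le]
    ring
  rw [h2] at h1
  refine h1.congr' ?_
  filter_upwards [eventually_gt_atTop 0] with n hn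
  have hn' : (0 : ℝ) < n := by exact_mod_cast hn
  have hs' : 0 < √(n : ℝ) := Real.sqrt_pos.2 hn'
  have h3 := integral_comp_mul_left_Ioi (fun x : ℝ => (1 + x / n) ^ n * Real.exp (-x)) 0 hs'
  rw [mul_zero, ← sum_distinctProb_eq_integral, smul_eq_mul] at h3
  rw [div_eq_inv_mul, ← h3]
  refine setIntegral_congr_fun measurableSet_Ioi fun u _ => ?_
  have : √(n : ℝ) * u / n = u / √n := by
    rw [mul_comm, ← mul_div, Real.sqrt_div_self', mul_one_div]
  simp only [this]

lemma tendsto_sqrt_natCast_atTop : Tendsto (fun n : ℕ => √(n : ℝ)) atTop atTop :=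
  Real.tendsto_sqrt_atTop.comp tendsto_natCast_atTop_atTop

lemma tendsto_cyclicMean_id :
    Tendsto (fun n : ℕ => cyclicMean n (fun m => m) / √n) atTop (𝓝 √(Real.pi / 2)) := by
  have h := tendsto_sum_distinctProb_div_sqrt.sub (tendsto_sqrt_natCast_atTop.const_div_atTop 1)
  rw [sub_zero] at h
  refine h.congr' ?_
  filter_upwards [eventually_ne_atTop 0] with n hn
  rw [← one_add_cyclicMean_id hn]
  ring

lemma tendsto_cyclicMean_sq :
    Tendsto (fun n : ℕ => cyclicMean n (fun m => (m : ℝ) ^ 2) / √n ^ 2) atTop (𝓝 2) := by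
  have h := (tendsto_cyclicMean_id.mul
    (tendsto_sqrt_natCast_atTop.const_div_atTop 1)).const_sub 2
  rw [mul_zero, sub_zero] at h
  refine h.congr' ?_
  filter_upwards [eventually_ne_atTop 0] with n hn
  have hn' : (0 : ℝ) < n := by positivity
  have hs' : 0 < √(n : ℝ) := Real.sqrt_pos.2 hn'
  rw [cyclicMean_sq hn, sub_div, Real.sq_sqrt hn'.le]
  conv_rhs => rw [mul_div_cancel_right₀ _ hn'.ne']
  congr 1
  conv_rhs => rw [← Real.sq_sqrt hn'.le]
  field_simp

/-- For every ε there is C with |c m - L m^d| ≤ ε m^d + C for all m. The mean of the first term is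
O(ε √n^d), and C is negligible against √n^d because d ≠ 0. -/
lemma tendsto_cyclicMean {c : ℕ → ℝ} {d : ℕ} (hd : d ≠ 0) {K L : ℝ}
    (hK : Tendsto (fun n : ℕ => cyclicMean n (fun m => (m : ℝ) ^ d) / √n ^ d) atTop (𝓝 K))
    (hc : Tendsto (fun m : ℕ => c m / (m : ℝ) ^ d) atTop (𝓝 L)) :
    Tendsto (fun n : ℕ => cyclicMean n c / √n ^ d) atTop (𝓝 (L * K)) := by
  have h1 (n : ℕ) : cyclicMean n c - L * cyclicMean n (fun m => (m : ℝ) ^ d) =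
      cyclicMean n fun m => c m - L * (m : ℝ) ^ d := by
    simp only [cyclicMean, Finset.mul_sum, ← Finset.sum_sub_distrib]
    exact Finset.sum_congr rfl fun m _ => by ring
  have key (ε : ℝ) (hε : 0 < ε) : ∃ C : ℝ, 0 ≤ C ∧
      ∀ m : ℕ, |c m - L * (m : ℝ) ^ d| ≤ ε * (m : ℝ) ^ d + C := by
    rw [Metric.tendsto_atTop] at hc
    obtain ⟨M, hM⟩ := hc ε hε
    have hnn (m : ℕ) : 0 ≤ |c m - L * (m : ℝ) ^ d| := abs_nonneg _
    refine ⟨∑ m ∈ Finset.range (M + 1), |c m - L * (m : ℝ) ^ d|,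
      Finset.sum_nonneg fun m _ => hnn m, fun m => ?_⟩
    rcases lt_or_ge m (M + 1) with h | h
    · have h2 := Finset.single_le_sum (fun m _ => hnn m) (Finset.mem_range.2 h)
      have : 0 ≤ ε * (m : ℝ) ^ d := by positivity
      linarith
    · have h2 := hM m (by omega)
      have hm : (0 : ℝ) < (m : ℝ) ^ d := by
        have : (0 : ℝ) < m := by exact_mod_cast (by omega : 0 < m)
        positivity
      rw [Real.dist_eq, div_sub' hm.ne', abs_div, abs_of_pos hm, div_lt_iff₀ hm, mul_comm _ L] at h2
      have := Finset.sum_nonneg (s := Finset.range (M + 1)) fun m _ => hnn m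
      linarith
  have h2 : Tendsto (fun n : ℕ => (cyclicMean n fun m => c m - L * (m : ℝ) ^ d) / √n ^ d) atTop
      (𝓝 0) := by
    rw [Metric.tendsto_nhds]
    intro ε hε
    have hK' : 0 < |K| + 1 := by positivity
    obtain ⟨C, hC0, hC⟩ := key (ε / 2 / (|K| + 1)) (by positivity)
    have h3 : Tendsto (fun n : ℕ => C / √(n : ℝ) ^ d) atTop (𝓝 0) :=
      ((tendsto_pow_atTop hd).comp tendsto_sqrt_natCast_atTop).const_div_atTop C
    filter_upwards [h3.eventually (eventually_lt_nhds (half_pos hε)),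
      hK.eventually (eventually_lt_nhds (show K < |K| + 1 by linarith [le_abs_self K])),
      eventually_ne_atTop 0] with n h4 h5 hn
    have hn' : (0 : ℝ) < n := by positivity
    have hs' : 0 < √(n : ℝ) ^ d := pow_pos (Real.sqrt_pos.2 hn') d
    rw [dist_zero_right, norm_div, Real.norm_of_nonneg hs'.le]
    have h6 : ‖cyclicMean n fun m => c m - L * (m : ℝ) ^ d‖ ≤
        ε / 2 / (|K| + 1) * cyclicMean n (fun m => (m : ℝ) ^ d) + C := by
      calc _ ≤ cyclicMean n fun m => ε / 2 / (|K| + 1) * (m : ℝ) ^ d + C * 1 := by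
            refine norm_sum_le_of_le _ fun m _ => ?_
            rw [norm_mul, Real.norm_of_nonneg (cyclicProb_nonneg n m), mul_one]
            exact mul_le_mul_of_nonneg_left (hC m) (cyclicProb_nonneg n m)
        _ = ε / 2 / (|K| + 1) * cyclicMean n (fun m => (m : ℝ) ^ d) +
            C * cyclicMean n (fun _ => 1) := by
            simp only [cyclicMean, Finset.mul_sum, ← Finset.sum_add_distrib]
            exact Finset.sum_congr rfl fun m _ => by ring
        _ = _ := by rw [cyclicMean_one hn, mul_one]
    calc _ ≤ (ε / 2 / (|K| + 1) * cyclicMean n (fun m => (m : ℝ) ^ d) + C) / √n ^ d := by gcongr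
      _ = ε / 2 / (|K| + 1) * (cyclicMean n (fun m => (m : ℝ) ^ d) / √n ^ d) + C / √n ^ d := by
          ring
      _ < ε / 2 / (|K| + 1) * (|K| + 1) + ε / 2 := by
          refine add_lt_add (mul_lt_mul_of_pos_left h5 (by positivity)) h4
      _ = ε := by field_simp; ring
  have h3 := h2.add (hK.const_mul L)
  rw [zero_add] at h3
  refine h3.congr fun n => ?_
  rw [← h1]
  ring

end MeanCyclic

end RandomMapping

/-! ### The limit of the correlation coefficient. -/

namespace RandomMapping

section Correlation

lemma tendsto_mean_longestCycle {r : ℕ} (hr : 1 ≤ r) :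
    Tendsto (fun n : ℕ => mean n (fun f => (longestCycle r f : ℝ)) / √n) atTop
      (𝓝 (G r 1 * √(Real.pi / 2))) := by
  obtain ⟨s, rfl⟩ := Nat.exists_eq_add_of_le' hr
  have h := tendsto_cyclicMean (d := 1) (K := √(Real.pi / 2)) one_ne_zero (by simpa only [pow_one] using tendsto_cyclicMean_id)
    (tendsto_permMoment_div_pow 0 s)
  refine h.congr' ?_
  filter_upwards [eventually_ne_atTop 0] with n hn
  have := mean_longestCycle_pow_mul hn 0 hr fun _ => 1
  simp only [zero_add, pow_one, mul_one] at this ⊢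
  rw [this]

lemma tendsto_mean_longestCycle_mul {r : ℕ} (hr : 1 ≤ r) :
    Tendsto (fun n : ℕ => mean n (fun f => (longestCycle r f : ℝ) * numCyclicPoints f) / √n ^ 2)
      atTop (𝓝 (G r 1 * 2)) := by
  obtain ⟨s, rfl⟩ := Nat.exists_eq_add_of_le' hr
  have hc : Tendsto (fun m : ℕ => permMoment 1 (s + 1) m * (m : ℝ) / (m : ℝ) ^ 2) atTop
      (𝓝 (G (s + 1) 1)) := by
    refine (tendsto_permMoment_div_pow 0 s).congr' ?_
    filter_upwards [eventually_ne_atTop 0] with m hm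
    have : (m : ℝ) ≠ 0 := by exact_mod_cast hm
    rw [zero_add]
    field_simp
  refine (tendsto_cyclicMean two_ne_zero tendsto_cyclicMean_sq hc).congr' ?_
  filter_upwards [eventually_ne_atTop 0] with n hn
  have := mean_longestCycle_pow_mul hn 0 hr fun m => m
  simp only [zero_add, pow_one] at this
  rw [this]

lemma tendsto_mean_longestCycle_sq {r : ℕ} (hr : 1 ≤ r) :
    Tendsto (fun n : ℕ => mean n (fun f => (longestCycle r f : ℝ) ^ 2) / √n ^ 2) atTop
      (𝓝 (G r 2 * 2)) := by
  obtain ⟨s, rfl⟩ := Nat.exists_eq_add_of_le' hr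
  refine (tendsto_cyclicMean two_ne_zero tendsto_cyclicMean_sq
    (tendsto_permMoment_div_pow 1 s)).congr' ?_
  filter_upwards [eventually_ne_atTop 0] with n hn
  have := mean_longestCycle_pow_mul hn 1 hr fun _ => 1
  simp only [mul_one] at this
  rw [this]

lemma tendsto_mean_numCyclicPoints :
    Tendsto (fun n : ℕ => mean n (fun f => (numCyclicPoints f : ℝ)) / √n) atTop
      (𝓝 √(Real.pi / 2)) := by
  refine tendsto_cyclicMean_id.congr' ?_
  filter_upwards [eventually_ne_atTop 0] with n hn
  rw [← mean_comp_numCyclicPoints hn]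

lemma tendsto_mean_numCyclicPoints_sq :
    Tendsto (fun n : ℕ => mean n (fun f => (numCyclicPoints f : ℝ) ^ 2) / √n ^ 2) atTop
      (𝓝 2) := by
  refine tendsto_cyclicMean_sq.congr' ?_
  filter_upwards [eventually_ne_atTop 0] with n hn
  rw [← mean_comp_numCyclicPoints hn]

/-- The limit of E(Λ_r N)² ≤ E(Λ_r²) E(N²), divided by n², is (2 G_{r,1})² ≤ 2 G_{r,2} · 2. -/
lemma sq_G_one_le {r : ℕ} (hr : 1 ≤ r) : G r 1 ^ 2 ≤ G r 2 := by
  have h := le_of_tendsto_of_tendsto' ((tendsto_mean_longestCycle_mul hr).pow 2)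
    ((tendsto_mean_longestCycle_sq hr).mul tendsto_mean_numCyclicPoints_sq) fun n => by
      rw [div_pow, div_mul_div_comm, ← sq]
      exact div_le_div_of_nonneg_right (sq_mean_mul_le n _ _) (by positivity)
  linarith

theorem tendsto_correlation {r : ℕ} (hr : 1 ≤ r) :
    Tendsto (fun n : ℕ => correlation (fun f : Fin n → Fin n => (longestCycle r f : ℝ))
      (fun f : Fin n → Fin n => (numCyclicPoints f : ℝ)) (uniformMapping n)) atTop
      (𝓝 (limitCorrelation r)) := by
  have hG : 0 < G r 1 := by
    obtain ⟨s, rfl⟩ := Nat.exists_eq_add_of_le' hr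
    exact G_pos s 0
  have hsq : √(Real.pi / 2) ^ 2 = Real.pi / 2 := Real.sq_sqrt (by positivity)
  have hpi : 0 < 2 - Real.pi / 2 := by linarith [Real.pi_lt_four]
  -- By `sq_G_one_le` this is at least (2 - π/2) G_{r,1}² > 0, so the limiting denominator is not
  -- zero and the quotient of limits is legitimate.
  have hvar : 0 < 2 * G r 2 - Real.pi / 2 * G r 1 ^ 2 := by
    have h1 := mul_pos hpi (pow_pos hG 2)
    linarith [sq_G_one_le hr]
  have hX := (tendsto_mean_longestCycle_sq hr).sub ((tendsto_mean_longestCycle hr).pow 2)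
  have hY := tendsto_mean_numCyclicPoints_sq.sub (tendsto_mean_numCyclicPoints.pow 2)
  have hXY := (tendsto_mean_longestCycle_mul hr).sub
    ((tendsto_mean_longestCycle hr).mul tendsto_mean_numCyclicPoints)
  rw [mul_pow, hsq, show G r 2 * 2 - G r 1 ^ 2 * (Real.pi / 2) =
    2 * G r 2 - Real.pi / 2 * G r 1 ^ 2 by ring] at hX
  rw [hsq] at hY
  rw [mul_assoc, ← sq, hsq, ← mul_sub] at hXY
  have h := hXY.div (hX.sqrt.mul hY.sqrt)
    (mul_pos (Real.sqrt_pos.2 hvar) (Real.sqrt_pos.2 hpi)).ne'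
  have e : limitCorrelation r = G r 1 * (2 - Real.pi / 2) /
      (√(2 * G r 2 - Real.pi / 2 * G r 1 ^ 2) * √(2 - Real.pi / 2)) := by
    rw [limitCorrelation, mul_comm (√(2 * G r 2 - _)), ← div_div, mul_div_assoc (G r 1),
      Real.div_sqrt, mul_comm]
  rw [e]
  refine h.congr' ?_
  filter_upwards [eventually_ne_atTop 0] with n hn
  have hn' : (0 : ℝ) < n := by positivity
  have hs : 0 < √(n : ℝ) := Real.sqrt_pos.2 hn'
  rw [correlation, variance_uniformMapping hn, variance_uniformMapping hn,
    integral_uniformMapping, integral_uniformMapping, integral_uniformMapping, Pi.div_apply,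
    div_pow, div_pow, ← sub_div, ← sub_div, Real.sqrt_div' _ (sq_nonneg _),
    Real.sqrt_div' _ (sq_nonneg _), Real.sqrt_sq hs.le, div_mul_div_comm, div_mul_div_comm, ← sq,
    ← sub_div, div_div_div_cancel_right₀ (pow_pos hs 2).ne']

end Correlation

end RandomMapping

end

theorem mainTheorem3 :
    (∀ r : ℕ, 1 ≤ r →
      Tendsto
        (fun n : ℕ =>
          RandomMapping.correlation
            (fun f : Fin n → Fin n => (RandomMapping.longestCycle r f : ℝ))
            (fun f : Fin n → Fin n => (RandomMapping.numCyclicPoints f : ℝ))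
            (RandomMapping.uniformMapping n))
        atTop (𝓝 (RandomMapping.limitCorrelation r))) ∧
    RandomMapping.limitCorrelation 1 ∈ Set.Ico (0.83298010 : ℝ) 0.83298011 ∧
    RandomMapping.limitCorrelation 2 ∈ Set.Ico (0.65486924 : ℝ) 0.65486925 ∧
    RandomMapping.limitCorrelation 3 ∈ Set.Ico (0.52094617 : ℝ) 0.52094618 ∧
    RandomMapping.limitCorrelation 4 ∈ Set.Ico (0.42505712 : ℝ) 0.42505713 :=
  ⟨fun _ hr => RandomMapping.tendsto_correlation hr, RandomMapping.limitCorrelation_numeric⟩
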